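/- For $n\ge 1$ let $K_n$ be the transition matrix of an irreducible birth and death chain on $\{0,1,\dots,n\}$ (so $K_n(i,j)=0$ when $|i-j|>1$), with stationary distribution $\pi_n$, and let $\lambda_n$ be the smallest non-zero eigenvalue of $I-K_n$. Let $(X^{(n)}_m)_{m\ge 0}$ be a Markov chain with transition matrix $K_n$ and $(N_t)_{t\ge 0}$ an independent Poisson process with parameter $1$. For $i\in\{0,\dots,n\}$ set $$\tau^{(n)}_i=\inf\{m\ge 0: X^{(n)}_m=i\},\qquad \widetilde\tau^{(n)}_i=\inf\{t\ge 0: X^{(n)}_{N_t}=i\},$$ and let $\mathbb{E}_j,\mathrm{Var}_j$ be the expectation and variance given $X^{(n)}_0=j$. Let $\mathrm{sep}(\mu,\nu)=\max_x\{1-\mu(x)/\nu(x)\}$ and $H_{n,t}=e^{-t(I-K_n)}$. For $\epsilon\in(0,1)$ the separation mixing times from state $0$ are $$T_n(\epsilon)=\min\{m\in\{0,1,2,\dots\}: \mathrm{sep}(K_n^m(0,\cdot),\pi_n)\le\epsilon\},\qquad T^{(c)}_n(\epsilon)=\min\{t\ge 0: \mathrm{sep}(H_{n,t}(0,\cdot),\pi_n)\le\epsilon\}$$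 in discrete time (family $\mathcal F^L$) and in continuous time (family $\mathcal F^L_c$), respectively. A family with mixing times $T_n(\epsilon)$ has a separation cutoff if there are $t_n>0$ with $T_n(\epsilon)/t_n\to 1$ for all $\epsilon\in(0,1)$. For sequences $t_n,b_n$ it has a $(t_n,b_n)$ separation cutoff if it has a separation cutoff, $t_n>0$, $b_n>0$, $b_n/t_n\to 0$ and $\limsup_n |T_n(\epsilon)-t_n|/b_n<\infty$ for all $\epsilon\in(0,1)$. **Theorem 1.3.** Let $M_n\in\{0,1,\dots,n\}$ satisfy $$\inf_{n\ge 1}\pi_n([0,M_n])>0,\qquad \inf_{n\ge 1}\pi_n([M_n,n])>0 .$$ Then $\tau^{(n)}_{M_n}$ and $\widetilde\tau^{(n)}_{M_n}$, started at $0$ or at $n$, are almost surely finite with finite second moments, and $$s_n:=\mathbb{E}_0\widetilde\tau^{(n)}_{M_n}+\mathbb{E}_n\widetilde\tau^{(n)}_{M_n}=\mathbb{E}_0\tau^{(n)}_{M_n}+\mathbb{E}_n\tau^{(n)}_{M_n}.$$ Define $b_n,c_n\ge 0$ by $$b_n^2=\mathrm{Var}_0\widetilde\tau^{(n)}_{M_n}+\mathrm{Var}_n\widetilde\tau^{(n)}_{M_n},\qquad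 c_n^2=\mathrm{Var}_0\tau^{(n)}_{M_n}+\mathrm{Var}_n\tau^{(n)}_{M_n}.$$ 1. $\mathcal F^L_c$ has a separation cutoff if and only if $s_n\lambda_n\to\infty$, if and only if $s_n/b_n\to\infty$. Furthermore, if $s_n/b_n\to\infty$, then $\mathcal F^L_c$ has an $(s_n,b_n)$ separation cutoff. 2. Assume that $K_n(i,i+1)+K_n(i+1,i)\le 1$ for all $n\ge 1$ and $0\le i<n$. Then $\mathcal F^L$ has a separation cutoff if and only if $s_n\lambda_n\to\infty$, if and only if $s_n/c_n\to\infty$. Furthermore, if $s_n/c_n\to\infty$, then $\mathcal F^L$ has an $(s_n,\max\{c_n,1/\lambda_n\})$ separation cutoff. -/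

import Mathlib

open MeasureTheory ProbabilityTheory Filter Topology
open scoped NNReal ENNReal

namespace BDCutoff

/-! ### Birth and death chains on `{0, …, n}` -/

/-- Transition matrix of a birth and death chain on `{0, …, n}`: a stochastic matrix whose only
nonzero entries are `K i (i+1)`, `K i (i-1)` and `K i i`. -/
structure IsBirthDeath {n : ℕ} (K : Matrix (Fin (n + 1)) (Fin (n + 1)) ℝ) : Prop where
  stochastic : K ∈ Matrix.rowStochastic ℝ (Fin (n + 1))
  nearest : ∀ i j : Fin (n + 1), (i : ℕ) + 1 < j ∨ (j : ℕ) + 1 < i → K i j = 0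

/-- `μ` is a probability vector with `μ K = μ`. -/
structure IsStationary {n : ℕ} (K : Matrix (Fin (n + 1)) (Fin (n + 1)) ℝ)
    (μ : Fin (n + 1) → ℝ) : Prop where
  nonneg : ∀ i, 0 ≤ μ i
  sum_eq_one : ∑ i, μ i = 1
  invariant : Matrix.vecMul μ K = μ

/-- The smallest nonzero eigenvalue of `I - K` (the minimum of a finite set, nonempty for
irreducible `K` and `n ≥ 1`). -/
noncomputable def spectralGap {n : ℕ} (K : Matrix (Fin (n + 1)) (Fin (n + 1)) ℝ) : ℝ :=
  sInf {l : ℝ | l ≠ 0 ∧ Module.End.HasEigenvalue (Matrix.toLin' (1 - K)) l}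

/-! ### Separation and mixing times -/

/-- `sep(μ, ν) = max_x (1 - μ x / ν x)`. -/
noncomputable def sep {n : ℕ} (μ ν : Fin (n + 1) → ℝ) : ℝ :=
  ⨆ x, (1 - μ x / ν x)

/-- Transition semigroup `H_t = exp(-t (I - K))` of the associated continuous time chain. -/
noncomputable def heat {n : ℕ} (K : Matrix (Fin (n + 1)) (Fin (n + 1)) ℝ) (t : ℝ) :
    Matrix (Fin (n + 1)) (Fin (n + 1)) ℝ :=
  NormedSpace.exp ((-t) • (1 - K))

/-- Discrete time separation mixing time started at `x`:
`min {m ≥ 0 | sep(K^m(x,·), μ) ≤ ε}`. -/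
noncomputable def sepTime {n : ℕ} (K : Matrix (Fin (n + 1)) (Fin (n + 1)) ℝ)
    (μ : Fin (n + 1) → ℝ) (x : Fin (n + 1)) (ε : ℝ) : ℕ :=
  sInf {m : ℕ | sep ((K ^ m) x) μ ≤ ε}

/-- Continuous time separation mixing time started at `x`:
`min {t ≥ 0 | sep(H_t(x,·), μ) ≤ ε}`. -/
noncomputable def sepTimeC {n : ℕ} (K : Matrix (Fin (n + 1)) (Fin (n + 1)) ℝ)
    (μ : Fin (n + 1) → ℝ) (x : Fin (n + 1)) (ε : ℝ) : ℝ :=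
  sInf {t : ℝ | 0 ≤ t ∧ sep (heat K t x) μ ≤ ε}

/-! ### Cutoff for a family indexed by `n ≥ 1` with mixing times `T n ε` -/

/-- There is a sequence of positive numbers `t n` with `T n ε / t n → 1` for all `0 < ε < 1`. -/
def HasCutoff (T : ℕ → ℝ → ℝ) : Prop :=
  ∃ t : ℕ → ℝ, (∀ n, 1 ≤ n → 0 < t n) ∧
    ∀ ε : ℝ, 0 < ε → ε < 1 → Tendsto (fun n => T n ε / t n) atTop (𝓝 1)

/-- A `(t n, b n)` cutoff: the family has a cutoff, `t n, b n > 0`, `b n / t n → 0`, and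
`limsup |T n ε - t n| / b n < ∞` for all `0 < ε < 1`. -/
structure HasCutoffWindow (T : ℕ → ℝ → ℝ) (t b : ℕ → ℝ) : Prop where
  cutoff : HasCutoff T
  time_pos : ∀ n, 1 ≤ n → 0 < t n
  window_pos : ∀ n, 1 ≤ n → 0 < b n
  window_small : Tendsto (fun n => b n / t n) atTop (𝓝 0)
  window : ∀ ε : ℝ, 0 < ε → ε < 1 → ∃ C : ℝ, ∀ᶠ n in atTop, |T n ε - t n| / b n ≤ C

/-! ### The Markov chain, the Poisson process and the hitting times -/

section Processes

variable {Ω : Type*} [MeasurableSpace Ω]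

/-- Under `P`, the process `X` is a Markov chain with transition matrix `K` and `X 0 = j`:
the probability of following a path `x 0, …, x (m+1)` is that of following `x 0, …, x m` times
`K (x m) (x (m+1))`. -/
structure IsMarkovChain {n : ℕ} (K : Matrix (Fin (n + 1)) (Fin (n + 1)) ℝ) (j : Fin (n + 1))
    (X : ℕ → Ω → Fin (n + 1)) (P : Measure Ω) : Prop where
  measurable : ∀ m, Measurable (X m)
  init : ∀ᵐ ω ∂P, X 0 ω = j
  step : ∀ (m : ℕ) (x : ℕ → Fin (n + 1)),
    P {ω | ∀ k ≤ m + 1, X k ω = x k} =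
      P {ω | ∀ k ≤ m, X k ω = x k} * ENNReal.ofReal (K (x m) (x (m + 1)))

/-- Under `P`, the process `N` is a Poisson process with parameter `1`: it counts almost surely
the terms, up to time `t`, of a strictly increasing sequence of positive arrival times tending to
infinity, its increments are independent, and `N t - N s` is Poisson with mean `t - s`. -/
structure IsPoissonProcess (N : ℝ≥0 → Ω → ℕ) (P : Measure Ω) : Prop where
  measurable : ∀ t, Measurable (N t)
  counting : ∀ᵐ ω ∂P, ∃ S : ℕ → ℝ≥0, 0 < S 0 ∧ StrictMono S ∧ Tendsto S atTop atTop ∧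
    ∀ t, N t ω = {k : ℕ | S k ≤ t}.ncard
  indep : HasIndepIncrements N P
  law : ∀ s t : ℝ≥0, s ≤ t → P.map (fun ω => N t ω - N s ω) = poissonMeasure (t - s)

/-- `τ_i = inf {m ≥ 0 | X_m = i}`, with value `∞` if `i` is never visited. -/
noncomputable def hit {n : ℕ} (X : ℕ → Ω → Fin (n + 1)) (i : Fin (n + 1)) (ω : Ω) : ℝ≥0∞ :=
  ⨅ (m : ℕ) (_ : X m ω = i), (m : ℝ≥0∞)

/-- `inf {t ≥ 0 | X_{N_t} = i}`, with value `∞` if `i` is never visited. -/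
noncomputable def hitC {n : ℕ} (X : ℕ → Ω → Fin (n + 1)) (N : ℝ≥0 → Ω → ℕ) (i : Fin (n + 1))
    (ω : Ω) : ℝ≥0∞ :=
  ⨅ (t : ℝ≥0) (_ : X (N t ω) ω = i), (t : ℝ≥0∞)

/-- The `[0,∞]`-valued random time `τ` is almost surely finite and square integrable, so that its
mean and variance are meaningful. -/
def HasMeanVar (τ : Ω → ℝ≥0∞) (P : Measure Ω) : Prop :=
  (∀ᵐ ω ∂P, τ ω ≠ ∞) ∧ MemLp (fun ω => (τ ω).toReal) 2 P

/-- Expectation of a random time. -/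
noncomputable def mean (τ : Ω → ℝ≥0∞) (P : Measure Ω) : ℝ :=
  ∫ ω, (τ ω).toReal ∂P

/-- Variance of a random time. -/
noncomputable def var (τ : Ω → ℝ≥0∞) (P : Measure Ω) : ℝ :=
  variance (fun ω => (τ ω).toReal) P

/-- `E_0 τ + E_n τ`, where `P j` is the law given that the chain starts at `j`. -/
noncomputable def endMean {n : ℕ} (P : Fin (n + 1) → Measure Ω) (τ : Ω → ℝ≥0∞) : ℝ :=
  mean τ (P 0) + mean τ (P (Fin.last n))

/-- `(Var_0 τ + Var_n τ)^{1/2}`, where `P j` is the law given that the chain starts at `j`. -/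
noncomputable def endDev {n : ℕ} (P : Fin (n + 1) → Measure Ω) (τ : Ω → ℝ≥0∞) : ℝ :=
  Real.sqrt (var τ (P 0) + var τ (P (Fin.last n)))

end Processes

end BDCutoff

/-!
The separation from `0` to `π` is attained at `n`, where it is the tail of a random time, the
fastest strong stationary time. Writing `F i = π([0, i])` and `q i = π i * K i (i + 1)`, that time
has mean `∑ F i (1 - F i) / q i`, whereas `s = ∑ G i / q i`, where `G i` is the mass of the side of
the edge `{i, i + 1}` not containing `M`; the variances are double sums of the same kind. The
difference of the two means, `∑ G i ^ 2 / q i`, is at most a multiple of the window, so Chebyshev's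
inequality places the mixing times within a multiple of the window around `s`. Conversely, the
mixing times are at least of order `log (1 / ε) / λ`, which rules out a cutoff when `s * λ` does not
tend to infinity; the Poincaré inequality bounds `λ` times the squared window by a multiple of `s`.
-/

namespace BDCutoff

/-! ### Gradients of functions on a path -/

section Path

variable {n : ℕ} {μ : Fin (n + 1) → ℝ}

/-- The decrease of `f` across the edge `{i, i+1}`; the sign makes gradients of decreasing
functions nonnegative. -/
def grad (f : Fin (n + 1) → ℝ) (i : Fin n) : ℝ := f i.castSucc - f i.succ

/-- The indicator function of the vertices on the left of the edge `{i, i+1}`. -/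
def below (i : Fin n) (j : Fin (n + 1)) : ℝ := if j ≤ i.castSucc then 1 else 0

/-- The `μ`-mass of the vertices on the left of the edge `{i, i+1}`. -/
def cum (μ : Fin (n + 1) → ℝ) (i : Fin n) : ℝ := ∑ j, μ j * below i j

/-- The covariance under a probability vector `μ` of `below i` and `below k`, in the closed form
`F (i ∧ k) (1 - F (i ∨ k))`, where `F` is the distribution function; see `cov_eq_sum`. -/
def cov (μ : Fin (n + 1) → ℝ) (i k : Fin n) : ℝ :=
  min (cum μ i) (cum μ k) * (1 - max (cum μ i) (cum μ k))

/-- The function with gradient `d` that has mean zero under the probability vector `μ`. -/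
def centeredPotential (μ : Fin (n + 1) → ℝ) (d : Fin n → ℝ) (j : Fin (n + 1)) : ℝ :=
  ∑ i, (below i j - cum μ i) * d i

lemma below_of_le {i : Fin n} {j : Fin (n + 1)} (h : j ≤ i.castSucc) : below i j = 1 := if_pos h

lemma below_of_lt {i : Fin n} {j : Fin (n + 1)} (h : i.castSucc < j) : below i j = 0 :=
  if_neg h.not_ge

lemma below_nonneg (i : Fin n) (j : Fin (n + 1)) : 0 ≤ below i j := by
  unfold below; split_ifs <;> norm_num

lemma below_le_one (i : Fin n) (j : Fin (n + 1)) : below i j ≤ 1 := by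
  unfold below; split_ifs <;> norm_num

lemma below_zero (i : Fin n) : below i 0 = 1 := below_of_le (Fin.zero_le _)

lemma below_last (i : Fin n) : below i (Fin.last n) = 0 := below_of_lt (Fin.castSucc_lt_last i)

lemma grad_below (i k : Fin n) : grad (below i) k = if i = k then 1 else 0 := by
  simp only [grad, below, Fin.le_def, Fin.val_castSucc, Fin.val_succ, Fin.ext_iff]
  split_ifs <;> first | omega | norm_num

lemma antitone_iff_grad_nonneg {f : Fin (n + 1) → ℝ} : Antitone f ↔ ∀ i, 0 ≤ grad f i := by
  simp [Fin.antitone_iff_succ_le, grad]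

lemma sum_below_mul_grad (f : Fin (n + 1) → ℝ) (j : Fin (n + 1)) :
    ∑ i, below i j * grad f i = f j - f (Fin.last n) := by
  induction j using Fin.reverseInduction with
  | last => simp [below_last]
  | cast j ih =>
    have step (i : Fin n) : below i j.castSucc = below i j.succ + if i = j then 1 else 0 := by
      rw [← grad_below, grad]; ring
    simp only [step, add_mul, Finset.sum_add_distrib, ite_mul, one_mul, zero_mul,
      Finset.sum_ite_eq', Finset.mem_univ, if_true]
    rw [ih, grad]
    ring

lemma sum_mul_below_mul_grad {w : Fin (n + 1) → ℝ} (hw : ∑ j, w j = 0) (f : Fin (n + 1) → ℝ) :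
    ∑ i, (∑ j, w j * below i j) * grad f i = ∑ j, w j * f j :=
  calc ∑ i, (∑ j, w j * below i j) * grad f i
      = ∑ j, w j * ∑ i, below i j * grad f i := by
        simp only [Finset.sum_mul, Finset.mul_sum, mul_assoc]
        exact Finset.sum_comm
    _ = ∑ j, w j * f j := by
        simp only [sum_below_mul_grad, mul_sub, Finset.sum_sub_distrib, ← Finset.sum_mul, hw,
          zero_mul, sub_zero]

lemma grad_centeredPotential (μ : Fin (n + 1) → ℝ) (d : Fin n → ℝ) (i : Fin n) :
    grad (centeredPotential μ d) i = d i := by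
  calc grad (centeredPotential μ d) i = ∑ k, grad (below k) i * d k := by
        simp only [grad, centeredPotential, ← Finset.sum_sub_distrib]
        exact Finset.sum_congr rfl fun k _ => by ring
    _ = d i := by simp [grad_below]

lemma sum_mul_centeredPotential (hμ : ∑ j, μ j = 1) (d : Fin n → ℝ) :
    ∑ j, μ j * centeredPotential μ d j = 0 := by
  simp only [centeredPotential, Finset.mul_sum, ← mul_assoc, mul_sub]
  rw [Finset.sum_comm]
  simp only [← Finset.sum_mul, Finset.sum_sub_distrib, hμ, one_mul]
  simp [cum]

lemma eq_centeredPotential_grad (hμ : ∑ j, μ j = 1) {f : Fin (n + 1) → ℝ}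
    (hf : ∑ j, μ j * f j = 0) : f = centeredPotential μ (grad f) := by
  have hlast : f (Fin.last n) = -∑ i, cum μ i * grad f i := by
    have hsum : ∑ i, cum μ i * grad f i = ∑ j, μ j * (f j - f (Fin.last n)) := by
      simp only [cum, ← sum_below_mul_grad f, Finset.sum_mul, Finset.mul_sum, mul_assoc]
      exact Finset.sum_comm
    simp only [mul_sub, Finset.sum_sub_distrib, ← Finset.sum_mul, hf, hμ] at hsum
    linarith
  funext j
  simp only [centeredPotential, sub_mul, Finset.sum_sub_distrib, sum_below_mul_grad]
  linarith

lemma cov_comm (μ : Fin (n + 1) → ℝ) (i k : Fin n) : cov μ i k = cov μ k i := by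
  rw [cov, cov, min_comm, max_comm]

lemma monotone_cum (hμ : ∀ j, 0 ≤ μ j) : Monotone (cum μ) := by
  refine fun i k h => Finset.sum_le_sum fun j _ => mul_le_mul_of_nonneg_left ?_ (hμ j)
  rcases le_or_gt j i.castSucc with hj | hj
  · rw [below_of_le (hj.trans (Fin.castSucc_le_castSucc_iff.2 h))]
    exact below_le_one i j
  · rw [below_of_lt hj]
    exact below_nonneg k j

lemma sum_mul_below_mul_below (hμ : ∀ j, 0 ≤ μ j) (i k : Fin n) :
    ∑ j, μ j * below i j * below k j = min (cum μ i) (cum μ k) := by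
  wlog h : i ≤ k generalizing i k
  · rw [min_comm, ← this k i (le_of_not_ge h)]
    exact Finset.sum_congr rfl fun j _ => by ring
  rw [min_eq_left (monotone_cum hμ h)]
  refine Finset.sum_congr rfl fun j _ => ?_
  rcases le_or_gt j i.castSucc with hj | hj
  · rw [below_of_le (hj.trans (Fin.castSucc_le_castSucc_iff.2 h)), mul_one]
  · rw [below_of_lt hj, mul_zero, zero_mul]

lemma cov_eq_sum (hμ : ∀ j, 0 ≤ μ j) (i k : Fin n) :
    cov μ i k = ∑ j, μ j * below i j * (below k j - cum μ k) := by
  simp only [mul_sub, Finset.sum_sub_distrib, sum_mul_below_mul_below hμ, ← Finset.sum_mul]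
  change _ = _ - cum μ i * cum μ k
  rw [← min_mul_max (cum μ i), cov, mul_sub, mul_one]

lemma cov_nonneg (hμ : μ ∈ stdSimplex ℝ (Fin (n + 1))) (i k : Fin n) : 0 ≤ cov μ i k := by
  have hnonneg (i : Fin n) : 0 ≤ cum μ i :=
    Finset.sum_nonneg fun j _ => mul_nonneg (hμ.1 j) (below_nonneg i j)
  have hle (i : Fin n) : cum μ i ≤ 1 := hμ.2 ▸
    Finset.sum_le_sum fun j _ => mul_le_of_le_one_right (hμ.1 j) (below_le_one i j)
  exact mul_nonneg (le_min (hnonneg i) (hnonneg k)) (sub_nonneg.2 (max_le (hle i) (hle k)))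

lemma sum_mul_mul_below (hμ : μ ∈ stdSimplex ℝ (Fin (n + 1))) {f : Fin (n + 1) → ℝ}
    (hf : ∑ j, μ j * f j = 0) (i : Fin n) :
    ∑ j, μ j * f j * below i j = ∑ k, cov μ i k * grad f k := by
  simp only [cov_eq_sum hμ.1, Finset.sum_mul]
  rw [Finset.sum_comm]
  refine Finset.sum_congr rfl fun j _ => ?_
  conv_lhs => rw [eq_centeredPotential_grad hμ.2 hf, centeredPotential, Finset.mul_sum,
    Finset.sum_mul]
  exact Finset.sum_congr rfl fun k _ => by ring

lemma sum_mul_sq (hμ : μ ∈ stdSimplex ℝ (Fin (n + 1))) {f : Fin (n + 1) → ℝ}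
    (hf : ∑ j, μ j * f j = 0) :
    ∑ j, μ j * f j ^ 2 = ∑ i, ∑ k, cov μ i k * grad f i * grad f k :=
  calc ∑ j, μ j * f j ^ 2 = ∑ j, μ j * f j * f j :=
        Finset.sum_congr rfl fun j _ => by ring
    _ = ∑ i, (∑ k, cov μ i k * grad f k) * grad f i := by
        rw [← sum_mul_below_mul_grad hf]
        simp only [sum_mul_mul_below hμ hf]
    _ = ∑ i, ∑ k, cov μ i k * grad f i * grad f k := by
        simp only [Finset.sum_mul]
        exact Finset.sum_congr rfl fun i _ => Finset.sum_congr rfl fun k _ => by ring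

lemma sum_mul_below_nonneg_of_antitone (hμ : μ ∈ stdSimplex ℝ (Fin (n + 1)))
    {f : Fin (n + 1) → ℝ} (hf : ∑ j, μ j * f j = 0)
    (hanti : Antitone f) (i : Fin n) : 0 ≤ ∑ j, μ j * f j * below i j := by
  rw [sum_mul_mul_below hμ hf]
  exact Finset.sum_nonneg fun k _ =>
    mul_nonneg (cov_nonneg hμ i k) (antitone_iff_grad_nonneg.1 hanti k)

end Path

/-! ### Irreducible birth and death chains -/

/-- An irreducible birth and death chain together with its stationary law. -/
structure IrreducibleChain {n : ℕ} (K : Matrix (Fin (n + 1)) (Fin (n + 1)) ℝ)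
    (μ : Fin (n + 1) → ℝ) : Prop extends IsBirthDeath K, IsStationary K μ where
  irreducible : K.IsIrreducible

lemma pow_apply_eq_zero_of_closed {ι R : Type*} [Fintype ι] [DecidableEq ι] [Semiring R]
    {A : Matrix ι ι R} {S : Set ι} (hS : ∀ x ∈ S, ∀ y ∉ S, A x y = 0) (k : ℕ) {x y : ι}
    (hx : x ∈ S) (hy : y ∉ S) : (A ^ k) x y = 0 := by
  induction k generalizing x with
  | zero => rw [pow_zero, Matrix.one_apply_ne (ne_of_mem_of_not_mem hx hy)]
  | succ k ih =>
    rw [pow_succ', Matrix.mul_apply]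
    refine Finset.sum_eq_zero fun z _ => ?_
    by_cases hz : z ∈ S
    · rw [ih hz, mul_zero]
    · rw [hS x hx z hz, zero_mul]

section Generator

variable {n : ℕ} {K : Matrix (Fin (n + 1)) (Fin (n + 1)) ℝ} {μ : Fin (n + 1) → ℝ}

/-- The generator `I - K` acting on functions. -/
def gen (K : Matrix (Fin (n + 1)) (Fin (n + 1)) ℝ) (f : Fin (n + 1) → ℝ) : Fin (n + 1) → ℝ :=
  Matrix.mulVec (1 - K) f

/-- The stationary flow across the edge `{i, i+1}`. -/
def flow (K : Matrix (Fin (n + 1)) (Fin (n + 1)) ℝ) (μ : Fin (n + 1) → ℝ) (i : Fin n) : ℝ :=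
  μ i.castSucc * K i.castSucc i.succ

lemma gen_apply (K : Matrix (Fin (n + 1)) (Fin (n + 1)) ℝ) (f : Fin (n + 1) → ℝ)
    (x : Fin (n + 1)) : gen K f x = f x - Matrix.mulVec K f x := by
  simp [gen, Matrix.sub_mulVec]

lemma gen_apply_eq_sum (hrow : ∀ x, ∑ y, K x y = 1) (f : Fin (n + 1) → ℝ) (x : Fin (n + 1)) :
    gen K f x = ∑ y, K x y * (f x - f y) := by
  simp only [gen_apply, mul_sub, Finset.sum_sub_distrib, ← Finset.sum_mul, hrow, one_mul,
    Matrix.mulVec, dotProduct]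

namespace IsBirthDeath

lemma apply_nonneg (hK : IsBirthDeath K) (x y : Fin (n + 1)) : 0 ≤ K x y :=
  Matrix.nonneg_of_mem_rowStochastic hK.stochastic

lemma row_sum (hK : IsBirthDeath K) (x : Fin (n + 1)) : ∑ y, K x y = 1 :=
  Matrix.sum_row_of_mem_rowStochastic hK.stochastic x

lemma apply_le_one (hK : IsBirthDeath K) (x y : Fin (n + 1)) : K x y ≤ 1 := by
  rw [← hK.row_sum x]
  exact Finset.single_le_sum (fun z _ => hK.apply_nonneg x z) (Finset.mem_univ y)

lemma apply_eq_zero_of_le_of_lt (hK : IsBirthDeath K) {i : Fin n} {x y : Fin (n + 1)}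
    (hx : x ≤ i.castSucc) (hy : i.castSucc < y) (h : ¬ (x = i.castSucc ∧ y = i.succ)) :
    K x y = 0 ∧ K y x = 0 := by
  have hfar : (x : ℕ) + 1 < y := by
    simp only [Fin.le_def, Fin.lt_def, Fin.ext_iff, Fin.val_castSucc, Fin.val_succ] at *
    omega
  exact ⟨hK.nearest x y (Or.inl hfar), hK.nearest y x (Or.inr hfar)⟩

lemma gen_below (hK : IsBirthDeath K) (i : Fin n) :
    gen K (below i) =
      Pi.single i.castSucc (K i.castSucc i.succ) - Pi.single i.succ (K i.succ i.castSucc) := by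
  have hi : i.castSucc < i.succ := Fin.castSucc_lt_succ
  funext x
  rw [gen_apply_eq_sum hK.row_sum, Pi.sub_apply]
  rcases le_or_gt x i.castSucc with hx | hx
  · rw [Finset.sum_eq_single i.succ _ (by simp), Pi.single_eq_of_ne (hx.trans_lt hi).ne,
      below_of_le hx, below_of_lt hi]
    · rcases eq_or_ne x i.castSucc with rfl | hne
      · simp
      · simp [hne, (hK.apply_eq_zero_of_le_of_lt hx hi fun h => hne h.1).1]
    · intro y _ hy
      rcases le_or_gt y i.castSucc with hyi | hyi
      · rw [below_of_le hx, below_of_le hyi, sub_self, mul_zero]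
      · rw [(hK.apply_eq_zero_of_le_of_lt hx hyi fun h => hy h.2).1, zero_mul]
  · rw [Finset.sum_eq_single i.castSucc _ (by simp), Pi.single_eq_of_ne hx.ne',
      below_of_lt hx, below_of_le le_rfl]
    · rcases eq_or_ne x i.succ with rfl | hne
      · simp
      · simp [hne, (hK.apply_eq_zero_of_le_of_lt le_rfl hx fun h => hne h.2).2]
    · intro y _ hy
      rcases le_or_gt y i.castSucc with hyi | hyi
      · rw [(hK.apply_eq_zero_of_le_of_lt hyi hx fun h => hy h.1).2, zero_mul]
      · rw [below_of_lt hx, below_of_lt hyi, sub_self, mul_zero]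

lemma gen_eq_sum_grad (hK : IsBirthDeath K) (f : Fin (n + 1) → ℝ) :
    gen K f = ∑ i, grad f i • gen K (below i) := by
  funext x
  have hdiff (y : Fin (n + 1)) : f x - f y = ∑ i, grad f i * (below i x - below i y) := by
    simp only [mul_comm (grad f _), sub_mul, Finset.sum_sub_distrib, sum_below_mul_grad]
    ring
  simp only [Finset.sum_apply, Pi.smul_apply, smul_eq_mul, gen_apply_eq_sum hK.row_sum, hdiff,
    Finset.mul_sum]
  rw [Finset.sum_comm]
  exact Finset.sum_congr rfl fun i _ => Finset.sum_congr rfl fun y _ => by ring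

end IsBirthDeath

namespace IrreducibleChain

lemma exists_apply_ne_zero (hC : IrreducibleChain K μ) {S : Set (Fin (n + 1))}
    {x y : Fin (n + 1)} (hx : x ∈ S) (hy : y ∉ S) : ∃ a ∈ S, ∃ b ∉ S, K a b ≠ 0 := by
  by_contra! hS
  obtain ⟨k, -, hk⟩ :=
    (Matrix.isIrreducible_iff_exists_pow_pos hC.apply_nonneg).1 hC.irreducible x y
  exact hk.ne' (pow_apply_eq_zero_of_closed hS k hx hy)

lemma up_pos (hC : IrreducibleChain K μ) (i : Fin n) : 0 < K i.castSucc i.succ := by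
  obtain ⟨a, ha, b, hb, hab⟩ := hC.exists_apply_ne_zero (S := Set.Iic i.castSucc)
    (x := i.castSucc) (y := i.succ) (by simp) (by simp)
  by_cases h : a = i.castSucc ∧ b = i.succ
  · obtain ⟨rfl, rfl⟩ := h
    exact (hC.apply_nonneg _ _).lt_of_ne' hab
  · exact absurd (hC.apply_eq_zero_of_le_of_lt ha (not_le.1 hb) h).1 hab

lemma down_pos (hC : IrreducibleChain K μ) (i : Fin n) : 0 < K i.succ i.castSucc := by
  obtain ⟨b, hb, a, ha, hab⟩ := hC.exists_apply_ne_zero (S := Set.Ioi i.castSucc)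
    (x := i.succ) (y := i.castSucc) (by simp) (by simp)
  by_cases h : a = i.castSucc ∧ b = i.succ
  · obtain ⟨rfl, rfl⟩ := h
    exact (hC.apply_nonneg _ _).lt_of_ne' hab
  · exact absurd (hC.apply_eq_zero_of_le_of_lt (not_lt.1 ha) hb h).2 hab

lemma sum_mul_gen (hC : IrreducibleChain K μ) (f : Fin (n + 1) → ℝ) :
    ∑ x, μ x * gen K f x = 0 := by
  have hinv : μ ⬝ᵥ Matrix.mulVec K f = μ ⬝ᵥ f := by rw [Matrix.dotProduct_mulVec, hC.invariant]
  simp only [gen_apply, mul_sub, Finset.sum_sub_distrib]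
  exact sub_eq_zero.2 hinv.symm

lemma balance (hC : IrreducibleChain K μ) (i : Fin n) :
    μ i.castSucc * K i.castSucc i.succ = μ i.succ * K i.succ i.castSucc := by
  have := hC.sum_mul_gen (below i)
  simp only [hC.gen_below, Pi.sub_apply, Pi.single_apply, mul_sub, mul_ite, mul_zero,
    Finset.sum_sub_distrib, Finset.sum_ite_eq', Finset.mem_univ, if_true] at this
  exact sub_eq_zero.1 this

lemma pos (hC : IrreducibleChain K μ) (x : Fin (n + 1)) : 0 < μ x := by
  have hedge (i : Fin n) : μ i.castSucc = 0 ↔ μ i.succ = 0 := by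
    have := hC.balance i
    constructor <;> intro h <;> rw [h, zero_mul] at this
    · exact (mul_eq_zero.1 this.symm).resolve_right (hC.down_pos i).ne'
    · exact (mul_eq_zero.1 this).resolve_right (hC.up_pos i).ne'
  have hzero (y : Fin (n + 1)) : μ y = 0 ↔ μ 0 = 0 := by
    induction y using Fin.induction with
    | zero => rfl
    | succ i ih => rw [← ih, hedge]
  refine (hC.nonneg x).lt_of_ne' fun hx => zero_ne_one (α := ℝ) ?_
  rw [← hC.sum_eq_one, Finset.sum_eq_zero fun y _ => (hzero y).2 ((hzero x).1 hx)]

lemma mem_stdSimplex (hC : IrreducibleChain K μ) : μ ∈ stdSimplex ℝ (Fin (n + 1)) :=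
  ⟨hC.nonneg, hC.sum_eq_one⟩

lemma flow_pos (hC : IrreducibleChain K μ) (i : Fin n) : 0 < flow K μ i :=
  mul_pos (hC.pos _) (hC.up_pos i)

lemma sum_gen_below_mul (hC : IrreducibleChain K μ) (i : Fin n) (g : Fin (n + 1) → ℝ) :
    ∑ x, μ x * gen K (below i) x * g x = flow K μ i * grad g i := by
  simp only [hC.gen_below, Pi.sub_apply, Pi.single_apply, mul_sub, sub_mul, mul_ite, ite_mul,
    mul_zero, zero_mul, Finset.sum_sub_distrib, Finset.sum_ite_eq', Finset.mem_univ, if_true]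
  rw [← hC.balance, ← flow, grad, mul_sub]

lemma sum_gen_mul (hC : IrreducibleChain K μ) (f g : Fin (n + 1) → ℝ) :
    ∑ x, μ x * gen K f x * g x = ∑ i, flow K μ i * grad f i * grad g i :=
  calc ∑ x, μ x * gen K f x * g x
      = ∑ i, grad f i * ∑ x, μ x * gen K (below i) x * g x := by
        simp only [hC.gen_eq_sum_grad f, Finset.sum_apply, Pi.smul_apply, smul_eq_mul,
          Finset.mul_sum, Finset.sum_mul]
        rw [Finset.sum_comm]
        exact Finset.sum_congr rfl fun i _ => Finset.sum_congr rfl fun x _ => by ring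
    _ = ∑ i, flow K μ i * grad f i * grad g i := by
        simp only [hC.sum_gen_below_mul]
        exact Finset.sum_congr rfl fun i _ => by ring

lemma eq_of_sum_mul_eq (hC : IrreducibleChain K μ) {f g : Fin (n + 1) → ℝ}
    (h : ∀ φ : Fin (n + 1) → ℝ, ∑ x, μ x * f x * φ x = ∑ x, μ x * g x * φ x) : f = g := by
  funext x
  have := h (Pi.single x 1)
  simp only [Pi.single_apply, mul_ite, mul_one, mul_zero, Finset.sum_ite_eq', Finset.mem_univ,
    if_true] at this
  exact mul_left_cancel₀ (hC.pos x).ne' this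

end IrreducibleChain

/-- The Green operator: for `y` of mean zero under `μ`, the mean zero solution `f` of
`(I - K) f = y`. Summing the equation over the left side of an edge determines the gradient. -/
noncomputable def green (K : Matrix (Fin (n + 1)) (Fin (n + 1)) ℝ) (μ y : Fin (n + 1) → ℝ) :
    Fin (n + 1) → ℝ :=
  centeredPotential μ fun i => (∑ j, μ j * y j * below i j) / flow K μ i

lemma grad_green (K : Matrix (Fin (n + 1)) (Fin (n + 1)) ℝ) (μ y : Fin (n + 1) → ℝ) (i : Fin n) :
    grad (green K μ y) i = (∑ j, μ j * y j * below i j) / flow K μ i :=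
  grad_centeredPotential ..

lemma neg_green_last (K : Matrix (Fin (n + 1)) (Fin (n + 1)) ℝ) (μ y : Fin (n + 1) → ℝ) :
    -green K μ y (Fin.last n) = ∑ i, cum μ i * grad (green K μ y) i := by
  conv_lhs => rw [green, centeredPotential, ← Finset.sum_neg_distrib]
  refine Finset.sum_congr rfl fun i _ => ?_
  rw [grad_green, below_last]
  ring

namespace IrreducibleChain

variable {y : Fin (n + 1) → ℝ}

lemma sum_mul_green (hC : IrreducibleChain K μ) (y : Fin (n + 1) → ℝ) :
    ∑ j, μ j * green K μ y j = 0 :=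
  sum_mul_centeredPotential hC.sum_eq_one _

lemma gen_green (hC : IrreducibleChain K μ) (hy : ∑ j, μ j * y j = 0) :
    gen K (green K μ y) = y := by
  refine hC.eq_of_sum_mul_eq fun φ => ?_
  rw [hC.sum_gen_mul, ← sum_mul_below_mul_grad hy]
  refine Finset.sum_congr rfl fun i _ => ?_
  rw [grad_green, mul_div_cancel₀ _ (hC.flow_pos i).ne']

lemma antitone_green (hC : IrreducibleChain K μ) (hy : ∑ j, μ j * y j = 0) (hanti : Antitone y) :
    Antitone (green K μ y) :=
  antitone_iff_grad_nonneg.2 fun i => by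
    rw [grad_green]
    exact div_nonneg (sum_mul_below_nonneg_of_antitone hC.mem_stdSimplex hy hanti i)
      (hC.flow_pos i).le

end IrreducibleChain

end Generator

/-! ### The mean and variance of the separation time -/

section SeparationTime

variable {n : ℕ} {K : Matrix (Fin (n + 1)) (Fin (n + 1)) ℝ} {μ : Fin (n + 1) → ℝ}

/-- The mean of the fastest strong stationary time from `0`; it is the trace of the inverse of
`I - K` on mean zero functions. -/
noncomputable def sepMean (K : Matrix (Fin (n + 1)) (Fin (n + 1)) ℝ)
    (μ : Fin (n + 1) → ℝ) : ℝ :=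
  ∑ i, cum μ i * (1 - cum μ i) / flow K μ i

/-- The variance of the fastest strong stationary time from `0` in continuous time; it is the trace
of the squared inverse of `I - K` on mean zero functions. -/
noncomputable def sepVar (K : Matrix (Fin (n + 1)) (Fin (n + 1)) ℝ)
    (μ : Fin (n + 1) → ℝ) : ℝ :=
  ∑ i, ∑ k, cov μ i k ^ 2 / (flow K μ i * flow K μ k)

/-- The density of the point mass at `0` with respect to `μ`, minus one. -/
noncomputable def startDensity (μ : Fin (n + 1) → ℝ) (j : Fin (n + 1)) : ℝ :=
  (if j = 0 then 1 / μ 0 else 0) - 1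

lemma one_sub_cum (hμ : ∑ j, μ j = 1) (i : Fin n) :
    1 - cum μ i = ∑ j, μ j * (1 - below i j) := by
  simp only [mul_sub, Finset.sum_sub_distrib, mul_one, hμ, cum]

lemma cov_sq_add (μ : Fin (n + 1) → ℝ) (i k : Fin n) :
    cov μ i k ^ 2 + cum μ i * (1 - cum μ i) * (cum μ k * (1 - cum μ k)) =
      cov μ i k * (cum μ i * (1 - cum μ k) + cum μ k * (1 - cum μ i)) := by
  rcases le_total (cum μ i) (cum μ k) with h | h
  · rw [cov, min_eq_left h, max_eq_right h]; ring
  · rw [cov, min_eq_right h, max_eq_left h]; ring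

namespace IrreducibleChain

lemma le_cum (hC : IrreducibleChain K μ) (i : Fin n) : μ i.castSucc ≤ cum μ i := by
  have := Finset.single_le_sum (f := fun j => μ j * below i j)
    (fun j _ => mul_nonneg (hC.nonneg j) (below_nonneg i j)) (Finset.mem_univ i.castSucc)
  rwa [below_of_le le_rfl, mul_one] at this

lemma le_one_sub_cum (hC : IrreducibleChain K μ) (i : Fin n) : μ i.succ ≤ 1 - cum μ i := by
  have := Finset.single_le_sum (f := fun j => μ j * (1 - below i j))
    (fun j _ => mul_nonneg (hC.nonneg j) (sub_nonneg.2 (below_le_one i j)))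
    (Finset.mem_univ i.succ)
  rwa [below_of_lt Fin.castSucc_lt_succ, sub_zero, mul_one, ← one_sub_cum hC.sum_eq_one] at this

lemma cum_pos (hC : IrreducibleChain K μ) (i : Fin n) : 0 < cum μ i :=
  (hC.pos _).trans_le (hC.le_cum i)

lemma cum_lt_one (hC : IrreducibleChain K μ) (i : Fin n) : cum μ i < 1 :=
  sub_pos.1 ((hC.pos _).trans_le (hC.le_one_sub_cum i))

lemma flow_le_cum (hC : IrreducibleChain K μ) (i : Fin n) : flow K μ i ≤ cum μ i :=
  (mul_le_of_le_one_right (hC.nonneg _) (hC.apply_le_one _ _)).trans (hC.le_cum i)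

lemma flow_le_one_sub_cum (hC : IrreducibleChain K μ) (i : Fin n) :
    flow K μ i ≤ 1 - cum μ i := by
  rw [flow, hC.balance]
  exact (mul_le_of_le_one_right (hC.nonneg _) (hC.apply_le_one _ _)).trans (hC.le_one_sub_cum i)

lemma cov_pos (hC : IrreducibleChain K μ) (i k : Fin n) : 0 < cov μ i k :=
  mul_pos (lt_min (hC.cum_pos i) (hC.cum_pos k))
    (sub_pos.2 (max_lt (hC.cum_lt_one i) (hC.cum_lt_one k)))

lemma sum_mul_startDensity (hC : IrreducibleChain K μ) :
    ∑ j, μ j * startDensity μ j = 0 := by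
  simp [startDensity, mul_sub, hC.sum_eq_one, (hC.pos 0).ne']

lemma antitone_startDensity (hC : IrreducibleChain K μ) : Antitone (startDensity μ) := by
  intro a b hab
  refine sub_le_sub_right ?_ 1
  rcases eq_or_ne b 0 with rfl | hb
  · rw [le_antisymm hab (Fin.zero_le a)]
  · rw [if_neg hb]
    split_ifs
    exacts [one_div_nonneg.2 (hC.nonneg 0), le_rfl]

lemma sum_mul_startDensity_mul_below (hC : IrreducibleChain K μ) (i : Fin n) :
    ∑ j, μ j * startDensity μ j * below i j = 1 - cum μ i := by
  simp [startDensity, mul_sub, sub_mul, below_zero, (hC.pos 0).ne', cum]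

lemma grad_green_startDensity (hC : IrreducibleChain K μ) (i : Fin n) :
    grad (green K μ (startDensity μ)) i = (1 - cum μ i) / flow K μ i := by
  rw [grad_green, hC.sum_mul_startDensity_mul_below]

lemma neg_green_startDensity_last (hC : IrreducibleChain K μ) :
    -green K μ (startDensity μ) (Fin.last n) = sepMean K μ := by
  simp only [neg_green_last, hC.grad_green_startDensity, mul_div_assoc', sepMean]

lemma two_mul_neg_green_green_startDensity_last (hC : IrreducibleChain K μ) :
    2 * -green K μ (green K μ (startDensity μ)) (Fin.last n) =
      sepVar K μ + sepMean K μ ^ 2 := by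
  have hsum : -green K μ (green K μ (startDensity μ)) (Fin.last n) =
      ∑ i, ∑ k, cum μ i * (1 - cum μ k) * cov μ i k / (flow K μ i * flow K μ k) := by
    simp only [neg_green_last, grad_green _ _ (green K μ (startDensity μ)),
      sum_mul_mul_below hC.mem_stdSimplex (hC.sum_mul_green _), hC.grad_green_startDensity,
      Finset.sum_div, Finset.mul_sum]
    exact Finset.sum_congr rfl fun i _ => Finset.sum_congr rfl fun k _ => by ring
  have hsum_swap : -green K μ (green K μ (startDensity μ)) (Fin.last n) =
      ∑ i, ∑ k, cum μ k * (1 - cum μ i) * cov μ i k / (flow K μ i * flow K μ k) := by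
    rw [hsum, Finset.sum_comm]
    exact Finset.sum_congr rfl fun i _ => Finset.sum_congr rfl fun k _ => by
      rw [cov_comm, mul_comm (flow K μ k)]
  rw [two_mul]
  nth_rewrite 1 [hsum]
  rw [hsum_swap, sepVar, sepMean, sq, Finset.sum_mul_sum]
  simp only [← Finset.sum_add_distrib]
  refine Finset.sum_congr rfl fun i _ => Finset.sum_congr rfl fun k _ => ?_
  rw [div_mul_div_comm, ← add_div, ← add_div, cov_sq_add]
  ring

end IrreducibleChain

end SeparationTime

/-! ### The spectral gap -/

section Rayleigh

open Matrix

variable {ι : Type*} [Fintype ι] {A : Matrix ι ι ℝ} {w : ι → ℝ}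

lemma dotProduct_mulVec_smul_self (A : Matrix ι ι ℝ) (a : ℝ) (d : ι → ℝ) :
    a • d ⬝ᵥ A *ᵥ (a • d) = a ^ 2 * (d ⬝ᵥ A *ᵥ d) := by
  simp only [mulVec_smul, smul_dotProduct, dotProduct_smul, smul_eq_mul]
  ring

lemma dotProduct_mulVec_le_abs (hA : ∀ i k, 0 ≤ A i k) (d : ι → ℝ) :
    d ⬝ᵥ A *ᵥ d ≤ |d| ⬝ᵥ A *ᵥ |d| := by
  simp only [dotProduct, mulVec, Finset.mul_sum]
  refine Finset.sum_le_sum fun i _ => Finset.sum_le_sum fun k _ => ?_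
  rw [mul_left_comm, mul_left_comm (|d| i)]
  refine mul_le_mul_of_nonneg_left ?_ (hA i k)
  rw [Pi.abs_apply, Pi.abs_apply, ← abs_mul]
  exact le_abs_self _

variable [DecidableEq ι]

lemma abs_dotProduct_diagonal_mulVec_abs (w d : ι → ℝ) :
    |d| ⬝ᵥ diagonal w *ᵥ |d| = d ⬝ᵥ diagonal w *ᵥ d := by
  simp only [dotProduct, mulVec_diagonal, Pi.abs_apply]
  exact Finset.sum_congr rfl fun i _ => by
    rw [mul_left_comm, abs_mul_abs_self, mul_left_comm]

lemma exists_nonneg_isMaxOn_rayleigh [Nonempty ι] (hA : ∀ i k, 0 ≤ A i k) (hw : ∀ i, 0 < w i) :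
    ∃ (β : ℝ) (g : ι → ℝ), 0 ≤ g ∧ g ≠ 0 ∧ g ⬝ᵥ A *ᵥ g = β * (g ⬝ᵥ diagonal w *ᵥ g) ∧
      ∀ d, d ⬝ᵥ A *ᵥ d ≤ β * (d ⬝ᵥ diagonal w *ᵥ d) := by
  have hpos (d : ι → ℝ) (hd : d ≠ 0) : 0 < d ⬝ᵥ diagonal w *ᵥ d :=
    (PosDef.diagonal hw).dotProduct_mulVec_pos hd
  set R : (ι → ℝ) → ℝ := fun d => (d ⬝ᵥ A *ᵥ d) / (d ⬝ᵥ diagonal w *ᵥ d) with hR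
  have hRcont : ContinuousOn R (Metric.sphere 0 1) := by
    refine ContinuousOn.div (by fun_prop) (by fun_prop) fun d hd => (hpos d ?_).ne'
    exact ne_zero_of_mem_unit_sphere ⟨d, hd⟩
  obtain ⟨g, hg, hmax⟩ := (isCompact_sphere (0 : ι → ℝ) 1).exists_isMaxOn
    (NormedSpace.sphere_nonempty.2 zero_le_one) hRcont
  have hg0 : g ≠ 0 := ne_zero_of_mem_unit_sphere ⟨g, hg⟩
  have habs0 : |g| ≠ 0 := by simpa using hg0
  refine ⟨R |g|, |g|, abs_nonneg g, habs0, (div_mul_cancel₀ _ (hpos _ habs0).ne').symm,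
    fun d => ?_⟩
  rcases eq_or_ne d 0 with rfl | hd
  · simp
  rw [← div_le_iff₀ (hpos d hd)]
  have hnorm : ‖d‖⁻¹ ≠ 0 := inv_ne_zero (norm_ne_zero_iff.2 hd)
  calc R d = R (‖d‖⁻¹ • d) := by
        simp only [hR, dotProduct_mulVec_smul_self,
          mul_div_mul_left _ _ (pow_ne_zero 2 hnorm)]
    _ ≤ R g := hmax (by simp [norm_smul, hd])
    _ ≤ R |g| := by
        rw [hR]
        dsimp only
        rw [abs_dotProduct_diagonal_mulVec_abs]
        exact div_le_div_of_nonneg_right (dotProduct_mulVec_le_abs hA g) (hpos g hg0).le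

lemma mulVec_eq_of_rayleigh_eq (hA : A.IsSymm) {β : ℝ} {g : ι → ℝ}
    (heq : g ⬝ᵥ A *ᵥ g = β * (g ⬝ᵥ diagonal w *ᵥ g))
    (hle : ∀ d, d ⬝ᵥ A *ᵥ d ≤ β * (d ⬝ᵥ diagonal w *ᵥ d)) :
    A *ᵥ g = β • diagonal w *ᵥ g := by
  have hform (d e : ι → ℝ) : d ⬝ᵥ (β • diagonal w - A) *ᵥ e =
      β * (d ⬝ᵥ diagonal w *ᵥ e) - d ⬝ᵥ A *ᵥ e := by
    rw [sub_mulVec, dotProduct_sub, smul_mulVec, dotProduct_smul, smul_eq_mul]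
  have hpsd : (β • diagonal w - A).PosSemidef := by
    refine .of_dotProduct_mulVec_nonneg ?_ fun d => ?_
    · rw [IsHermitian, conjTranspose_eq_transpose_of_trivial, transpose_sub, transpose_smul,
        diagonal_transpose, hA.eq]
    · rw [star_trivial, hform]
      exact sub_nonneg.2 (hle d)
  have hker : (β • diagonal w - A) *ᵥ g = 0 := by
    rw [← hpsd.dotProduct_mulVec_zero_iff, star_trivial, hform, heq, sub_self]
  rw [sub_mulVec, smul_mulVec] at hker
  exact (sub_eq_zero.1 hker).symm

end Rayleigh

section Gap

variable {n : ℕ} {K : Matrix (Fin (n + 1)) (Fin (n + 1)) ℝ} {μ : Fin (n + 1) → ℝ} {l : ℝ}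
  {f : Fin (n + 1) → ℝ}

/-- The Poincaré inequality with constant `l`, in terms of gradients: the sums are the Dirichlet
form and the variance of the function with gradient `d`. -/
def Poincare (K : Matrix (Fin (n + 1)) (Fin (n + 1)) ℝ) (μ : Fin (n + 1) → ℝ) (l : ℝ) : Prop :=
  ∀ d : Fin n → ℝ, l * ∑ i, ∑ k, cov μ i k * d i * d k ≤ ∑ i, flow K μ i * d i ^ 2

namespace IrreducibleChain

lemma sum_mul_eq_zero_of_gen_eq_smul (hC : IrreducibleChain K μ) (hl : l ≠ 0)
    (hf : gen K f = l • f) : ∑ j, μ j * f j = 0 := by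
  have := hC.sum_mul_gen f
  simp only [hf, Pi.smul_apply, smul_eq_mul, mul_left_comm _ l, ← Finset.mul_sum] at this
  exact (mul_eq_zero.1 this).resolve_left hl

lemma mul_sum_sq_of_gen_eq_smul (hC : IrreducibleChain K μ) (hf : gen K f = l • f) :
    l * ∑ j, μ j * f j ^ 2 = ∑ i, flow K μ i * grad f i ^ 2 :=
  calc l * ∑ j, μ j * f j ^ 2 = ∑ j, μ j * gen K f j * f j := by
        rw [hf, Finset.mul_sum]
        exact Finset.sum_congr rfl fun j _ => by rw [Pi.smul_apply, smul_eq_mul]; ring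
    _ = ∑ i, flow K μ i * grad f i ^ 2 := by
        rw [hC.sum_gen_mul]
        exact Finset.sum_congr rfl fun i _ => by ring

lemma sum_mul_sq_pos (hC : IrreducibleChain K μ) (hf : f ≠ 0) : 0 < ∑ j, μ j * f j ^ 2 := by
  obtain ⟨j, hj⟩ := Function.ne_iff.1 hf
  exact Finset.sum_pos' (fun j _ => mul_nonneg (hC.nonneg j) (sq_nonneg _))
    ⟨j, Finset.mem_univ j, mul_pos (hC.pos j) (sq_pos_of_ne_zero hj)⟩

lemma spectralGap_eq_of_poincare (hC : IrreducibleChain K μ) (hl : l ≠ 0) (hf0 : f ≠ 0)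
    (hf : gen K f = l • f) (hP : Poincare K μ l) : spectralGap K = l := by
  have hlin (φ : Fin (n + 1) → ℝ) : Matrix.toLin' (1 - K) φ = gen K φ :=
    Matrix.toLin'_apply _ _
  refine IsLeast.csInf_eq ⟨⟨hl, Module.End.hasEigenvalue_of_hasEigenvector (x := f) ⟨?_, hf0⟩⟩, ?_⟩
  · rw [Module.End.mem_eigenspace_iff, hlin, hf]
  · rintro m ⟨hm, hev⟩
    obtain ⟨φ, hφ⟩ := hev.exists_hasEigenvector
    have hgen : gen K φ = m • φ := by rw [← hlin]; exact hφ.apply_eq_smul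
    refine le_of_mul_le_mul_right ?_ (hC.sum_mul_sq_pos hφ.2)
    rw [hC.mul_sum_sq_of_gen_eq_smul hgen,
      sum_mul_sq hC.mem_stdSimplex (hC.sum_mul_eq_zero_of_gen_eq_smul hm hgen)]
    exact hP (grad φ)

lemma exists_nonneg_cov_eigenvector (hC : IrreducibleChain K μ) (hn : 1 ≤ n) :
    ∃ (β : ℝ) (g : Fin n → ℝ), 0 < β ∧ 0 ≤ g ∧ g ≠ 0 ∧
      (∀ i, ∑ k, cov μ i k * g k = β * (flow K μ i * g i)) ∧
      ∀ d : Fin n → ℝ, ∑ i, ∑ k, cov μ i k * d i * d k ≤ β * ∑ i, flow K μ i * d i ^ 2 := by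
  have : Nonempty (Fin n) := ⟨⟨0, hn⟩⟩
  obtain ⟨β, g, hg, hg0, heq, hle⟩ := exists_nonneg_isMaxOn_rayleigh (A := Matrix.of (cov μ))
    (fun i k => (hC.cov_pos i k).le) hC.flow_pos
  have heig (i : Fin n) : ∑ k, cov μ i k * g k = β * (flow K μ i * g i) := by
    have := congrFun (mulVec_eq_of_rayleigh_eq
      (Matrix.IsSymm.ext fun i k => cov_comm μ k i) heq hle) i
    rwa [Pi.smul_apply, Matrix.mulVec_diagonal] at this
  have hform (d : Fin n → ℝ) :
      ∑ i, ∑ k, cov μ i k * d i * d k ≤ β * ∑ i, flow K μ i * d i ^ 2 := by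
    convert hle d using 2
    · simp only [dotProduct, Matrix.mulVec, Matrix.of_apply, Finset.mul_sum]
      exact Finset.sum_congr rfl fun i _ => Finset.sum_congr rfl fun k _ => by ring
    · exact Finset.sum_congr rfl fun i _ => by rw [Matrix.mulVec_diagonal]; ring
  refine ⟨β, g, ?_, hg, hg0, heig, hform⟩
  have hcov : 0 < ∑ i, ∑ k, cov μ i k :=
    Finset.sum_pos (fun i _ => Finset.sum_pos (fun k _ => hC.cov_pos i k) Finset.univ_nonempty)
      Finset.univ_nonempty
  have := hcov.trans_le (by simpa using hform 1)
  exact pos_of_mul_pos_left this (Finset.sum_nonneg fun i _ => (hC.flow_pos i).le)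

lemma exists_antitone_gen_eq_smul (hC : IrreducibleChain K μ) (hn : 1 ≤ n) :
    ∃ (l : ℝ) (f : Fin (n + 1) → ℝ), 0 < l ∧ f ≠ 0 ∧ Antitone f ∧ gen K f = l • f ∧
      Poincare K μ l := by
  obtain ⟨β, g, hβ, hg, hg0, heig, hform⟩ := hC.exists_nonneg_cov_eigenvector hn
  set f := centeredPotential μ g with hf
  have hgrad : grad f = g := funext (grad_centeredPotential μ g)
  have hmean : ∑ j, μ j * f j = 0 := sum_mul_centeredPotential hC.sum_eq_one g
  refine ⟨β⁻¹, f, inv_pos.2 hβ, ?_, ?_, ?_, fun d => (inv_mul_le_iff₀ hβ).2 (hform d)⟩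
  · refine fun h0 => hg0 ?_
    rw [← hgrad, h0]
    exact funext fun _ => sub_self 0
  · exact antitone_iff_grad_nonneg.2 fun i => hgrad ▸ hg i
  · have hgreen : green K μ f = β • f := by
      have hgrad_green (i : Fin n) : grad (green K μ f) i = β * g i := by
        rw [grad_green, sum_mul_mul_below hC.mem_stdSimplex hmean, hgrad, heig,
          mul_left_comm, mul_div_cancel_left₀ _ (hC.flow_pos i).ne']
      rw [eq_centeredPotential_grad hC.sum_eq_one (hC.sum_mul_green f), funext hgrad_green]
      funext j
      simp only [hf, centeredPotential, Pi.smul_apply, smul_eq_mul, Finset.mul_sum, mul_left_comm]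
    have := hC.gen_green hmean
    rw [hgreen, gen, Matrix.mulVec_smul] at this
    rw [← this, gen, inv_smul_smul₀ hβ.ne', this]

lemma gap_pos (hC : IrreducibleChain K μ) (hn : 1 ≤ n) : 0 < spectralGap K := by
  obtain ⟨l, f, hl, hf0, -, hf, hP⟩ := hC.exists_antitone_gen_eq_smul hn
  rwa [hC.spectralGap_eq_of_poincare hl.ne' hf0 hf hP]

lemma poincare_gap (hC : IrreducibleChain K μ) (hn : 1 ≤ n) : Poincare K μ (spectralGap K) := by
  obtain ⟨l, f, hl, hf0, -, hf, hP⟩ := hC.exists_antitone_gen_eq_smul hn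
  rwa [hC.spectralGap_eq_of_poincare hl.ne' hf0 hf hP]

lemma exists_antitone_eigenfunction (hC : IrreducibleChain K μ) (hn : 1 ≤ n) :
    ∃ f : Fin (n + 1) → ℝ, f ≠ 0 ∧ Antitone f ∧ ∑ j, μ j * f j = 0 ∧
      gen K f = spectralGap K • f := by
  obtain ⟨l, f, hl, hf0, hanti, hf, hP⟩ := hC.exists_antitone_gen_eq_smul hn
  rw [hC.spectralGap_eq_of_poincare hl.ne' hf0 hf hP]
  exact ⟨f, hf0, hanti, hC.sum_mul_eq_zero_of_gen_eq_smul hl.ne' hf, hf⟩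

lemma apply_zero_pos_of_antitone (hC : IrreducibleChain K μ) (hf0 : f ≠ 0) (hanti : Antitone f)
    (hmean : ∑ j, μ j * f j = 0) : 0 < f 0 := by
  by_contra! hcon
  have hle (j : Fin (n + 1)) : f j ≤ 0 := (hanti (Fin.zero_le j)).trans hcon
  refine hf0 (funext fun j => ?_)
  have := (Finset.sum_eq_zero_iff_of_nonpos fun j _ =>
    mul_nonpos_of_nonneg_of_nonpos (hC.nonneg j) (hle j)).1 hmean j (Finset.mem_univ j)
  exact (mul_eq_zero.1 this).resolve_left (hC.pos j).ne'

lemma one_le_gap_sq_mul_sepVar (hC : IrreducibleChain K μ) (hn : 1 ≤ n) :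
    1 ≤ spectralGap K ^ 2 * sepVar K μ := by
  obtain ⟨f, hf0, -, hmean, hf⟩ := hC.exists_antitone_eigenfunction hn
  have hcauchy : (∑ j, μ j * f j ^ 2) ^ 2 ≤
      sepVar K μ * (∑ i, flow K μ i * grad f i ^ 2) ^ 2 := by
    rw [sum_mul_sq hC.mem_stdSimplex hmean, sq (∑ i, flow K μ i * _), Finset.sum_mul_sum, sepVar]
    simp only [← Finset.sum_product']
    have hpos (p : Fin n × Fin n) : 0 < flow K μ p.1 * flow K μ p.2 :=
      mul_pos (hC.flow_pos _) (hC.flow_pos _)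
    refine Finset.sum_sq_le_sum_mul_sum_of_sq_le_mul _
      (fun p _ => div_nonneg (sq_nonneg _) (hpos p).le) (fun p _ => ?_) (fun p _ => ?_)
    · rw [mul_mul_mul_comm]
      exact mul_nonneg (hpos p).le (mul_nonneg (sq_nonneg _) (sq_nonneg _))
    · refine le_of_eq ?_
      rw [mul_mul_mul_comm (flow K μ _), ← mul_assoc, div_mul_cancel₀ _ (hpos p).ne']
      ring
  rw [← hC.mul_sum_sq_of_gen_eq_smul hf] at hcauchy
  refine le_of_mul_le_mul_right ?_ (pow_pos (hC.sum_mul_sq_pos hf0) 2)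
  linarith

lemma gap_le_two (hC : IrreducibleChain K μ) (hn : 1 ≤ n) : spectralGap K ≤ 2 := by
  set i : Fin n := ⟨0, hn⟩
  have hedge : spectralGap K * (cum μ i * (1 - cum μ i)) ≤ flow K μ i := by
    simpa [Pi.single_apply, cov] using hC.poincare_gap hn (Pi.single i 1)
  have hpos := mul_pos (hC.cum_pos i) (sub_pos.2 (hC.cum_lt_one i))
  refine le_of_mul_le_mul_right (hedge.trans ?_) hpos
  rcases le_total (cum μ i) (1 / 2) with h | h
  · nlinarith [hC.flow_le_cum i, hC.cum_pos i]
  · nlinarith [hC.flow_le_one_sub_cum i, hC.cum_lt_one i]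

end IrreducibleChain

end Gap

/-! ### The mean and variance of the hitting times, compared with the separation time -/

section Hitting

variable {n : ℕ} {K : Matrix (Fin (n + 1)) (Fin (n + 1)) ℝ} {μ : Fin (n + 1) → ℝ}
  {M : Fin (n + 1)} {δ : ℝ}

/-- The mass of the side of the edge `{i, i+1}` that does not contain `M`. -/
def far (μ : Fin (n + 1) → ℝ) (M : Fin (n + 1)) (i : Fin n) : ℝ :=
  if i.castSucc < M then cum μ i else 1 - cum μ i

/-- The edges `{i, i+1}` and `{k, k+1}` lie on the same side of the vertex `M`. -/
def SameSide (M : Fin (n + 1)) (i k : Fin n) : Prop := i.castSucc < M ↔ k.castSucc < M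

instance (M : Fin (n + 1)) (i k : Fin n) : Decidable (SameSide M i k) :=
  inferInstanceAs (Decidable (_ ↔ _))

/-- Sum over both end points of the mean hitting times of `M`. -/
noncomputable def hitMean (K : Matrix (Fin (n + 1)) (Fin (n + 1)) ℝ) (μ : Fin (n + 1) → ℝ)
    (M : Fin (n + 1)) : ℝ := ∑ i, far μ M i / flow K μ i

/-- Sum over both end points of the variances of the continuous time hitting times of `M`. -/
noncomputable def hitVar (K : Matrix (Fin (n + 1)) (Fin (n + 1)) ℝ) (μ : Fin (n + 1) → ℝ)
    (M : Fin (n + 1)) : ℝ :=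
  ∑ i, ∑ k, if SameSide M i k then
    min (far μ M i) (far μ M k) ^ 2 / (flow K μ i * flow K μ k) else 0

/-- The difference between the sum of mean hitting times and the mean separation time. -/
noncomputable def meanGap (K : Matrix (Fin (n + 1)) (Fin (n + 1)) ℝ) (μ : Fin (n + 1) → ℝ)
    (M : Fin (n + 1)) : ℝ := ∑ i, far μ M i ^ 2 / flow K μ i

lemma sepMean_add_meanGap (K : Matrix (Fin (n + 1)) (Fin (n + 1)) ℝ) (μ : Fin (n + 1) → ℝ)
    (M : Fin (n + 1)) : sepMean K μ + meanGap K μ M = hitMean K μ M := by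
  rw [sepMean, meanGap, hitMean, ← Finset.sum_add_distrib]
  refine Finset.sum_congr rfl fun i _ => ?_
  rw [← add_div]
  unfold far
  split_ifs <;> ring

lemma meanGap_eq_add (K : Matrix (Fin (n + 1)) (Fin (n + 1)) ℝ) (μ : Fin (n + 1) → ℝ)
    (M : Fin (n + 1)) :
    meanGap K μ M = ∑ i with i.castSucc < M, far μ M i ^ 2 / flow K μ i +
      ∑ i with ¬ i.castSucc < M, far μ M i ^ 2 / flow K μ i :=
  (Finset.sum_filter_add_sum_filter_not _ _ _).symm

lemma sum_Iic_le_cum (hμ : ∀ j, 0 ≤ μ j) {i : Fin n} (h : M ≤ i.castSucc) :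
    ∑ j ∈ Finset.Iic M, μ j ≤ cum μ i := by
  calc ∑ j ∈ Finset.Iic M, μ j = ∑ j ∈ Finset.Iic M, μ j * below i j :=
        Finset.sum_congr rfl fun j hj => by
          rw [below_of_le ((Finset.mem_Iic.1 hj).trans h), mul_one]
    _ ≤ cum μ i :=
        Finset.sum_le_univ_sum_of_nonneg fun j => mul_nonneg (hμ j) (below_nonneg i j)

lemma sum_Ici_le_one_sub_cum (hμ : ∀ j, 0 ≤ μ j) (hμ1 : ∑ j, μ j = 1) {i : Fin n}
    (h : i.castSucc < M) : ∑ j ∈ Finset.Ici M, μ j ≤ 1 - cum μ i := by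
  rw [one_sub_cum hμ1]
  calc ∑ j ∈ Finset.Ici M, μ j = ∑ j ∈ Finset.Ici M, μ j * (1 - below i j) :=
        Finset.sum_congr rfl fun j hj => by
          rw [below_of_lt (h.trans_le (Finset.mem_Ici.1 hj)), sub_zero, mul_one]
    _ ≤ ∑ j, μ j * (1 - below i j) :=
        Finset.sum_le_univ_sum_of_nonneg fun j =>
          mul_nonneg (hμ j) (sub_nonneg.2 (below_le_one i j))

namespace IrreducibleChain

lemma far_pos (hC : IrreducibleChain K μ) (i : Fin n) : 0 < far μ M i := by
  unfold far
  split_ifs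
  · exact hC.cum_pos i
  · exact sub_pos.2 (hC.cum_lt_one i)

lemma far_le_one (hC : IrreducibleChain K μ) (i : Fin n) : far μ M i ≤ 1 := by
  unfold far
  split_ifs
  · exact (hC.cum_lt_one i).le
  · exact sub_le_self 1 (hC.cum_pos i).le

lemma far_mul_far_le_min (hC : IrreducibleChain K μ) (i k : Fin n) :
    far μ M i * far μ M k ≤ min (far μ M i) (far μ M k) :=
  le_min (mul_le_of_le_one_right (hC.far_pos i).le (hC.far_le_one k))
    (mul_le_of_le_one_left (hC.far_pos k).le (hC.far_le_one i))

lemma flow_le_far (hC : IrreducibleChain K μ) (i : Fin n) : flow K μ i ≤ far μ M i := by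
  unfold far
  split_ifs
  · exact hC.flow_le_cum i
  · exact hC.flow_le_one_sub_cum i

lemma flow_lt_far (hC : IrreducibleChain K μ) {i : Fin n}
    (hmono : K i.castSucc i.succ + K i.succ i.castSucc ≤ 1) : flow K μ i < far μ M i := by
  have hup := hC.up_pos i
  have hdown := hC.down_pos i
  unfold far
  split_ifs
  · exact (mul_lt_of_lt_one_right (hC.pos _) (by linarith)).trans_le (hC.le_cum i)
  · rw [flow, hC.balance]
    exact (mul_lt_of_lt_one_right (hC.pos _) (by linarith)).trans_le (hC.le_one_sub_cum i)

lemma le_hitMean (hC : IrreducibleChain K μ) : (n : ℝ) ≤ hitMean K μ M :=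
  calc (n : ℝ) = ∑ _i : Fin n, (1 : ℝ) := by simp
    _ ≤ hitMean K μ M :=
        Finset.sum_le_sum fun i _ => (one_le_div (hC.flow_pos i)).2 (hC.flow_le_far i)

lemma meanGap_nonneg (hC : IrreducibleChain K μ) : 0 ≤ meanGap K μ M :=
  Finset.sum_nonneg fun i _ => div_nonneg (sq_nonneg _) (hC.flow_pos i).le

lemma mul_min_far_le_cov (hC : IrreducibleChain K μ) (hl : δ ≤ ∑ i ∈ Finset.Iic M, μ i)
    (hr : δ ≤ ∑ i ∈ Finset.Ici M, μ i) {i k : Fin n} (h : SameSide M i k) :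
    δ * min (far μ M i) (far μ M k) ≤ cov μ i k := by
  unfold SameSide at h
  unfold far cov
  by_cases hi : i.castSucc < M
  · have hk := h.1 hi
    rw [if_pos hi, if_pos hk, mul_comm]
    refine mul_le_mul_of_nonneg_left ?_ (le_min (hC.cum_pos i).le (hC.cum_pos k).le)
    have hδ {j : Fin n} (hj : j.castSucc < M) : δ ≤ 1 - cum μ j :=
      hr.trans (sum_Ici_le_one_sub_cum hC.nonneg hC.sum_eq_one hj)
    exact le_sub_comm.1 (max_le (le_sub_comm.1 (hδ hi)) (le_sub_comm.1 (hδ hk)))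
  · have hk : ¬ k.castSucc < M := fun hk => hi (h.2 hk)
    rw [if_neg hi, if_neg hk, min_sub_sub_left]
    have hδ {j : Fin n} (hj : ¬ j.castSucc < M) : δ ≤ cum μ j :=
      hl.trans (sum_Iic_le_cum hC.nonneg (not_lt.1 hj))
    exact mul_le_mul_of_nonneg_right (le_min (hδ hi) (hδ hk))
      (sub_nonneg.2 (max_le (hC.cum_lt_one i).le (hC.cum_lt_one k).le))

lemma cov_le_min_far (hC : IrreducibleChain K μ) {i k : Fin n} (h : SameSide M i k) :
    cov μ i k ≤ min (far μ M i) (far μ M k) := by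
  unfold SameSide at h
  unfold far cov
  have hmin : 0 < min (cum μ i) (cum μ k) := lt_min (hC.cum_pos i) (hC.cum_pos k)
  have hmax : max (cum μ i) (cum μ k) < 1 := max_lt (hC.cum_lt_one i) (hC.cum_lt_one k)
  by_cases hi : i.castSucc < M
  · rw [if_pos hi, if_pos (h.1 hi)]
    exact mul_le_of_le_one_right hmin.le (sub_le_self 1 (hmin.le.trans min_le_max))
  · rw [if_neg hi, if_neg fun hk => hi (h.2 hk), min_sub_sub_left]
    exact mul_le_of_le_one_left (sub_pos.2 hmax).le (min_le_max.trans hmax.le)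

lemma cov_eq_mul_far (hC : IrreducibleChain K μ) {i k : Fin n} (h : ¬ SameSide M i k) :
    cov μ i k = far μ M i * far μ M k := by
  wlog hi : i.castSucc < M generalizing i k
  · rw [cov_comm μ, this (i := k) (k := i) (fun h' => h h'.symm), mul_comm]
    by_contra hk
    exact h ⟨fun h' => absurd h' hi, fun h' => absurd h' hk⟩
  have hk : ¬ k.castSucc < M := fun hk => h ⟨fun _ => hk, fun _ => hi⟩
  have hik : i ≤ k := Fin.castSucc_le_castSucc_iff.1 (hi.trans_le (not_lt.1 hk)).le
  have hcum : cum μ i ≤ cum μ k := monotone_cum hC.nonneg hik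
  rw [far, far, if_pos hi, if_neg hk, cov, min_eq_left hcum, max_eq_right hcum]

lemma gap_mul_sum_le_one (hC : IrreducibleChain K μ) (hn : 1 ≤ n) {κ : ℝ} {r : Fin n → ℝ}
    (S : Finset (Fin n)) (hr : ∀ i, 0 ≤ r i)
    (h_le : ∀ i ∈ S, ∀ k ∈ S, κ * (r i * r k) ≤ cov μ i k) :
    spectralGap K * κ * ∑ i ∈ S, r i ^ 2 / flow K μ i ≤ 1 := by
  set d : Fin n → ℝ := fun i => if i ∈ S then r i / flow K μ i else 0 with hd
  set A := ∑ i ∈ S, r i ^ 2 / flow K μ i with hA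
  have hA0 : 0 ≤ A := Finset.sum_nonneg fun i _ => div_nonneg (sq_nonneg _) (hC.flow_pos i).le
  have henergy : ∑ i, flow K μ i * d i ^ 2 = A := by
    rw [hA, ← Finset.sum_subset (Finset.subset_univ S) fun i _ hi => by simp [hd, hi]]
    refine Finset.sum_congr rfl fun i hi => ?_
    have := (hC.flow_pos i).ne'
    simp only [hd, hi, if_true]
    field_simp
  have hvar : κ * A ^ 2 ≤ ∑ i, ∑ k, cov μ i k * d i * d k := by
    have hA' : A = ∑ i, r i * d i := by
      simp only [hd, mul_ite, mul_zero, Finset.sum_ite_mem, Finset.univ_inter, hA]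
      exact Finset.sum_congr rfl fun i _ => by ring
    rw [hA', sq, Finset.sum_mul_sum, Finset.mul_sum]
    refine Finset.sum_le_sum fun i _ => ?_
    rw [Finset.mul_sum]
    refine Finset.sum_le_sum fun k _ => ?_
    by_cases hik : i ∈ S ∧ k ∈ S
    · have hdd : 0 ≤ d i * d k := by
        simp only [hd, hik, if_true]
        exact mul_nonneg (div_nonneg (hr i) (hC.flow_pos i).le)
          (div_nonneg (hr k) (hC.flow_pos k).le)
      calc κ * (r i * d i * (r k * d k)) = κ * (r i * r k) * (d i * d k) := by ring
        _ ≤ cov μ i k * (d i * d k) :=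
            mul_le_mul_of_nonneg_right (h_le i hik.1 k hik.2) hdd
        _ = cov μ i k * d i * d k := (mul_assoc _ _ _).symm
    · rcases not_and_or.1 hik with h | h <;> simp [hd, h]
  have hle : spectralGap K * (κ * A ^ 2) ≤ A :=
    (mul_le_mul_of_nonneg_left hvar (hC.gap_pos hn).le).trans
      ((hC.poincare_gap hn d).trans_eq henergy)
  rcases hA0.eq_or_lt with h | h
  · rw [← h, mul_zero]; exact zero_le_one
  · exact le_of_mul_le_mul_left (by linarith) h

lemma gap_mul_meanGap_le (hC : IrreducibleChain K μ) (hn : 1 ≤ n) (hδ : 0 ≤ δ)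
    (hl : δ ≤ ∑ i ∈ Finset.Iic M, μ i) (hr : δ ≤ ∑ i ∈ Finset.Ici M, μ i) :
    spectralGap K * δ * meanGap K μ M ≤ 2 := by
  have hside (S : Finset (Fin n)) (hS : ∀ i ∈ S, ∀ k ∈ S, SameSide M i k) :
      spectralGap K * δ * ∑ i ∈ S, far μ M i ^ 2 / flow K μ i ≤ 1 :=
    hC.gap_mul_sum_le_one hn S (fun i => (hC.far_pos i).le) fun i hi k hk =>
      (mul_le_mul_of_nonneg_left (hC.far_mul_far_le_min i k) hδ).trans
        (hC.mul_min_far_le_cov hl hr (hS i hi k hk))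
  have hleft := hside {i | i.castSucc < M} fun i hi k hk =>
    iff_of_true (Finset.mem_filter_univ i |>.1 hi) (Finset.mem_filter_univ k |>.1 hk)
  have hright := hside {i | ¬ i.castSucc < M} fun i hi k hk =>
    iff_of_false (Finset.mem_filter_univ i |>.1 hi) (Finset.mem_filter_univ k |>.1 hk)
  rw [meanGap_eq_add]
  linarith

lemma gap_mul_sum_sameSide_le_far (hC : IrreducibleChain K μ) (hn : 1 ≤ n) (hδ : 0 ≤ δ)
    (hl : δ ≤ ∑ i ∈ Finset.Iic M, μ i) (hr : δ ≤ ∑ i ∈ Finset.Ici M, μ i) (k : Fin n) :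
    spectralGap K * δ * ∑ i with SameSide M i k ∧ far μ M i ≤ far μ M k,
      far μ M i ^ 2 / flow K μ i ≤ far μ M k := by
  have hk := hC.far_pos (M := M) k
  have := hC.gap_mul_sum_le_one hn (κ := δ / far μ M k) (r := far μ M)
    {i | SameSide M i k ∧ far μ M i ≤ far μ M k} (fun i => (hC.far_pos i).le) (by
      intro i hi j hj
      obtain ⟨hik, hi⟩ := (Finset.mem_filter_univ i).1 hi
      obtain ⟨hjk, hj⟩ := (Finset.mem_filter_univ j).1 hj
      refine le_trans ?_ (hC.mul_min_far_le_cov hl hr (hik.trans hjk.symm))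
      rw [div_mul_eq_mul_div, div_le_iff₀ hk, mul_assoc,
        ← min_mul_max (far μ M i) (far μ M j)]
      exact mul_le_mul_of_nonneg_left (mul_le_mul_of_nonneg_left (max_le hi hj)
        (le_min (hC.far_pos i).le (hC.far_pos j).le)) hδ)
  rwa [← mul_div_assoc, div_mul_eq_mul_div, div_le_one hk] at this

lemma hitVar_le_sum (hC : IrreducibleChain K μ) :
    hitVar K μ M ≤ 2 * ∑ k, (∑ i with SameSide M i k ∧ far μ M i ≤ far μ M k,
      far μ M i ^ 2 / flow K μ i) / flow K μ k := by
  set t : Fin n → Fin n → ℝ := fun i k =>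
    if SameSide M i k ∧ far μ M i ≤ far μ M k then far μ M i ^ 2 / flow K μ i / flow K μ k else 0
    with ht
  have ht0 (i k : Fin n) : 0 ≤ t i k := by
    have hi := hC.flow_pos i
    have hk := hC.flow_pos k
    simp only [ht]
    split_ifs <;> positivity
  have hle (i k : Fin n) : (if SameSide M i k then
      min (far μ M i) (far μ M k) ^ 2 / (flow K μ i * flow K μ k) else 0) ≤ t i k + t k i := by
    split_ifs with h
    · rcases le_total (far μ M i) (far μ M k) with hik | hki
      · rw [min_eq_left hik, ← div_div]
        exact le_add_of_le_of_nonneg (if_pos (⟨h, hik⟩ : _ ∧ _)).ge (ht0 k i)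
      · rw [min_eq_right hki, mul_comm, ← div_div]
        exact le_add_of_nonneg_of_le (ht0 i k) (if_pos (⟨h.symm, hki⟩ : _ ∧ _)).ge
    · exact add_nonneg (ht0 i k) (ht0 k i)
  calc hitVar K μ M ≤ ∑ i, ∑ k, (t i k + t k i) :=
        Finset.sum_le_sum fun i _ => Finset.sum_le_sum fun k _ => hle i k
    _ = 2 * ∑ k, ∑ i, t i k := by
        simp only [Finset.sum_add_distrib]
        rw [Finset.sum_comm, two_mul]
    _ = _ := by simp only [ht, Finset.sum_div, Finset.sum_filter, ite_div, zero_div]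

lemma gap_mul_hitVar_le (hC : IrreducibleChain K μ) (hn : 1 ≤ n) (hδ : 0 ≤ δ)
    (hl : δ ≤ ∑ i ∈ Finset.Iic M, μ i) (hr : δ ≤ ∑ i ∈ Finset.Ici M, μ i) :
    spectralGap K * δ * hitVar K μ M ≤ 2 * hitMean K μ M :=
  calc spectralGap K * δ * hitVar K μ M
      ≤ spectralGap K * δ * (2 * ∑ k, (∑ i with SameSide M i k ∧ far μ M i ≤ far μ M k,
          far μ M i ^ 2 / flow K μ i) / flow K μ k) :=
        mul_le_mul_of_nonneg_left hC.hitVar_le_sum (mul_nonneg (hC.gap_pos hn).le hδ)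
    _ = 2 * ∑ k, (spectralGap K * δ * ∑ i with SameSide M i k ∧ far μ M i ≤ far μ M k,
          far μ M i ^ 2 / flow K μ i) / flow K μ k := by
        rw [mul_left_comm, Finset.mul_sum]
        simp only [mul_div_assoc]
    _ ≤ 2 * hitMean K μ M :=
        mul_le_mul_of_nonneg_left (Finset.sum_le_sum fun k _ =>
          div_le_div_of_nonneg_right (hC.gap_mul_sum_sameSide_le_far hn hδ hl hr k)
            (hC.flow_pos k).le) zero_le_two

lemma sepVar_le (hC : IrreducibleChain K μ) : sepVar K μ ≤ hitVar K μ M + meanGap K μ M ^ 2 := by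
  rw [sepVar, hitVar, meanGap, sq, Finset.sum_mul_sum, ← Finset.sum_add_distrib]
  refine Finset.sum_le_sum fun i _ => ?_
  rw [← Finset.sum_add_distrib]
  refine Finset.sum_le_sum fun k _ => ?_
  have hi := hC.flow_pos i
  have hk := hC.flow_pos k
  rw [div_mul_div_comm]
  split_ifs with h
  · refine le_add_of_le_of_nonneg ?_ (by positivity)
    gcongr
    · exact (hC.cov_pos i k).le
    · exact hC.cov_le_min_far h
  · rw [hC.cov_eq_mul_far h, mul_pow, zero_add]

lemma meanGap_sq_le (hC : IrreducibleChain K μ) : meanGap K μ M ^ 2 ≤ 2 * hitVar K μ M := by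
  have hsides : (∑ i with i.castSucc < M, far μ M i ^ 2 / flow K μ i) ^ 2 +
      (∑ i with ¬ i.castSucc < M, far μ M i ^ 2 / flow K μ i) ^ 2 ≤ hitVar K μ M := by
    simp only [sq (Finset.sum _ _), Finset.sum_filter]
    rw [Finset.sum_mul_sum, Finset.sum_mul_sum, ← Finset.sum_add_distrib, hitVar]
    refine Finset.sum_le_sum fun i _ => ?_
    rw [← Finset.sum_add_distrib]
    refine Finset.sum_le_sum fun k _ => ?_
    have hi := hC.flow_pos i
    have hk := hC.flow_pos k
    have hprod : far μ M i ^ 2 / flow K μ i * (far μ M k ^ 2 / flow K μ k) ≤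
        min (far μ M i) (far μ M k) ^ 2 / (flow K μ i * flow K μ k) := by
      rw [div_mul_div_comm, ← mul_pow]
      have hfi := hC.far_pos (M := M) i
      have hfk := hC.far_pos (M := M) k
      gcongr
      exact hC.far_mul_far_le_min i k
    unfold SameSide
    by_cases h1 : i.castSucc < M <;> by_cases h2 : k.castSucc < M <;> simp [h1, h2, hprod]
  rw [meanGap_eq_add]
  exact add_sq_le.trans (by linarith)

lemma hitVar_pos (hC : IrreducibleChain K μ) (hn : 1 ≤ n) : 0 < hitVar K μ M := by
  have hsep : 0 < sepVar K μ :=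
    pos_of_mul_pos_right (zero_lt_one.trans_le (hC.one_le_gap_sq_mul_sepVar hn)) (sq_nonneg _)
  linarith [hC.sepVar_le (M := M), hC.meanGap_sq_le (M := M)]

lemma hitMean_lt_hitVar (hC : IrreducibleChain K μ) (hn : 1 ≤ n)
    (hmono : ∀ i : Fin n, K i.castSucc i.succ + K i.succ i.castSucc ≤ 1) :
    hitMean K μ M < hitVar K μ M := by
  have hdiag (i : Fin n) : far μ M i / flow K μ i < far μ M i ^ 2 / (flow K μ i * flow K μ i) := by
    have hflow := hC.flow_pos i
    rw [sq, mul_div_mul_comm]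
    exact lt_mul_of_one_lt_left (div_pos (hC.far_pos i) hflow)
      ((one_lt_div hflow).2 (hC.flow_lt_far (hmono i)))
  have : Nonempty (Fin n) := ⟨⟨0, hn⟩⟩
  refine (Finset.sum_lt_sum_of_nonempty Finset.univ_nonempty fun i _ => hdiag i).trans_le
    (Finset.sum_le_sum fun i _ => ?_)
  have hterm := Finset.single_le_sum (f := fun k => if SameSide M i k then
    min (far μ M i) (far μ M k) ^ 2 / (flow K μ i * flow K μ k) else 0) (fun k _ => by
      have hi := hC.flow_pos i
      have hk := hC.flow_pos k
      split_ifs <;> positivity) (Finset.mem_univ i)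
  have hrefl : SameSide M i i := Iff.rfl
  rwa [if_pos hrefl, min_self] at hterm

end IrreducibleChain

end Hitting

/-! ### Chebyshev's inequality for tail functions

The one-sided bounds are stated in terms of iterated integrals of the tail `F t = P(T > t)`, so no
random variable `T` has to be constructed. -/

section Chebyshev

variable {F F' U Z : ℝ → ℝ} {m v t : ℝ}

/-- `F` is decreasing from `F 0 = 1` and has the iterated tail integrals `U` and `Z`, as the tail
of a nonnegative random time with mean `m` and variance `v` does; `F'` is the derivative of `F`. -/
structure IsTail (F F' U Z : ℝ → ℝ) (m v : ℝ) : Prop where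
  hasDerivAt : ∀ t, HasDerivAt F (F' t) t
  hasDerivAt_fst : ∀ t, HasDerivAt U (-F t) t
  hasDerivAt_snd : ∀ t, HasDerivAt Z (-U t) t
  deriv_nonpos : ∀ t, 0 ≤ t → F' t ≤ 0
  fst_nonneg : ∀ t, 0 ≤ t → 0 ≤ U t
  snd_nonneg : ∀ t, 0 ≤ t → 0 ≤ Z t
  apply_zero : F 0 = 1
  fst_zero : U 0 = m
  two_mul_snd_zero : 2 * Z 0 = v + m ^ 2

namespace IsTail

/-- For a random time `T` with tail `F` this is `E[(T - m)²; T > t]`. -/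
def truncatedVar (F U Z : ℝ → ℝ) (m t : ℝ) : ℝ :=
  (t - m) ^ 2 * F t + 2 * (t - m) * U t + 2 * Z t

lemma hasDerivAt_sub_sq (m t : ℝ) : HasDerivAt (fun t : ℝ => (t - m) ^ 2) (2 * (t - m)) t := by
  simpa using ((hasDerivAt_id t).sub_const m).fun_pow 2

lemma hasDerivAt_truncatedVar (h : IsTail F F' U Z m v) (t : ℝ) :
    HasDerivAt (truncatedVar F U Z m) ((t - m) ^ 2 * F' t) t := by
  have := (((hasDerivAt_sub_sq m t).mul (h.hasDerivAt t)).add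
    ((((hasDerivAt_id t).sub_const m).const_mul 2).mul (h.hasDerivAt_fst t))).add
      ((h.hasDerivAt_snd t).const_mul 2)
  exact this.congr_deriv (by simp only [id]; ring)

lemma truncatedVar_zero (h : IsTail F F' U Z m v) : truncatedVar F U Z m 0 = v := by
  rw [truncatedVar, h.apply_zero, h.fst_zero, h.two_mul_snd_zero]
  ring

lemma antitoneOn_of_hasDerivAt {f f' : ℝ → ℝ} {s : Set ℝ} (hs : Convex ℝ s)
    (hf : ∀ t, HasDerivAt f (f' t) t) (hf' : ∀ t ∈ interior s, f' t ≤ 0) : AntitoneOn f s :=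
  antitoneOn_of_hasDerivWithinAt_nonpos hs (fun t _ => (hf t).continuousAt.continuousWithinAt)
    (fun t _ => (hf t).hasDerivWithinAt) hf'

lemma antitoneOn_truncatedVar (h : IsTail F F' U Z m v) :
    AntitoneOn (truncatedVar F U Z m) (Set.Ici 0) := by
  refine antitoneOn_of_hasDerivAt (convex_Ici 0) h.hasDerivAt_truncatedVar fun t ht => ?_
  rw [interior_Ici] at ht
  exact mul_nonpos_of_nonneg_of_nonpos (sq_nonneg _) (h.deriv_nonpos t ht.le)

lemma le_one (h : IsTail F F' U Z m v) (ht : 0 ≤ t) : F t ≤ 1 := by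
  have hanti : AntitoneOn F (Set.Ici 0) :=
    antitoneOn_of_hasDerivAt (convex_Ici 0) h.hasDerivAt fun t ht => by
      rw [interior_Ici] at ht
      exact h.deriv_nonpos t ht.le
  exact h.apply_zero ▸ hanti Set.self_mem_Ici ht ht

lemma sub_sq_mul_le (h : IsTail F F' U Z m v) (ht : 0 ≤ t) (hmt : m ≤ t) :
    (t - m) ^ 2 * F t ≤ v := by
  have hV : truncatedVar F U Z m t ≤ v :=
    h.truncatedVar_zero ▸ h.antitoneOn_truncatedVar Set.self_mem_Ici ht ht
  have hU := mul_nonneg (mul_nonneg zero_le_two (sub_nonneg.2 hmt)) (h.fst_nonneg t ht)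
  have hZ := h.snd_nonneg t ht
  rw [truncatedVar] at hV
  linarith

lemma truncatedVar_nonneg (h : IsTail F F' U Z m v) (ht : 0 ≤ t) (htm : t ≤ m) :
    0 ≤ truncatedVar F U Z m t := by
  refine le_trans ?_ (h.antitoneOn_truncatedVar ht (ht.trans htm) htm)
  have hZ := h.snd_nonneg m (ht.trans htm)
  rw [truncatedVar, sub_self]
  linarith

lemma sub_sq_mul_one_sub_le (h : IsTail F F' U Z m v) (ht : 0 ≤ t) (htm : t ≤ m) :
    (t - m) ^ 2 * (1 - F t) ≤ v := by
  have hderiv (s : ℝ) : HasDerivAt (fun s => truncatedVar F U Z m s + (s - m) ^ 2 * (1 - F s))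
      (2 * (s - m) * (1 - F s)) s :=
    ((h.hasDerivAt_truncatedVar s).add
      ((hasDerivAt_sub_sq m s).mul ((h.hasDerivAt s).const_sub 1))).congr_deriv (by ring)
  have hanti := antitoneOn_of_hasDerivAt (convex_Icc 0 m) hderiv fun s hs => by
    rw [interior_Icc] at hs
    exact mul_nonpos_of_nonpos_of_nonneg
      (mul_nonpos_of_nonneg_of_nonpos zero_le_two (sub_nonpos.2 hs.2.le))
      (sub_nonneg.2 (h.le_one hs.1.le))
  have hle := hanti ⟨le_rfl, ht.trans htm⟩ ⟨ht, htm⟩ ht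
  simp only [h.truncatedVar_zero, h.apply_zero, sub_self, mul_zero, add_zero] at hle
  linarith [h.truncatedVar_nonneg ht htm]

end IsTail

end Chebyshev

section DiscreteChebyshev

variable {F U Z : ℕ → ℝ} {m v : ℝ} {k : ℕ}

/-- `F` is decreasing from `F 0 = 1` and has the iterated tail sums `U` and `Z`, as the tail
`F k = P(T > k)` of a random time in `ℕ` does; that time has mean `m` and variance `v - m`. -/
structure IsNatTail (F U Z : ℕ → ℝ) (m v : ℝ) : Prop where
  antitone : Antitone F
  fst_succ : ∀ k, U (k + 1) = U k - F k
  snd_succ : ∀ k, Z (k + 1) = Z k - U k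
  nonneg : ∀ k, 0 ≤ F k
  fst_nonneg : ∀ k, 0 ≤ U k
  snd_nonneg : ∀ k, 0 ≤ Z k
  apply_zero : F 0 = 1
  fst_zero : U 0 = m
  two_mul_snd_zero : 2 * Z 0 = v + m ^ 2

namespace IsNatTail

/-- For a random time `T` with tail `F` this is `E[(T - m)²; T > k]`. -/
def truncatedVar (F U Z : ℕ → ℝ) (m : ℝ) (k : ℕ) : ℝ :=
  (k + 1 - m) ^ 2 * F k + (2 * (k + 1 - m) + 1) * U (k + 1) + 2 * Z (k + 2)

lemma truncatedVar_succ (h : IsNatTail F U Z m v) (k : ℕ) :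
    truncatedVar F U Z m (k + 1) =
      truncatedVar F U Z m k - (k + 1 - m) ^ 2 * (F k - F (k + 1)) := by
  simp only [truncatedVar, h.snd_succ (k + 2), h.fst_succ (k + 1)]
  push_cast
  ring

lemma truncatedVar_zero (h : IsNatTail F U Z m v) : truncatedVar F U Z m 0 = v - m := by
  simp only [truncatedVar, zero_add, h.snd_succ 1, h.snd_succ 0, h.fst_succ 0, h.apply_zero,
    h.fst_zero]
  push_cast
  linarith [h.two_mul_snd_zero]

lemma antitone_truncatedVar (h : IsNatTail F U Z m v) : Antitone (truncatedVar F U Z m) :=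
  antitone_nat_of_succ_le fun k => by
    rw [h.truncatedVar_succ]
    exact sub_le_self _ (mul_nonneg (sq_nonneg _) (sub_nonneg.2 (h.antitone k.le_succ)))

lemma sub_sq_mul_le_truncatedVar (h : IsNatTail F U Z m v) (hk : m ≤ k + 1) :
    (k + 1 - m) ^ 2 * F k ≤ truncatedVar F U Z m k := by
  have hU : 0 ≤ (2 * ((k : ℝ) + 1 - m) + 1) * U (k + 1) :=
    mul_nonneg (by linarith) (h.fst_nonneg _)
  have hZ := h.snd_nonneg (k + 2)
  rw [truncatedVar]
  linarith

lemma truncatedVar_nonneg (h : IsNatTail F U Z m v) (k : ℕ) : 0 ≤ truncatedVar F U Z m k := by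
  obtain ⟨j, hj⟩ := exists_nat_ge m
  have hmax : m ≤ (max k j : ℕ) + 1 :=
    hj.trans ((Nat.cast_le.2 (le_max_right k j)).trans (le_add_of_nonneg_right zero_le_one))
  exact (mul_nonneg (sq_nonneg _) (h.nonneg _)).trans
    ((h.sub_sq_mul_le_truncatedVar hmax).trans (h.antitone_truncatedVar (le_max_left k j)))

lemma sub_sq_mul_le (h : IsNatTail F U Z m v) (hk : m ≤ k + 1) :
    (k + 1 - m) ^ 2 * F k ≤ v - m :=
  (h.sub_sq_mul_le_truncatedVar hk).trans
    (h.truncatedVar_zero ▸ h.antitone_truncatedVar (Nat.zero_le k))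

lemma sub_sq_mul_one_sub_le (h : IsNatTail F U Z m v) (hk : k ≤ m) :
    (k - m) ^ 2 * (1 - F k) ≤ v - m := by
  have hle : (k - m) ^ 2 * (1 - F k) ≤ v - m - truncatedVar F U Z m k := by
    induction k with
    | zero => simp [h.truncatedVar_zero, h.apply_zero]
    | succ k ih =>
      push_cast at hk ⊢
      have hF : F k ≤ 1 := h.apply_zero ▸ h.antitone k.zero_le
      have hsq : ((k : ℝ) + 1 - m) ^ 2 ≤ (k - m) ^ 2 :=
        sq_le_sq.2 (by rw [abs_of_nonpos (by linarith), abs_of_nonpos (by linarith)]; linarith)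
      rw [h.truncatedVar_succ]
      linarith [ih (by linarith), mul_le_mul_of_nonneg_right hsq (sub_nonneg.2 hF)]
  linarith [h.truncatedVar_nonneg k]

end IsNatTail

end DiscreteChebyshev

/-! ### Operators preserving decreasing functions -/

section MonotoneOp

variable {n : ℕ} {K A B : Matrix (Fin (n + 1)) (Fin (n + 1)) ℝ} {μ : Fin (n + 1) → ℝ}
  {f : Fin (n + 1) → ℝ}

/-- An operator with row sums `1`, reversible with respect to `μ`, that preserves decreasing
functions and commutes with `K`. Nonnegativity of the entries is not part of the definition. -/
structure MonotoneOp (K : Matrix (Fin (n + 1)) (Fin (n + 1)) ℝ) (μ : Fin (n + 1) → ℝ)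
    (A : Matrix (Fin (n + 1)) (Fin (n + 1)) ℝ) : Prop where
  reversible : ∀ x y, μ x * A x y = μ y * A y x
  row_sum : ∀ x, ∑ y, A x y = 1
  antitone : ∀ f : Fin (n + 1) → ℝ, Antitone f → Antitone (A.mulVec f)
  comm : Commute A K

namespace MonotoneOp

lemma gen_mulVec (hA : MonotoneOp K μ A) (f : Fin (n + 1) → ℝ) :
    gen K (A.mulVec f) = A.mulVec (gen K f) := by
  rw [gen, gen, Matrix.mulVec_mulVec, Matrix.mulVec_mulVec, mul_sub, sub_mul, hA.comm.eq, one_mul,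
    mul_one]

lemma sum_mul_mulVec (hA : MonotoneOp K μ A) (f : Fin (n + 1) → ℝ) :
    ∑ x, μ x * A.mulVec f x = ∑ x, μ x * f x := by
  simp only [Matrix.mulVec, dotProduct, Finset.mul_sum]
  rw [Finset.sum_comm]
  refine Finset.sum_congr rfl fun y _ => ?_
  simp only [← mul_assoc, hA.reversible _ y, ← Finset.sum_mul, ← Finset.mul_sum, hA.row_sum,
    mul_one]

lemma mulVec_last_nonpos (hμ : μ ∈ stdSimplex ℝ (Fin (n + 1))) (hA : MonotoneOp K μ A)
    (hf : Antitone f) (h0 : ∑ x, μ x * f x = 0) : A.mulVec f (Fin.last n) ≤ 0 :=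
  calc A.mulVec f (Fin.last n) = ∑ x, μ x * A.mulVec f (Fin.last n) := by
        rw [← Finset.sum_mul, hμ.2, one_mul]
    _ ≤ ∑ x, μ x * A.mulVec f x := Finset.sum_le_sum fun x _ =>
        mul_le_mul_of_nonneg_left (hA.antitone f hf (Fin.le_last x)) (hμ.1 x)
    _ = 0 := by rw [hA.sum_mul_mulVec, h0]

lemma mulVec_startDensity (hA : MonotoneOp K μ A) (x : Fin (n + 1)) :
    A.mulVec (startDensity μ) x = A x 0 / μ 0 - 1 := by
  simp [Matrix.mulVec, dotProduct, startDensity, mul_sub, hA.row_sum, div_eq_mul_inv]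

lemma one_sub_div (hC : IrreducibleChain K μ) (hA : MonotoneOp K μ A) (x : Fin (n + 1)) :
    1 - A 0 x / μ x = -A.mulVec (startDensity μ) x := by
  have hrev : A 0 x / μ x = A x 0 / μ 0 := by
    rw [div_eq_div_iff (hC.pos x).ne' (hC.pos 0).ne', mul_comm, hA.reversible 0 x, mul_comm]
  rw [hA.mulVec_startDensity, hrev, neg_sub]

lemma sep_eq (hC : IrreducibleChain K μ) (hA : MonotoneOp K μ A) :
    sep (A 0) μ = -A.mulVec (startDensity μ) (Fin.last n) := by
  simp only [sep, hA.one_sub_div hC]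
  refine le_antisymm (ciSup_le fun x => ?_) ?_
  · exact neg_le_neg (hA.antitone _ hC.antitone_startDensity (Fin.le_last x))
  · exact le_ciSup (f := fun x => -A.mulVec (startDensity μ) x)
      (Set.finite_range _).bddAbove (Fin.last n)

lemma le_sep_of_mulVec_eq_smul (hC : IrreducibleChain K μ) (hA : MonotoneOp K μ A) {a : ℝ}
    (hf : Antitone f) (h0 : ∑ x, μ x * f x = 0) (hpos : 0 < f 0) (ha : A.mulVec f = a • f) :
    a ≤ sep (A 0) μ := by
  set σ := sep (A 0) μ
  have hminor (x : Fin (n + 1)) : (1 - σ) * μ x ≤ A 0 x := by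
    have : 1 - A 0 x / μ x ≤ σ :=
      le_ciSup (f := fun x => 1 - A 0 x / μ x) (Set.finite_range _).bddAbove x
    exact (le_div_iff₀ (hC.pos x)).1 (sub_le_comm.1 this)
  have hle : (1 - σ) * f 0 ≤ (1 - a) * f 0 :=
    calc (1 - σ) * f 0 = ∑ x, (1 - σ) * μ x * (f 0 - f x) := by
          simp only [mul_assoc, ← Finset.mul_sum, mul_sub (μ _), Finset.sum_sub_distrib,
            ← Finset.sum_mul, hC.sum_eq_one, h0, one_mul, sub_zero]
      _ ≤ ∑ x, A 0 x * (f 0 - f x) := Finset.sum_le_sum fun x _ =>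
          mul_le_mul_of_nonneg_right (hminor x) (sub_nonneg.2 (hf (Fin.zero_le x)))
      _ = f 0 - A.mulVec f 0 := by
          simp only [mul_sub, Finset.sum_sub_distrib, ← Finset.sum_mul, hA.row_sum, one_mul,
            Matrix.mulVec, dotProduct]
      _ = (1 - a) * f 0 := by rw [ha, Pi.smul_apply, smul_eq_mul, sub_mul, one_mul]
  linarith [le_of_mul_le_mul_right hle hpos]

lemma one (K : Matrix (Fin (n + 1)) (Fin (n + 1)) ℝ) (μ : Fin (n + 1) → ℝ) :
    MonotoneOp K μ 1 where
  reversible x y := by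
    by_cases h : x = y
    · rw [h]
    · rw [Matrix.one_apply_ne h, Matrix.one_apply_ne (Ne.symm h), mul_zero, mul_zero]
  row_sum x := by simp [Matrix.one_apply]
  antitone f hf := by rwa [Matrix.one_mulVec]
  comm := Commute.one_left K

lemma mul (hA : MonotoneOp K μ A) (hB : MonotoneOp K μ B) (hAB : Commute A B) :
    MonotoneOp K μ (A * B) where
  reversible x y := by
    have hcomm : (A * B) y x = (B * A) y x := by rw [hAB.eq]
    rw [hcomm, Matrix.mul_apply, Matrix.mul_apply, Finset.mul_sum, Finset.mul_sum]
    refine Finset.sum_congr rfl fun z _ => ?_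
    rw [← mul_assoc, hA.reversible x z, mul_right_comm, hB.reversible z y]; ring
  row_sum x := by
    simp only [Matrix.mul_apply]
    rw [Finset.sum_comm]
    simp only [← Finset.mul_sum, hB.row_sum, mul_one, hA.row_sum]
  antitone f hf := by
    rw [← Matrix.mulVec_mulVec]
    exact hA.antitone _ (hB.antitone f hf)
  comm := hA.comm.mul_left hB.comm

lemma pow (hA : MonotoneOp K μ A) (k : ℕ) : MonotoneOp K μ (A ^ k) := by
  induction k with
  | zero => rw [pow_zero]; exact one K μ
  | succ k ih => rw [pow_succ]; exact ih.mul hA ((Commute.refl A).pow_left k)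

end MonotoneOp

namespace IsBirthDeath

lemma gen_last_nonpos (hK : IsBirthDeath K) (hf : Antitone f) : gen K f (Fin.last n) ≤ 0 := by
  rw [gen_apply_eq_sum hK.row_sum]
  exact Finset.sum_nonpos fun y _ =>
    mul_nonpos_of_nonneg_of_nonpos (hK.apply_nonneg _ y) (sub_nonpos.2 (hf (Fin.le_last y)))

lemma gen_castSucc_le (hK : IsBirthDeath K) (hf : Antitone f) (i : Fin n) :
    gen K f i.castSucc ≤ K i.castSucc i.succ * grad f i := by
  rw [gen_apply_eq_sum hK.row_sum, ← Finset.add_sum_erase _ _ (Finset.mem_univ i.succ), grad]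
  refine add_le_of_nonpos_right (Finset.sum_nonpos fun y hy => ?_)
  rcases le_or_gt y i.castSucc with h | h
  · exact mul_nonpos_of_nonneg_of_nonpos (hK.apply_nonneg _ y) (sub_nonpos.2 (hf h))
  · rw [(hK.apply_eq_zero_of_le_of_lt le_rfl h fun h => Finset.ne_of_mem_erase hy h.2).1, zero_mul]

lemma le_gen_succ (hK : IsBirthDeath K) (hf : Antitone f) (i : Fin n) :
    -(K i.succ i.castSucc * grad f i) ≤ gen K f i.succ := by
  rw [gen_apply_eq_sum hK.row_sum, ← Finset.add_sum_erase _ _ (Finset.mem_univ i.castSucc),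
    ← mul_neg, grad, neg_sub]
  refine le_add_of_nonneg_right (Finset.sum_nonneg fun y hy => ?_)
  rcases le_or_gt y i.castSucc with h | h
  · rw [(hK.apply_eq_zero_of_le_of_lt h Fin.castSucc_lt_succ fun h =>
      Finset.ne_of_mem_erase hy h.1).2, zero_mul]
  · exact mul_nonneg (hK.apply_nonneg _ y) (sub_nonneg.2 (hf (Fin.castSucc_lt_iff_succ_le.1 h)))

lemma antitone_sub_mul_gen (hK : IsBirthDeath K) {a : ℝ} (ha : 0 ≤ a)
    (hmono : ∀ i : Fin n, a * (K i.castSucc i.succ + K i.succ i.castSucc) ≤ 1)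
    (hf : Antitone f) : Antitone (fun x => f x - a * gen K f x) := by
  refine antitone_iff_grad_nonneg.2 fun i => ?_
  have hgen : a * (gen K f i.castSucc - gen K f i.succ) ≤ grad f i :=
    calc a * (gen K f i.castSucc - gen K f i.succ)
        ≤ a * ((K i.castSucc i.succ + K i.succ i.castSucc) * grad f i) :=
          mul_le_mul_of_nonneg_left
            (by linarith [hK.gen_castSucc_le hf i, hK.le_gen_succ hf i]) ha
      _ = a * (K i.castSucc i.succ + K i.succ i.castSucc) * grad f i := (mul_assoc _ _ _).symm
      _ ≤ grad f i := mul_le_of_le_one_left (antitone_iff_grad_nonneg.1 hf i) (hmono i)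
  rw [grad] at hgen ⊢
  linarith

end IsBirthDeath

namespace IrreducibleChain

lemma reversible (hC : IrreducibleChain K μ) (x y : Fin (n + 1)) :
    μ x * K x y = μ y * K y x := by
  wlog hxy : x < y generalizing x y
  · rcases (not_lt.1 hxy).eq_or_lt with rfl | h
    · rfl
    · exact (this y x h).symm
  obtain ⟨i, rfl⟩ := Fin.exists_castSucc_eq.2 (hxy.trans_le (Fin.le_last y)).ne
  by_cases hy : y = i.succ
  · rw [hy, hC.balance]
  · obtain ⟨hxy0, hyx0⟩ := hC.apply_eq_zero_of_le_of_lt le_rfl hxy fun h => hy h.2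
    rw [hxy0, hyx0, mul_zero, mul_zero]

lemma monotoneOp (hC : IrreducibleChain K μ)
    (hmono : ∀ i : Fin n, K i.castSucc i.succ + K i.succ i.castSucc ≤ 1) :
    MonotoneOp K μ K where
  reversible := hC.reversible
  row_sum := hC.row_sum
  antitone f hf := by
    have := hC.antitone_sub_mul_gen zero_le_one (by simpa only [one_mul] using hmono) hf
    simpa only [gen_apply, one_mul, sub_sub_cancel] using this
  comm := Commute.refl K

end IrreducibleChain

end MonotoneOp

/-! ### The heat semigroup -/

section MatrixExp

variable {ι : Type*} [Fintype ι] [DecidableEq ι] {A : Matrix ι ι ℝ}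

lemma mulVec_pow_of_mulVec_eq_smul {f : ι → ℝ} {a : ℝ} (h : A.mulVec f = a • f) (k : ℕ) :
    (A ^ k).mulVec f = a ^ k • f := by
  induction k with
  | zero => rw [pow_zero, pow_zero, Matrix.one_mulVec, one_smul]
  | succ k ih =>
    rw [pow_succ', ← Matrix.mulVec_mulVec, ih, Matrix.mulVec_smul, h, smul_smul, pow_succ]

open scoped Matrix.Norms.Operator in
lemma hasSum_map_exp (ℓ : Matrix ι ι ℝ →ₗ[ℝ] ℝ) (A : Matrix ι ι ℝ) :
    HasSum (fun k : ℕ => (k.factorial : ℝ)⁻¹ * ℓ (A ^ k)) (ℓ (NormedSpace.exp A)) := by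
  have hsum : HasSum (fun k : ℕ => (k.factorial : ℝ)⁻¹ • A ^ k) (NormedSpace.exp A) :=
    NormedSpace.exp_series_hasSum_exp' (𝕂 := ℝ) A
  simpa only [Function.comp_def, map_smul, smul_eq_mul] using
    hsum.map ℓ ℓ.continuous_of_finiteDimensional

/-- The linear functional `A ↦ (A v) x` on matrices. -/
def evalAt (v : ι → ℝ) (x : ι) : Matrix ι ι ℝ →ₗ[ℝ] ℝ where
  toFun A := A.mulVec v x
  map_add' A B := by rw [Matrix.add_mulVec, Pi.add_apply]
  map_smul' a A := by rw [Matrix.smul_mulVec, Pi.smul_apply, RingHom.id_apply]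

omit [DecidableEq ι] in
lemma evalAt_apply (v : ι → ℝ) (x : ι) (A : Matrix ι ι ℝ) : evalAt v x A = A.mulVec v x := rfl

lemma exp_mulVec_of_mulVec_eq_smul {f : ι → ℝ} {a : ℝ} (h : A.mulVec f = a • f) :
    (NormedSpace.exp A).mulVec f = Real.exp a • f := by
  funext x
  have hexp : HasSum (fun k : ℕ => (k.factorial : ℝ)⁻¹ * a ^ k * f x) (Real.exp a * f x) := by
    rw [Real.exp_eq_exp_ℝ]
    exact (NormedSpace.exp_series_hasSum_exp' (𝕂 := ℝ) a).mul_right (f x)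
  refine (hasSum_map_exp (evalAt f x) A).unique (hexp.congr_fun fun k => ?_)
  rw [evalAt_apply, mulVec_pow_of_mulVec_eq_smul h, Pi.smul_apply, smul_eq_mul, mul_assoc]

lemma map_exp_smul_nonneg (ℓ : Matrix ι ι ℝ →ₗ[ℝ] ℝ) {c : ℝ} (hc : 0 ≤ c)
    (h : ∀ k, 0 ≤ ℓ (A ^ k)) : 0 ≤ ℓ (NormedSpace.exp (c • A)) := by
  refine (hasSum_map_exp ℓ (c • A)).nonneg fun k => ?_
  rw [smul_pow, map_smul, smul_eq_mul]
  exact mul_nonneg (by positivity) (mul_nonneg (pow_nonneg hc k) (h k))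

end MatrixExp

section Heat

variable {n : ℕ} {K : Matrix (Fin (n + 1)) (Fin (n + 1)) ℝ} {μ : Fin (n + 1) → ℝ}

/-- The transition matrix `(1 + K) / 2` of the lazy chain. It preserves decreasing functions for
every birth and death chain, hence so does `heat K t = e^{-2t} exp (2t (1 + K) / 2)`. -/
noncomputable def lazy (K : Matrix (Fin (n + 1)) (Fin (n + 1)) ℝ) :
    Matrix (Fin (n + 1)) (Fin (n + 1)) ℝ := (1 / 2 : ℝ) • (1 + K)

lemma lazy_mulVec (K : Matrix (Fin (n + 1)) (Fin (n + 1)) ℝ) (f : Fin (n + 1) → ℝ) :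
    (lazy K).mulVec f = fun x => f x - 1 / 2 * gen K f x := by
  funext x
  simp only [lazy, Matrix.smul_mulVec, Matrix.add_mulVec, Matrix.one_mulVec, Pi.smul_apply,
    Pi.add_apply, smul_eq_mul, gen_apply]
  ring

lemma IrreducibleChain.monotoneOp_lazy (hC : IrreducibleChain K μ) : MonotoneOp K μ (lazy K) where
  reversible x y := by
    simp only [lazy, Matrix.smul_apply, Matrix.add_apply, smul_eq_mul]
    linarith [hC.reversible x y, (MonotoneOp.one K μ).reversible x y]
  row_sum x := by
    simp only [lazy, Matrix.smul_apply, Matrix.add_apply, smul_eq_mul, ← Finset.mul_sum,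
      Finset.sum_add_distrib, hC.row_sum, (MonotoneOp.one K μ).row_sum]
    norm_num
  antitone f hf := by
    rw [lazy_mulVec]
    refine hC.antitone_sub_mul_gen one_half_pos.le (fun i => ?_) hf
    linarith [hC.apply_le_one i.castSucc i.succ, hC.apply_le_one i.succ i.castSucc]
  comm := ((Commute.one_left K).add_left (Commute.refl K)).smul_left _

lemma heat_zero (K : Matrix (Fin (n + 1)) (Fin (n + 1)) ℝ) : heat K 0 = 1 := by
  rw [heat, neg_zero, zero_smul, NormedSpace.exp_zero]

lemma heat_eq (K : Matrix (Fin (n + 1)) (Fin (n + 1)) ℝ) (t : ℝ) :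
    heat K t = Real.exp (-(2 * t)) • NormedSpace.exp ((2 * t) • lazy K) := by
  have hsplit : (-t) • (1 - K) =
      (-(2 * t)) • (1 : Matrix (Fin (n + 1)) (Fin (n + 1)) ℝ) + (2 * t) • lazy K := by
    rw [lazy]; module
  have hscalar : NormedSpace.exp ((-(2 * t)) • (1 : Matrix (Fin (n + 1)) (Fin (n + 1)) ℝ)) =
      Real.exp (-(2 * t)) • 1 := by
    refine Matrix.ext_of_mulVec_single fun i => ?_
    rw [exp_mulVec_of_mulVec_eq_smul (a := -(2 * t)), Matrix.smul_mulVec, Matrix.one_mulVec]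
    rw [Matrix.smul_mulVec, Matrix.one_mulVec]
  rw [heat, hsplit, Matrix.exp_add_of_commute, hscalar, smul_mul_assoc, one_mul]
  exact ((Commute.one_left _).smul_left _).smul_right _

lemma map_heat_nonneg (ℓ : Matrix (Fin (n + 1)) (Fin (n + 1)) ℝ →ₗ[ℝ] ℝ) {t : ℝ} (ht : 0 ≤ t)
    (h : ∀ k, 0 ≤ ℓ (lazy K ^ k)) : 0 ≤ ℓ (heat K t) := by
  rw [heat_eq, map_smul, smul_eq_mul]
  exact mul_nonneg (Real.exp_pos _).le
    (map_exp_smul_nonneg ℓ (mul_nonneg zero_le_two ht) h)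

lemma heat_mulVec_of_gen_eq_smul {f : Fin (n + 1) → ℝ} {l : ℝ} (h : gen K f = l • f) (t : ℝ) :
    (heat K t).mulVec f = Real.exp (-t * l) • f := by
  refine exp_mulVec_of_mulVec_eq_smul ?_
  rw [Matrix.smul_mulVec, mul_smul, ← h, gen]

lemma IrreducibleChain.monotoneOp_heat (hC : IrreducibleChain K μ) {t : ℝ} (ht : 0 ≤ t) :
    MonotoneOp K μ (heat K t) where
  reversible := by
    have hle (x y : Fin (n + 1)) : μ y * heat K t y x ≤ μ x * heat K t x y :=
      sub_nonneg.1 <| map_heat_nonneg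
        (μ x • Matrix.entryLinearMap ℝ ℝ x y - μ y • Matrix.entryLinearMap ℝ ℝ y x) ht fun k =>
          sub_nonneg.2 ((hC.monotoneOp_lazy.pow k).reversible y x).le
    exact fun x y => le_antisymm (hle y x) (hle x y)
  row_sum x := by
    have hconst : gen K (fun _ => 1) = (0 : ℝ) • (fun _ => 1) := by
      funext x
      simp [gen_apply, Matrix.mulVec, dotProduct, hC.row_sum]
    simpa [Matrix.mulVec, dotProduct] using congrFun (heat_mulVec_of_gen_eq_smul hconst t) x
  antitone f hf x y hxy := sub_nonneg.1 <|
    map_heat_nonneg (evalAt f x - evalAt f y) ht fun k =>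
      sub_nonneg.2 ((hC.monotoneOp_lazy.pow k).antitone f hf hxy)
  comm := by
    open scoped Matrix.Norms.Operator in
    exact Commute.exp_left (((Commute.one_left K).sub_left (Commute.refl K)).smul_left (-t))

open scoped Matrix.Norms.Operator in
lemma hasDerivAt_heat (v : Fin (n + 1) → ℝ) (x : Fin (n + 1)) (t : ℝ) :
    HasDerivAt (fun t => (heat K t).mulVec v x) (-(heat K t).mulVec (gen K v) x) t := by
  have hexp (t : ℝ) : heat K t = NormedSpace.exp (t • -(1 - K)) := by
    rw [heat, smul_neg, neg_smul]
  have hderiv := (evalAt v x).toContinuousLinearMap.hasFDerivAt.comp_hasDerivAt t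
    (hasDerivAt_exp_smul_const (-(1 - K)) t)
  simp only [hexp]
  refine hderiv.congr_deriv ?_
  change (_ * -(1 - K)).mulVec v x = _
  rw [mul_neg, Matrix.neg_mulVec, ← Matrix.mulVec_mulVec]
  rfl

end Heat

/-! ### Separation mixing times -/

section MixingTimes

variable {n : ℕ} {K : Matrix (Fin (n + 1)) (Fin (n + 1)) ℝ} {μ : Fin (n + 1) → ℝ} {ε r : ℝ}

lemma exists_pos_le_mul_sq (hε : 0 < ε) (c : ℝ) : ∃ r > 0, c ≤ ε * r ^ 2 := by
  refine ⟨|c| / ε + 1, by positivity, ?_⟩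
  have hdiv : 0 ≤ |c| / ε := by positivity
  calc c ≤ |c| := le_abs_self c
    _ = ε * (|c| / ε) := (mul_div_cancel₀ _ hε.ne').symm
    _ ≤ ε * (|c| / ε + 1) ^ 2 := mul_le_mul_of_nonneg_left (by nlinarith) hε.le

lemma startDensity_last (μ : Fin (n + 1) → ℝ) (hn : 1 ≤ n) :
    startDensity μ (Fin.last n) = -1 := by
  have hne : Fin.last n ≠ 0 := by
    rw [ne_eq, Fin.ext_iff, Fin.val_last, Fin.val_zero]; omega
  simp [startDensity, hne]

namespace IrreducibleChain

lemma sepMean_nonneg (hC : IrreducibleChain K μ) : 0 ≤ sepMean K μ :=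
  Finset.sum_nonneg fun i _ => div_nonneg
    (mul_nonneg (hC.cum_pos i).le (sub_nonneg.2 (hC.cum_lt_one i).le)) (hC.flow_pos i).le

lemma antitone_green_startDensity (hC : IrreducibleChain K μ) :
    Antitone (green K μ (startDensity μ)) :=
  hC.antitone_green hC.sum_mul_startDensity hC.antitone_startDensity

lemma antitone_green_green_startDensity (hC : IrreducibleChain K μ) :
    Antitone (green K μ (green K μ (startDensity μ))) :=
  hC.antitone_green (hC.sum_mul_green _) hC.antitone_green_startDensity

lemma isTail_sep_heat (hC : IrreducibleChain K μ) (hn : 1 ≤ n) :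
    IsTail (fun t => -(heat K t).mulVec (startDensity μ) (Fin.last n))
      (fun t => (heat K t).mulVec (gen K (startDensity μ)) (Fin.last n))
      (fun t => -(heat K t).mulVec (green K μ (startDensity μ)) (Fin.last n))
      (fun t => -(heat K t).mulVec (green K μ (green K μ (startDensity μ))) (Fin.last n))
      (sepMean K μ) (sepVar K μ) := by
  have hderiv (v : Fin (n + 1) → ℝ) (t : ℝ) :
      HasDerivAt (fun t => -(heat K t).mulVec v (Fin.last n))
        ((heat K t).mulVec (gen K v) (Fin.last n)) t := by
    simpa only [neg_neg] using (hasDerivAt_heat (K := K) v (Fin.last n) t).fun_neg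
  exact {
    hasDerivAt := hderiv _
    hasDerivAt_fst t := by
      simpa only [neg_neg, hC.gen_green hC.sum_mul_startDensity] using
        hderiv (green K μ (startDensity μ)) t
    hasDerivAt_snd t := by
      simpa only [neg_neg, hC.gen_green (hC.sum_mul_green _)] using
        hderiv (green K μ (green K μ (startDensity μ))) t
    deriv_nonpos t ht := by
      rw [← (hC.monotoneOp_heat ht).gen_mulVec]
      exact hC.gen_last_nonpos ((hC.monotoneOp_heat ht).antitone _ hC.antitone_startDensity)
    fst_nonneg t ht := neg_nonneg.2 <| (hC.monotoneOp_heat ht).mulVec_last_nonpos hC.mem_stdSimplex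
      hC.antitone_green_startDensity (hC.sum_mul_green _)
    snd_nonneg t ht := neg_nonneg.2 <| (hC.monotoneOp_heat ht).mulVec_last_nonpos hC.mem_stdSimplex
      hC.antitone_green_green_startDensity (hC.sum_mul_green _)
    apply_zero := by rw [heat_zero, Matrix.one_mulVec, startDensity_last μ hn, neg_neg]
    fst_zero := by rw [heat_zero, Matrix.one_mulVec, hC.neg_green_startDensity_last]
    two_mul_snd_zero := by
      rw [heat_zero, Matrix.one_mulVec, hC.two_mul_neg_green_green_startDensity_last] }

lemma isNatTail_sep_pow (hC : IrreducibleChain K μ) (hn : 1 ≤ n)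
    (hmono : ∀ i : Fin n, K i.castSucc i.succ + K i.succ i.castSucc ≤ 1) :
    IsNatTail (fun k => -(K ^ k).mulVec (startDensity μ) (Fin.last n))
      (fun k => -(K ^ k).mulVec (green K μ (startDensity μ)) (Fin.last n))
      (fun k => -(K ^ k).mulVec (green K μ (green K μ (startDensity μ))) (Fin.last n))
      (sepMean K μ) (sepVar K μ) := by
  have hop (k : ℕ) : MonotoneOp K μ (K ^ k) := (hC.monotoneOp hmono).pow k
  have hstep (v : Fin (n + 1) → ℝ) (k : ℕ) : -(K ^ (k + 1)).mulVec v (Fin.last n) =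
      -(K ^ k).mulVec v (Fin.last n) - -(K ^ k).mulVec (gen K v) (Fin.last n) := by
    rw [pow_succ, ← Matrix.mulVec_mulVec, gen, Matrix.sub_mulVec, Matrix.one_mulVec,
      Matrix.mulVec_sub, Pi.sub_apply]
    ring
  exact {
    antitone := antitone_nat_of_succ_le fun k => by
      have hgen := hC.gen_last_nonpos ((hop k).antitone _ hC.antitone_startDensity)
      rw [(hop k).gen_mulVec] at hgen
      rw [hstep]
      linarith
    fst_succ k := by rw [hstep, hC.gen_green hC.sum_mul_startDensity]
    snd_succ k := by rw [hstep, hC.gen_green (hC.sum_mul_green _)]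
    nonneg k := neg_nonneg.2 <| (hop k).mulVec_last_nonpos hC.mem_stdSimplex
      hC.antitone_startDensity hC.sum_mul_startDensity
    fst_nonneg k := neg_nonneg.2 <| (hop k).mulVec_last_nonpos hC.mem_stdSimplex
      hC.antitone_green_startDensity (hC.sum_mul_green _)
    snd_nonneg k := neg_nonneg.2 <| (hop k).mulVec_last_nonpos hC.mem_stdSimplex
      hC.antitone_green_green_startDensity (hC.sum_mul_green _)
    apply_zero := by rw [pow_zero, Matrix.one_mulVec, startDensity_last μ hn, neg_neg]
    fst_zero := by rw [pow_zero, Matrix.one_mulVec, hC.neg_green_startDensity_last]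
    two_mul_snd_zero := by
      rw [pow_zero, Matrix.one_mulVec, hC.two_mul_neg_green_green_startDensity_last] }

lemma sub_sq_mul_sep_heat_le (hC : IrreducibleChain K μ) (hn : 1 ≤ n) {t : ℝ} (ht : 0 ≤ t)
    (hmt : sepMean K μ ≤ t) : (t - sepMean K μ) ^ 2 * sep (heat K t 0) μ ≤ sepVar K μ := by
  rw [(hC.monotoneOp_heat ht).sep_eq hC]
  exact (hC.isTail_sep_heat hn).sub_sq_mul_le ht hmt

lemma sub_sq_mul_one_sub_sep_heat_le (hC : IrreducibleChain K μ) (hn : 1 ≤ n) {t : ℝ}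
    (ht : 0 ≤ t) (htm : t ≤ sepMean K μ) :
    (t - sepMean K μ) ^ 2 * (1 - sep (heat K t 0) μ) ≤ sepVar K μ := by
  rw [(hC.monotoneOp_heat ht).sep_eq hC]
  exact (hC.isTail_sep_heat hn).sub_sq_mul_one_sub_le ht htm

lemma sub_sq_mul_sep_pow_le (hC : IrreducibleChain K μ) (hn : 1 ≤ n)
    (hmono : ∀ i : Fin n, K i.castSucc i.succ + K i.succ i.castSucc ≤ 1) {k : ℕ}
    (hk : sepMean K μ ≤ k + 1) :
    (k + 1 - sepMean K μ) ^ 2 * sep ((K ^ k) 0) μ ≤ sepVar K μ - sepMean K μ := by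
  rw [((hC.monotoneOp hmono).pow k).sep_eq hC]
  exact (hC.isNatTail_sep_pow hn hmono).sub_sq_mul_le hk

lemma sub_sq_mul_one_sub_sep_pow_le (hC : IrreducibleChain K μ) (hn : 1 ≤ n)
    (hmono : ∀ i : Fin n, K i.castSucc i.succ + K i.succ i.castSucc ≤ 1) {k : ℕ}
    (hk : k ≤ sepMean K μ) :
    (k - sepMean K μ) ^ 2 * (1 - sep ((K ^ k) 0) μ) ≤ sepVar K μ - sepMean K μ := by
  rw [((hC.monotoneOp hmono).pow k).sep_eq hC]
  exact (hC.isNatTail_sep_pow hn hmono).sub_sq_mul_one_sub_le hk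

lemma exp_le_sep_heat (hC : IrreducibleChain K μ) (hn : 1 ≤ n) {t : ℝ} (ht : 0 ≤ t) :
    Real.exp (-t * spectralGap K) ≤ sep (heat K t 0) μ := by
  obtain ⟨f, hf0, hanti, hmean, hgen⟩ := hC.exists_antitone_eigenfunction hn
  exact (hC.monotoneOp_heat ht).le_sep_of_mulVec_eq_smul hC hanti hmean
    (hC.apply_zero_pos_of_antitone hf0 hanti hmean) (heat_mulVec_of_gen_eq_smul hgen t)

lemma pow_le_sep_pow (hC : IrreducibleChain K μ) (hn : 1 ≤ n)
    (hmono : ∀ i : Fin n, K i.castSucc i.succ + K i.succ i.castSucc ≤ 1) (k : ℕ) :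
    (1 - spectralGap K) ^ k ≤ sep ((K ^ k) 0) μ := by
  obtain ⟨f, hf0, hanti, hmean, hgen⟩ := hC.exists_antitone_eigenfunction hn
  have hK : K.mulVec f = (1 - spectralGap K) • f := by
    rw [sub_smul, one_smul, ← hgen, gen, Matrix.sub_mulVec, Matrix.one_mulVec, sub_sub_cancel]
  exact ((hC.monotoneOp hmono).pow k).le_sep_of_mulVec_eq_smul hC hanti hmean
    (hC.apply_zero_pos_of_antitone hf0 hanti hmean) (mulVec_pow_of_mulVec_eq_smul hK k)

lemma sep_heat_le (hC : IrreducibleChain K μ) (hn : 1 ≤ n) (hr : 0 < r)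
    (hvar : sepVar K μ ≤ ε * r ^ 2) : sep (heat K (sepMean K μ + r) 0) μ ≤ ε := by
  have hcheb := hC.sub_sq_mul_sep_heat_le hn (add_nonneg hC.sepMean_nonneg hr.le)
    (le_add_of_nonneg_right hr.le)
  rw [add_sub_cancel_left, mul_comm] at hcheb
  exact le_of_mul_le_mul_right (hcheb.trans hvar) (pow_pos hr 2)

lemma sep_pow_le (hC : IrreducibleChain K μ) (hn : 1 ≤ n)
    (hmono : ∀ i : Fin n, K i.castSucc i.succ + K i.succ i.castSucc ≤ 1) (hε : 0 < ε)
    (hr : 0 < r) (hvar : sepVar K μ - sepMean K μ ≤ ε * r ^ 2) :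
    sep ((K ^ ⌈sepMean K μ + r⌉₊) 0) μ ≤ ε := by
  set k := ⌈sepMean K μ + r⌉₊
  have hk : sepMean K μ + r ≤ k := Nat.le_ceil _
  have hsq : r ^ 2 ≤ (k + 1 - sepMean K μ) ^ 2 := pow_le_pow_left₀ hr.le (by linarith) 2
  refine le_of_mul_le_mul_left ?_ ((pow_pos hr 2).trans_le hsq)
  calc (k + 1 - sepMean K μ) ^ 2 * sep ((K ^ k) 0) μ
      ≤ sepVar K μ - sepMean K μ := hC.sub_sq_mul_sep_pow_le hn hmono (by linarith)
    _ ≤ ε * r ^ 2 := hvar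
    _ ≤ (k + 1 - sepMean K μ) ^ 2 * ε := by
      rw [mul_comm]
      exact mul_le_mul_of_nonneg_right hsq hε.le

lemma abs_sepTimeC_sub_le (hC : IrreducibleChain K μ) (hn : 1 ≤ n) (hε1 : ε < 1) (hr : 0 < r)
    (hvar : sepVar K μ ≤ ε * r ^ 2) (hvar' : sepVar K μ ≤ (1 - ε) * r ^ 2) :
    |sepTimeC K μ 0 ε - sepMean K μ| ≤ r := by
  have hmem : sepMean K μ + r ∈ {t : ℝ | 0 ≤ t ∧ sep (heat K t 0) μ ≤ ε} :=
    ⟨add_nonneg hC.sepMean_nonneg hr.le, hC.sep_heat_le hn hr hvar⟩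
  have hlower : sepMean K μ - r ≤ sepTimeC K μ 0 ε := by
    refine le_csInf ⟨_, hmem⟩ fun t ⟨ht, hsep⟩ => ?_
    by_contra! hlt
    have hsq : r ^ 2 < (t - sepMean K μ) ^ 2 := by nlinarith
    have hcheb := hC.sub_sq_mul_one_sub_sep_heat_le hn ht (by linarith)
    nlinarith [mul_le_mul_of_nonneg_left (sub_le_sub_left hsep 1) (sq_nonneg (t - sepMean K μ)),
      mul_lt_mul_of_pos_left hsq (sub_pos.2 hε1)]
  have hupper : sepTimeC K μ 0 ε ≤ sepMean K μ + r := csInf_le ⟨0, fun _ ht => ht.1⟩ hmem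
  exact abs_le.2 ⟨by linarith, by linarith⟩

lemma neg_log_le_sepTimeC (hC : IrreducibleChain K μ) (hn : 1 ≤ n) (hε : 0 < ε) :
    -Real.log ε ≤ spectralGap K * sepTimeC K μ 0 ε := by
  obtain ⟨r, hr, hvar⟩ := exists_pos_le_mul_sq hε (sepVar K μ)
  refine (div_le_iff₀' (hC.gap_pos hn)).1 (le_csInf
    ⟨_, add_nonneg hC.sepMean_nonneg hr.le, hC.sep_heat_le hn hr hvar⟩ fun t ⟨ht, hsep⟩ => ?_)
  rw [div_le_iff₀ (hC.gap_pos hn), neg_le, ← neg_mul]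
  exact (Real.le_log_iff_exp_le hε).2 ((hC.exp_le_sep_heat hn ht).trans hsep)

lemma abs_sepTime_sub_le (hC : IrreducibleChain K μ) (hn : 1 ≤ n)
    (hmono : ∀ i : Fin n, K i.castSucc i.succ + K i.succ i.castSucc ≤ 1)
    (hε : 0 < ε) (hε1 : ε < 1) (hr : 0 < r)
    (hvar : sepVar K μ - sepMean K μ ≤ ε * r ^ 2)
    (hvar' : sepVar K μ - sepMean K μ ≤ (1 - ε) * r ^ 2) :
    |(sepTime K μ 0 ε : ℝ) - sepMean K μ| ≤ r + 1 := by
  have hmem : ⌈sepMean K μ + r⌉₊ ∈ {k : ℕ | sep ((K ^ k) 0) μ ≤ ε} :=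
    hC.sep_pow_le hn hmono hε hr hvar
  have hlower : sepMean K μ - r ≤ sepTime K μ 0 ε := by
    have hsep : sep ((K ^ sepTime K μ 0 ε) 0) μ ≤ ε := Nat.sInf_mem ⟨_, hmem⟩
    set k := sepTime K μ 0 ε
    by_contra! hlt
    have hsq : r ^ 2 < (k - sepMean K μ) ^ 2 := by nlinarith
    have hcheb := hC.sub_sq_mul_one_sub_sep_pow_le hn hmono (k := k) (by linarith)
    nlinarith [mul_le_mul_of_nonneg_left (sub_le_sub_left hsep 1) (sq_nonneg (k - sepMean K μ)),
      mul_lt_mul_of_pos_left hsq (sub_pos.2 hε1)]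
  have hupper : (sepTime K μ 0 ε : ℝ) ≤ ⌈sepMean K μ + r⌉₊ := Nat.cast_le.2 (Nat.sInf_le hmem)
  have hceil := Nat.ceil_lt_add_one (add_nonneg hC.sepMean_nonneg hr.le)
  exact abs_le.2 ⟨by linarith, by linarith⟩

lemma neg_log_le_sepTime (hC : IrreducibleChain K μ) (hn : 1 ≤ n)
    (hmono : ∀ i : Fin n, K i.castSucc i.succ + K i.succ i.castSucc ≤ 1)
    (hε : 0 < ε) (hgap : spectralGap K ≤ 1 / 2) :
    -Real.log ε ≤ 2 * (spectralGap K * sepTime K μ 0 ε) := by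
  obtain ⟨r, hr, hvar⟩ := exists_pos_le_mul_sq hε (sepVar K μ - sepMean K μ)
  have hmem : ⌈sepMean K μ + r⌉₊ ∈ {k : ℕ | sep ((K ^ k) 0) μ ≤ ε} :=
    hC.sep_pow_le hn hmono hε hr hvar
  have hsep : sep ((K ^ sepTime K μ 0 ε) 0) μ ≤ ε := Nat.sInf_mem ⟨_, hmem⟩
  set k := sepTime K μ 0 ε
  have hexp : Real.exp (-(2 * spectralGap K)) ≤ 1 - spectralGap K := by
    rw [Real.exp_neg, inv_le_iff_one_le_mul₀ (Real.exp_pos _)]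
    nlinarith [Real.add_one_le_exp (2 * spectralGap K), hC.gap_pos hn]
  have hlog : k * -(2 * spectralGap K) ≤ Real.log ε := by
    rw [Real.le_log_iff_exp_le hε, Real.exp_nat_mul]
    exact (pow_le_pow_left₀ (Real.exp_pos _).le hexp k).trans
      ((hC.pow_le_sep_pow hn hmono k).trans hsep)
  linarith

end IrreducibleChain

end MixingTimes

/-! ### Cutoff criteria for sequences -/

section Sequences

variable {T : ℕ → ℝ → ℝ} {s c lam β : ℕ → ℝ}

/-- The estimates on mixing times `T n ε` in terms of times `s n`, gaps `lam n` and windows `β n`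
that make the product condition `s n * lam n → ∞` equivalent to a cutoff. -/
structure WindowBounds (T : ℕ → ℝ → ℝ) (s lam β : ℕ → ℝ) : Prop where
  gap_pos : ∀ n, 1 ≤ n → 0 < lam n
  natCast_le : ∀ n : ℕ, 1 ≤ n → (n : ℝ) ≤ s n
  window_pos : ∀ n, 1 ≤ n → 0 < β n
  gap_mul_sq_le : ∃ C : ℝ, ∀ n, 1 ≤ n → lam n * β n ^ 2 ≤ C * s n
  abs_sub_le : ∀ ε : ℝ, 0 < ε → ε < 1 → ∃ D : ℝ, ∀ n, 1 ≤ n → |T n ε - s n| ≤ D * β n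
  neg_log_le : ∀ ε : ℝ, 0 < ε → ε < 1 → ∀ n, 1 ≤ n → lam n ≤ 1 / 2 →
    -Real.log ε ≤ 2 * (lam n * T n ε)

lemma HasCutoff.eventually_le_three_mul (h : HasCutoff T) {ε : ℝ} (hε : 0 < ε) (hε1 : ε < 1) :
    ∀ᶠ n in atTop, T n ε ≤ 3 * T n (1 / 2) := by
  obtain ⟨t, ht, hT⟩ := h
  filter_upwards [eventually_ge_atTop 1,
    (hT ε hε hε1).eventually_lt_const (u := 3 / 2) (by norm_num),
    (hT (1 / 2) one_half_pos one_half_lt_one).eventually_const_lt (u := 1 / 2) one_half_lt_one]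
    with n hn hup hlow
  rw [div_lt_iff₀ (ht n hn)] at hup
  rw [lt_div_iff₀ (ht n hn)] at hlow
  linarith

namespace WindowBounds

lemma time_pos (h : WindowBounds T s lam β) (n : ℕ) (hn : 1 ≤ n) : 0 < s n :=
  (Nat.cast_pos.2 hn).trans_le (h.natCast_le n hn)

lemma tendsto_window_div (h : WindowBounds T s lam β)
    (hprod : Tendsto (fun n => s n * lam n) atTop atTop) :
    Tendsto (fun n => β n / s n) atTop (𝓝 0) := by
  obtain ⟨C, hC⟩ := h.gap_mul_sq_le
  have hbound : Tendsto (fun n => C * (s n * lam n)⁻¹) atTop (𝓝 0) := by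
    simpa only [mul_zero, Pi.inv_apply] using hprod.inv_tendsto_atTop.const_mul C
  have hsq : Tendsto (fun n => (β n / s n) ^ 2) atTop (𝓝 0) := by
    refine squeeze_zero' (Eventually.of_forall fun n => sq_nonneg _) ?_ hbound
    filter_upwards [eventually_ge_atTop 1] with n hn
    have hs := h.time_pos n hn
    have hlam := h.gap_pos n hn
    rw [div_pow, ← div_eq_mul_inv, div_le_div_iff₀ (pow_pos hs 2) (mul_pos hs hlam)]
    nlinarith [mul_le_mul_of_nonneg_left (hC n hn) hs.le]
  have hsqrt := (Real.continuous_sqrt.tendsto 0).comp hsq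
  simp only [Function.comp_def, Real.sqrt_sq_eq_abs, Real.sqrt_zero] at hsqrt
  exact (tendsto_zero_iff_abs_tendsto_zero _).2 hsqrt

lemma tendsto_div_window (h : WindowBounds T s lam β)
    (hprod : Tendsto (fun n => s n * lam n) atTop atTop) :
    Tendsto (fun n => s n / β n) atTop atTop := by
  have hpos : Tendsto (fun n => β n / s n) atTop (𝓝[>] 0) := by
    refine tendsto_nhdsWithin_iff.2 ⟨h.tendsto_window_div hprod, ?_⟩
    filter_upwards [eventually_ge_atTop 1] with n hn
    exact div_pos (h.window_pos n hn) (h.time_pos n hn)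
  simpa only [Function.comp_def, inv_div] using tendsto_inv_nhdsGT_zero.comp hpos

lemma tendsto_apply_div (h : WindowBounds T s lam β)
    (hprod : Tendsto (fun n => s n * lam n) atTop atTop) {ε : ℝ} (hε : 0 < ε) (hε1 : ε < 1) :
    Tendsto (fun n => T n ε / s n) atTop (𝓝 1) := by
  obtain ⟨D, hD⟩ := h.abs_sub_le ε hε hε1
  have hbound : Tendsto (fun n => D * (β n / s n)) atTop (𝓝 0) := by
    simpa only [mul_zero] using (h.tendsto_window_div hprod).const_mul D
  rw [tendsto_iff_norm_sub_tendsto_zero]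
  refine squeeze_zero' (Eventually.of_forall fun n => norm_nonneg _) ?_ hbound
  filter_upwards [eventually_ge_atTop 1] with n hn
  have hs := h.time_pos n hn
  rw [Real.norm_eq_abs, div_sub_one hs.ne', abs_div, abs_of_pos hs, ← mul_div_assoc]
  exact div_le_div_of_nonneg_right (hD n hn) hs.le

lemma hasCutoffWindow (h : WindowBounds T s lam β)
    (hprod : Tendsto (fun n => s n * lam n) atTop atTop) : HasCutoffWindow T s β where
  cutoff := ⟨s, h.time_pos, fun _ => h.tendsto_apply_div hprod⟩
  time_pos := h.time_pos
  window_pos := h.window_pos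
  window_small := h.tendsto_window_div hprod
  window ε hε hε1 := by
    obtain ⟨D, hD⟩ := h.abs_sub_le ε hε hε1
    refine ⟨D, ?_⟩
    filter_upwards [eventually_ge_atTop 1] with n hn
    exact (div_le_iff₀ (h.window_pos n hn)).2 (hD n hn)

lemma exists_gap_mul_le (h : WindowBounds T s lam β) :
    ∃ E > 0, ∀ n, 1 ≤ n → lam n * T n (1 / 2) ≤ E * (1 + s n * lam n) := by
  obtain ⟨C, hC⟩ := h.gap_mul_sq_le
  obtain ⟨D, hD⟩ := h.abs_sub_le (1 / 2) one_half_pos one_half_lt_one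
  refine ⟨1 + |D| * (1 + |C|), by positivity, fun n hn => ?_⟩
  have hlam := h.gap_pos n hn
  have hprod : 0 < s n * lam n := mul_pos (h.time_pos n hn) hlam
  have hwindow : lam n * β n ≤ (1 + |C|) * (1 + s n * lam n) :=
    calc lam n * β n ≤ 1 + lam n * (lam n * β n ^ 2) := by nlinarith [sq_nonneg (lam n * β n - 1)]
      _ ≤ 1 + lam n * (C * s n) := by linarith [mul_le_mul_of_nonneg_left (hC n hn) hlam.le]
      _ = 1 + C * (s n * lam n) := by ring
      _ ≤ 1 + |C| * (s n * lam n) := by gcongr; exact le_abs_self C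
      _ ≤ (1 + |C|) * (1 + s n * lam n) := by nlinarith [abs_nonneg C]
  calc lam n * T n (1 / 2) ≤ lam n * (s n + |D| * β n) := by
        refine mul_le_mul_of_nonneg_left ?_ hlam.le
        have := mul_le_mul_of_nonneg_right (le_abs_self D) (h.window_pos n hn).le
        linarith [(abs_le.1 (hD n hn)).2]
    _ = s n * lam n + |D| * (lam n * β n) := by ring
    _ ≤ s n * lam n + |D| * ((1 + |C|) * (1 + s n * lam n)) := by gcongr
    _ ≤ (1 + |D| * (1 + |C|)) * (1 + s n * lam n) := by linarith

lemma tendsto_of_hasCutoff (h : WindowBounds T s lam β) (hT : HasCutoff T) :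
    Tendsto (fun n => s n * lam n) atTop atTop := by
  obtain ⟨E, hE, hET⟩ := h.exists_gap_mul_le
  refine tendsto_atTop.2 fun B => ?_
  -- If `s n * lam n < B`, then `T n (1 / 2)` is at most a multiple of `1 / lam n`, which
  -- `T n ε ≤ 3 * T n (1 / 2)` contradicts for this small `ε`.
  set x := 6 * (E * (1 + |B|)) + 1
  have hx : 0 < x := by positivity
  filter_upwards [eventually_ge_atTop 1, eventually_ge_atTop ⌈2 * |B|⌉₊,
    hT.eventually_le_three_mul (Real.exp_pos (-x)) (Real.exp_lt_one_iff.2 (neg_lt_zero.2 hx))]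
    with n hn hBn hthree
  by_contra! hlt
  have hlam := h.gap_pos n hn
  have hprod : s n * lam n ≤ |B| := hlt.le.trans (le_abs_self B)
  have hn0 : (0 : ℝ) < n := Nat.cast_pos.2 hn
  have hhalf : lam n ≤ 1 / 2 := by
    refine le_of_mul_le_mul_left ?_ hn0
    have := mul_le_mul_of_nonneg_right (h.natCast_le n hn) hlam.le
    linarith [Nat.ceil_le.1 hBn]
  have hlower := h.neg_log_le _ (Real.exp_pos (-x)) (Real.exp_lt_one_iff.2 (neg_lt_zero.2 hx)) n hn
    hhalf
  rw [Real.log_exp, neg_neg] at hlower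
  have hupper : lam n * T n (Real.exp (-x)) ≤ 3 * (E * (1 + |B|)) :=
    calc lam n * T n (Real.exp (-x)) ≤ lam n * (3 * T n (1 / 2)) :=
          mul_le_mul_of_nonneg_left hthree hlam.le
      _ = 3 * (lam n * T n (1 / 2)) := by ring
      _ ≤ 3 * (E * (1 + s n * lam n)) := by linarith [hET n hn]
      _ ≤ 3 * (E * (1 + |B|)) := by gcongr
  linarith

lemma tendsto_of_tendsto_div (h : WindowBounds T s lam β) (hc : ∀ n, 1 ≤ n → 0 < c n)
    (hone : ∀ n, 1 ≤ n → 1 ≤ 3 * (lam n ^ 2 * (c n ^ 2 + s n)))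
    (hdiv : Tendsto (fun n => s n / c n) atTop atTop) :
    Tendsto (fun n => s n * lam n) atTop atTop := by
  have hs : Tendsto s atTop atTop := by
    refine tendsto_atTop_mono' _ ?_ tendsto_natCast_atTop_atTop
    filter_upwards [eventually_ge_atTop 1] with n hn using h.natCast_le n hn
  have hzero : Tendsto (fun n => 3 * ((s n / c n)⁻¹ ^ 2 + (s n)⁻¹)) atTop (𝓝[>] 0) := by
    refine tendsto_nhdsWithin_iff.2 ⟨?_, ?_⟩
    · simpa using ((hdiv.inv_tendsto_atTop.pow 2).add hs.inv_tendsto_atTop).const_mul 3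
    · filter_upwards [eventually_ge_atTop 1] with n hn
      have := h.time_pos n hn
      exact Set.mem_Ioi.2 (by positivity)
  refine tendsto_atTop_mono' _ ?_
    (Real.tendsto_sqrt_atTop.comp (tendsto_inv_nhdsGT_zero.comp hzero))
  filter_upwards [eventually_ge_atTop 1] with n hn
  have hsn := h.time_pos n hn
  have hcn := hc n hn
  refine Real.sqrt_le_iff.2 ⟨(mul_pos hsn (h.gap_pos n hn)).le, ?_⟩
  rw [Function.comp_apply, inv_le_iff_one_le_mul₀ (by positivity)]
  refine (hone n hn).trans_eq ?_
  field_simp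

lemma cutoff_criteria (h : WindowBounds T s lam β) (hc : ∀ n, 1 ≤ n → 0 < c n)
    (hcβ : ∀ n, 1 ≤ n → c n ≤ β n)
    (hone : ∀ n, 1 ≤ n → 1 ≤ 3 * (lam n ^ 2 * (c n ^ 2 + s n))) :
    (HasCutoff T ↔ Tendsto (fun n => s n * lam n) atTop atTop) ∧
    (Tendsto (fun n => s n * lam n) atTop atTop ↔ Tendsto (fun n => s n / c n) atTop atTop) ∧
    (Tendsto (fun n => s n / c n) atTop atTop → HasCutoffWindow T s β) := by
  have hdiv (hprod : Tendsto (fun n => s n * lam n) atTop atTop) :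
      Tendsto (fun n => s n / c n) atTop atTop := by
    refine tendsto_atTop_mono' _ ?_ (h.tendsto_div_window hprod)
    filter_upwards [eventually_ge_atTop 1] with n hn
    exact div_le_div_of_nonneg_left (h.time_pos n hn).le (hc n hn) (hcβ n hn)
  have hprod := h.tendsto_of_tendsto_div hc hone
  exact ⟨⟨h.tendsto_of_hasCutoff, fun hp => (h.hasCutoffWindow hp).cutoff⟩, ⟨hdiv, hprod⟩,
    fun hd => h.hasCutoffWindow (hprod hd)⟩

end WindowBounds

end Sequences

/-! ### Cutoff in terms of hitting times -/

section CutoffOfHitting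

variable {n : ℕ} {K : Matrix (Fin (n + 1)) (Fin (n + 1)) ℝ} {μ : Fin (n + 1) → ℝ}
  {M : Fin (n + 1)} {δ ε : ℝ}

lemma exists_pos_le_mul_sq_and_le (hε : 0 < ε) (hε1 : ε < 1) (c : ℝ) :
    ∃ r > 0, c ≤ ε * r ^ 2 ∧ c ≤ (1 - ε) * r ^ 2 := by
  obtain ⟨r, hr, hc⟩ := exists_pos_le_mul_sq (lt_min hε (sub_pos.2 hε1)) c
  exact ⟨r, hr, hc.trans (by gcongr; exact min_le_left _ _),
    hc.trans (by gcongr; exact min_le_right _ _)⟩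

/-- The window `max {c, 1 / λ}` of the discrete time chain, where `c ^ 2 = hitVar - hitMean` is the
sum of the variances of the discrete hitting times of `M` from both ends. -/
noncomputable def discWindow (K : Matrix (Fin (n + 1)) (Fin (n + 1)) ℝ) (μ : Fin (n + 1) → ℝ)
    (M : Fin (n + 1)) : ℝ :=
  max (√(hitVar K μ M - hitMean K μ M)) (1 / spectralGap K)

namespace IrreducibleChain

lemma abs_sub_hitMean_le (hC : IrreducibleChain K μ) {t r : ℝ} (h : |t - sepMean K μ| ≤ r) :
    |t - hitMean K μ M| ≤ r + meanGap K μ M := by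
  rw [← sepMean_add_meanGap, ← sub_sub]
  refine (abs_sub _ _).trans ?_
  rw [abs_of_nonneg hC.meanGap_nonneg]
  gcongr

lemma sepVar_le_three_mul_hitVar (hC : IrreducibleChain K μ) :
    sepVar K μ ≤ 3 * hitVar K μ M := by
  linarith [hC.sepVar_le (M := M), hC.meanGap_sq_le (M := M)]

lemma one_le_gap_sq_mul_hitVar (hC : IrreducibleChain K μ) (hn : 1 ≤ n) :
    1 ≤ 3 * (spectralGap K ^ 2 * hitVar K μ M) :=
  calc 1 ≤ spectralGap K ^ 2 * sepVar K μ := hC.one_le_gap_sq_mul_sepVar hn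
    _ ≤ spectralGap K ^ 2 * (3 * hitVar K μ M) :=
        mul_le_mul_of_nonneg_left hC.sepVar_le_three_mul_hitVar (sq_nonneg _)
    _ = 3 * (spectralGap K ^ 2 * hitVar K μ M) := by ring

lemma meanGap_le_two_mul_sqrt_hitVar (hC : IrreducibleChain K μ) (hn : 1 ≤ n) :
    meanGap K μ M ≤ 2 * √(hitVar K μ M) := by
  refine (abs_le_of_sq_le_sq' ?_ (by positivity)).2
  rw [mul_pow, Real.sq_sqrt (hC.hitVar_pos hn).le]
  linarith [hC.meanGap_sq_le (M := M), hC.hitVar_pos hn (M := M)]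

lemma abs_sepTimeC_sub_hitMean_le (hC : IrreducibleChain K μ) (hn : 1 ≤ n) (hε1 : ε < 1) {r : ℝ}
    (hr : 0 < r) (h : 3 ≤ ε * r ^ 2) (h' : 3 ≤ (1 - ε) * r ^ 2) :
    |sepTimeC K μ 0 ε - hitMean K μ M| ≤ (r + 2) * √(hitVar K μ M) := by
  have hv := hC.hitVar_pos hn (M := M)
  have hvar {a : ℝ} (ha : 3 ≤ a * r ^ 2) : sepVar K μ ≤ a * (r * √(hitVar K μ M)) ^ 2 := by
    rw [mul_pow, Real.sq_sqrt hv.le, ← mul_assoc]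
    exact hC.sepVar_le_three_mul_hitVar.trans (mul_le_mul_of_nonneg_right ha hv.le)
  have habs := hC.abs_sub_hitMean_le (M := M)
    (hC.abs_sepTimeC_sub_le hn hε1 (mul_pos hr (Real.sqrt_pos.2 hv)) (hvar h) (hvar h'))
  linarith [hC.meanGap_le_two_mul_sqrt_hitVar hn (M := M)]

lemma gap_mul_hitVar_le_mul_hitMean (hC : IrreducibleChain K μ) (hn : 1 ≤ n) (hδ : 0 < δ)
    (hl : δ ≤ ∑ i ∈ Finset.Iic M, μ i) (hr : δ ≤ ∑ i ∈ Finset.Ici M, μ i) :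
    spectralGap K * hitVar K μ M ≤ 2 / δ * hitMean K μ M := by
  rw [div_mul_eq_mul_div, le_div_iff₀ hδ, mul_right_comm]
  exact hC.gap_mul_hitVar_le hn hδ.le hl hr

lemma discWindow_pos (hC : IrreducibleChain K μ) (hn : 1 ≤ n) : 0 < discWindow K μ M :=
  (one_div_pos.2 (hC.gap_pos hn)).trans_le (le_max_right _ _)

lemma one_le_two_mul_discWindow (hC : IrreducibleChain K μ) (hn : 1 ≤ n) :
    1 ≤ 2 * discWindow K μ M := by
  have hhalf : 1 / 2 ≤ 1 / spectralGap K :=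
    one_div_le_one_div_of_le (hC.gap_pos hn) (hC.gap_le_two hn)
  have hwindow : 1 / 2 ≤ discWindow K μ M := hhalf.trans (le_max_right _ _)
  linarith

lemma meanGap_le_mul_discWindow (hC : IrreducibleChain K μ) (hn : 1 ≤ n) (hδ : 0 < δ)
    (hl : δ ≤ ∑ i ∈ Finset.Iic M, μ i) (hr : δ ≤ ∑ i ∈ Finset.Ici M, μ i) :
    meanGap K μ M ≤ 2 / δ * discWindow K μ M := by
  have hgap := hC.gap_pos hn
  calc meanGap K μ M ≤ 2 / δ * (1 / spectralGap K) := by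
        rw [div_mul_div_comm, mul_one, le_div_iff₀ (mul_pos hδ hgap), mul_comm, mul_comm δ]
        exact hC.gap_mul_meanGap_le hn hδ.le hl hr
    _ ≤ 2 / δ * discWindow K μ M := by
        gcongr
        exact le_max_right _ _

section Discrete

variable (hC : IrreducibleChain K μ) (hn : 1 ≤ n)
  (hmono : ∀ i : Fin n, K i.castSucc i.succ + K i.succ i.castSucc ≤ 1)
include hC hn hmono

lemma sqrt_hitVar_sub_hitMean_sq :
    √(hitVar K μ M - hitMean K μ M) ^ 2 = hitVar K μ M - hitMean K μ M :=
  Real.sq_sqrt (sub_nonneg.2 (hC.hitMean_lt_hitVar hn hmono).le)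

lemma gap_mul_discWindow_sq_le (hδ : 0 < δ) (hl : δ ≤ ∑ i ∈ Finset.Iic M, μ i)
    (hr : δ ≤ ∑ i ∈ Finset.Ici M, μ i) :
    spectralGap K * discWindow K μ M ^ 2 ≤ 6 / δ * hitMean K μ M := by
  have hgap := hC.gap_pos hn
  have hbound : 3 * (spectralGap K * hitVar K μ M) ≤ 6 / δ * hitMean K μ M :=
    (mul_le_mul_of_nonneg_left (hC.gap_mul_hitVar_le_mul_hitMean hn hδ hl hr)
      zero_le_three).trans_eq (by ring)
  refine le_trans ?_ hbound
  rcases max_choice (√(hitVar K μ M - hitMean K μ M)) (1 / spectralGap K) with h | h <;>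
    rw [discWindow, h]
  · rw [hC.sqrt_hitVar_sub_hitMean_sq hn hmono]
    nlinarith [mul_nonneg hgap.le (n.cast_nonneg.trans (hC.le_hitMean (M := M))),
      mul_pos hgap (hC.hitVar_pos hn (M := M))]
  · rw [one_div_pow, sq, mul_one_div, div_mul_cancel_left₀ hgap.ne', inv_le_iff_one_le_mul₀ hgap]
    linarith [hC.one_le_gap_sq_mul_hitVar hn (M := M)]

lemma sepVar_sub_sepMean_le_mul_discWindow_sq (hδ : 0 < δ) (hl : δ ≤ ∑ i ∈ Finset.Iic M, μ i)
    (hr : δ ≤ ∑ i ∈ Finset.Ici M, μ i) :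
    sepVar K μ - sepMean K μ ≤ (1 + 4 / δ + (2 / δ) ^ 2) * discWindow K μ M ^ 2 := by
  set β := discWindow K μ M
  have hgap : meanGap K μ M ≤ 2 / δ * β := hC.meanGap_le_mul_discWindow hn hδ hl hr
  have hβ : 0 < β := hC.discWindow_pos hn
  have hhit : hitVar K μ M - hitMean K μ M ≤ β ^ 2 := by
    rw [← hC.sqrt_hitVar_sub_hitMean_sq hn hmono]
    exact pow_le_pow_left₀ (Real.sqrt_nonneg _) (le_max_left _ _) 2
  calc sepVar K μ - sepMean K μ
      ≤ (hitVar K μ M - hitMean K μ M) + meanGap K μ M * 1 + meanGap K μ M ^ 2 := by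
        linarith [hC.sepVar_le (M := M), sepMean_add_meanGap K μ M]
    _ ≤ β ^ 2 + 2 / δ * β * (2 * β) + (2 / δ * β) ^ 2 := by
        gcongr
        · exact hC.one_le_two_mul_discWindow hn
        · exact hC.meanGap_nonneg
    _ = (1 + 4 / δ + (2 / δ) ^ 2) * β ^ 2 := by ring

lemma abs_sepTime_sub_hitMean_le (hδ : 0 < δ) (hl : δ ≤ ∑ i ∈ Finset.Iic M, μ i)
    (hr : δ ≤ ∑ i ∈ Finset.Ici M, μ i) (hε : 0 < ε) (hε1 : ε < 1) {r : ℝ} (hr0 : 0 < r)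
    (h : 1 + 4 / δ + (2 / δ) ^ 2 ≤ ε * r ^ 2) (h' : 1 + 4 / δ + (2 / δ) ^ 2 ≤ (1 - ε) * r ^ 2) :
    |(sepTime K μ 0 ε : ℝ) - hitMean K μ M| ≤ (r + 2 + 2 / δ) * discWindow K μ M := by
  have hvar {a : ℝ} (ha : 1 + 4 / δ + (2 / δ) ^ 2 ≤ a * r ^ 2) :
      sepVar K μ - sepMean K μ ≤ a * (r * discWindow K μ M) ^ 2 := by
    rw [mul_pow, ← mul_assoc]
    exact (hC.sepVar_sub_sepMean_le_mul_discWindow_sq hn hmono hδ hl hr).trans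
      (mul_le_mul_of_nonneg_right ha (sq_nonneg _))
  have habs := hC.abs_sub_hitMean_le (M := M) (hC.abs_sepTime_sub_le hn hmono hε hε1
    (mul_pos hr0 (hC.discWindow_pos hn)) (hvar h) (hvar h'))
  linarith [hC.meanGap_le_mul_discWindow hn hδ hl hr, hC.one_le_two_mul_discWindow hn (M := M)]

end Discrete

end IrreducibleChain

end CutoffOfHitting

section Families

variable {K : (n : ℕ) → Matrix (Fin (n + 1)) (Fin (n + 1)) ℝ} {μ : (n : ℕ) → Fin (n + 1) → ℝ}
  {M : (n : ℕ) → Fin (n + 1)} {δ : ℝ} {lam s b c : ℕ → ℝ}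
  (hC : ∀ n, 1 ≤ n → IrreducibleChain (K n) (μ n)) (hδ : 0 < δ)
  (hl : ∀ n, 1 ≤ n → δ ≤ ∑ i ∈ Finset.Iic (M n), μ n i)
  (hr : ∀ n, 1 ≤ n → δ ≤ ∑ i ∈ Finset.Ici (M n), μ n i)
  (hlam : ∀ n, lam n = spectralGap (K n))
  (hs : ∀ n, 1 ≤ n → s n = hitMean (K n) (μ n) (M n))
include hC hδ hl hr hlam hs

theorem continuous_cutoff (hb : ∀ n, 1 ≤ n → b n = √(hitVar (K n) (μ n) (M n))) :
    (HasCutoff (fun n ε => sepTimeC (K n) (μ n) 0 ε) ↔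
      Tendsto (fun n => s n * lam n) atTop atTop) ∧
    (Tendsto (fun n => s n * lam n) atTop atTop ↔ Tendsto (fun n => s n / b n) atTop atTop) ∧
    (Tendsto (fun n => s n / b n) atTop atTop →
      HasCutoffWindow (fun n ε => sepTimeC (K n) (μ n) 0 ε) s b) := by
  have hbpos (n : ℕ) (hn : 1 ≤ n) : 0 < b n := hb n hn ▸ Real.sqrt_pos.2 ((hC n hn).hitVar_pos hn)
  have hbsq (n : ℕ) (hn : 1 ≤ n) : b n ^ 2 = hitVar (K n) (μ n) (M n) := by
    rw [hb n hn, Real.sq_sqrt ((hC n hn).hitVar_pos hn).le]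
  have hle (n : ℕ) (hn : 1 ≤ n) : (n : ℝ) ≤ s n := hs n hn ▸ (hC n hn).le_hitMean
  have hwindow : WindowBounds (fun n ε => sepTimeC (K n) (μ n) 0 ε) s lam b :=
    { gap_pos := fun n hn => hlam n ▸ (hC n hn).gap_pos hn
      natCast_le := hle
      window_pos := hbpos
      gap_mul_sq_le := ⟨2 / δ, fun n hn => by
        rw [hbsq n hn, hs n hn, hlam]
        exact (hC n hn).gap_mul_hitVar_le_mul_hitMean hn hδ (hl n hn) (hr n hn)⟩
      abs_sub_le := fun ε hε hε1 => by
        obtain ⟨r, hr0, h, h'⟩ := exists_pos_le_mul_sq_and_le hε hε1 3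
        refine ⟨r + 2, fun n hn => ?_⟩
        rw [hs n hn, hb n hn]
        exact (hC n hn).abs_sepTimeC_sub_hitMean_le hn hε1 hr0 h h'
      neg_log_le := fun ε hε hε1 n hn _ => by
        rw [hlam]
        linarith [(hC n hn).neg_log_le_sepTimeC hn hε, Real.log_nonpos hε.le hε1.le] }
  refine hwindow.cutoff_criteria hbpos (fun _ _ => le_rfl) fun n hn => ?_
  have hone := (hC n hn).one_le_gap_sq_mul_hitVar hn (M := M n)
  rw [← hbsq n hn, ← hlam] at hone
  refine hone.trans ?_
  gcongr
  exact le_add_of_nonneg_right (n.cast_nonneg.trans (hle n hn))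

theorem discrete_cutoff
    (hc : ∀ n, 1 ≤ n → c n = √(hitVar (K n) (μ n) (M n) - hitMean (K n) (μ n) (M n)))
    (hmono : ∀ n, 1 ≤ n → ∀ i : Fin n, K n i.castSucc i.succ + K n i.succ i.castSucc ≤ 1) :
    (HasCutoff (fun n ε => (sepTime (K n) (μ n) 0 ε : ℝ)) ↔
      Tendsto (fun n => s n * lam n) atTop atTop) ∧
    (Tendsto (fun n => s n * lam n) atTop atTop ↔ Tendsto (fun n => s n / c n) atTop atTop) ∧
    (Tendsto (fun n => s n / c n) atTop atTop →
      HasCutoffWindow (fun n ε => (sepTime (K n) (μ n) 0 ε : ℝ)) s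
        (fun n => max (c n) (1 / lam n))) := by
  have hβ (n : ℕ) (hn : 1 ≤ n) : max (c n) (1 / lam n) = discWindow (K n) (μ n) (M n) := by
    rw [discWindow, hc n hn, hlam]
  have hwindow : WindowBounds (fun n ε => (sepTime (K n) (μ n) 0 ε : ℝ)) s lam
      (fun n => max (c n) (1 / lam n)) :=
    { gap_pos := fun n hn => hlam n ▸ (hC n hn).gap_pos hn
      natCast_le := fun n hn => hs n hn ▸ (hC n hn).le_hitMean
      window_pos := fun n hn => hβ n hn ▸ (hC n hn).discWindow_pos hn
      gap_mul_sq_le := ⟨6 / δ, fun n hn => by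
        rw [hβ n hn, hs n hn, hlam]
        exact (hC n hn).gap_mul_discWindow_sq_le hn (hmono n hn) hδ (hl n hn) (hr n hn)⟩
      abs_sub_le := fun ε hε hε1 => by
        obtain ⟨r, hr0, h, h'⟩ :=
          exists_pos_le_mul_sq_and_le hε hε1 (1 + 4 / δ + (2 / δ) ^ 2)
        refine ⟨r + 2 + 2 / δ, fun n hn => ?_⟩
        rw [hβ n hn, hs n hn]
        exact (hC n hn).abs_sepTime_sub_hitMean_le hn (hmono n hn) hδ (hl n hn) (hr n hn) hε hε1
          hr0 h h'
      neg_log_le := fun ε hε _ n hn hgap => by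
        rw [hlam] at hgap ⊢
        exact (hC n hn).neg_log_le_sepTime hn (hmono n hn) hε hgap }
  refine hwindow.cutoff_criteria (fun n hn => ?_) (fun n _ => le_max_left _ _) fun n hn => ?_
  · rw [hc n hn]
    exact Real.sqrt_pos.2 (sub_pos.2 ((hC n hn).hitMean_lt_hitVar hn (hmono n hn)))
  · rw [hc n hn, (hC n hn).sqrt_hitVar_sub_hitMean_sq hn (hmono n hn), hs n hn, sub_add_cancel,
      hlam]
    exact (hC n hn).one_le_gap_sq_mul_hitVar hn

end Families

/-! ### Potentials of the chain killed at a vertex -/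

section KilledGreen

variable {n : ℕ} {K : Matrix (Fin (n + 1)) (Fin (n + 1)) ℝ} {μ : Fin (n + 1) → ℝ}
  {M : Fin (n + 1)}

/-- The indicator function of the vertices on the side of the edge `{i, i+1}` that does not
contain `M`. -/
def beyond (M : Fin (n + 1)) (i : Fin n) (j : Fin (n + 1)) : ℝ :=
  if i.castSucc < M then below i j else 1 - below i j

/-- The Green operator of the chain killed at `M`: `killedGreen K μ M y` is the function `f` that
vanishes at `M` and satisfies `(I - K) f = y` elsewhere. -/
noncomputable def killedGreen (K : Matrix (Fin (n + 1)) (Fin (n + 1)) ℝ) (μ : Fin (n + 1) → ℝ)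
    (M : Fin (n + 1)) (y : Fin (n + 1) → ℝ) (j : Fin (n + 1)) : ℝ :=
  ∑ i, beyond M i j * ((∑ x, μ x * y x * beyond M i x) / flow K μ i)

/-- The function `y`, corrected at `M` so as to have mean zero under `μ`. -/
noncomputable def centerAt (μ : Fin (n + 1) → ℝ) (M : Fin (n + 1)) (y : Fin (n + 1) → ℝ) :
    Fin (n + 1) → ℝ :=
  y - Pi.single M ((∑ x, μ x * y x) / μ M)

lemma beyond_nonneg (M : Fin (n + 1)) (i : Fin n) (j : Fin (n + 1)) : 0 ≤ beyond M i j := by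
  unfold beyond
  split_ifs
  exacts [below_nonneg i j, sub_nonneg.2 (below_le_one i j)]

lemma beyond_self (M : Fin (n + 1)) (i : Fin n) : beyond M i M = 0 := by
  unfold beyond
  split_ifs with h
  exacts [below_of_lt h, by rw [below_of_le (not_lt.1 h), sub_self]]

lemma beyond_mul_beyond (M : Fin (n + 1)) (i : Fin n) (j x : Fin (n + 1)) :
    beyond M i j * beyond M i x = (below i j - below i M) * (below i x - below i M) := by
  unfold beyond
  split_ifs with h
  · rw [below_of_lt h, sub_zero, sub_zero]
  · rw [below_of_le (not_lt.1 h), ← neg_mul_neg, neg_sub, neg_sub]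

lemma beyond_zero_add_beyond_last (M : Fin (n + 1)) (i : Fin n) :
    beyond M i 0 + beyond M i (Fin.last n) = 1 := by
  unfold beyond
  split_ifs <;> simp [below_zero, below_last]

lemma beyond_zero_mul_add_beyond_last_mul (M : Fin (n + 1)) (i k : Fin n) :
    beyond M i 0 * beyond M k 0 + beyond M i (Fin.last n) * beyond M k (Fin.last n) =
      if SameSide M i k then 1 else 0 := by
  unfold beyond SameSide
  by_cases hi : i.castSucc < M <;> by_cases hk : k.castSucc < M <;>
    simp [hi, hk, below_zero, below_last]

lemma sum_mul_centerAt_mul (hM : μ M ≠ 0) (y φ : Fin (n + 1) → ℝ) :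
    ∑ x, μ x * centerAt μ M y x * φ x = ∑ x, μ x * y x * (φ x - φ M) := by
  have hsingle (a : ℝ) :
      ∑ x, (μ x * φ x) * (Pi.single M a : Fin (n + 1) → ℝ) x = μ M * φ M * a :=
    dotProduct_single (fun x => μ x * φ x) a M
  simp only [centerAt, Pi.sub_apply, mul_sub, sub_mul, Finset.sum_sub_distrib,
    mul_right_comm _ _ (φ _), hsingle]
  rw [mul_right_comm, mul_div_cancel₀ _ hM, Finset.sum_mul]
  simp only [mul_right_comm _ (φ M)]

lemma killedGreen_self (K : Matrix (Fin (n + 1)) (Fin (n + 1)) ℝ) (μ y : Fin (n + 1) → ℝ)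
    (M : Fin (n + 1)) : killedGreen K μ M y M = 0 := by
  simp [killedGreen, beyond_self]

namespace IrreducibleChain

lemma killedGreen_nonneg (hC : IrreducibleChain K μ) {y : Fin (n + 1) → ℝ} (hy : ∀ x, 0 ≤ y x)
    (j : Fin (n + 1)) : 0 ≤ killedGreen K μ M y j :=
  Finset.sum_nonneg fun i _ => mul_nonneg (beyond_nonneg M i j) <|
    div_nonneg (Finset.sum_nonneg fun x _ =>
      mul_nonneg (mul_nonneg (hC.nonneg x) (hy x)) (beyond_nonneg M i x)) (hC.flow_pos i).le

lemma killedGreen_eq_green_sub (hC : IrreducibleChain K μ) (M : Fin (n + 1))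
    (y : Fin (n + 1) → ℝ) (j : Fin (n + 1)) :
    killedGreen K μ M y j = green K μ (centerAt μ M y) j - green K μ (centerAt μ M y) M := by
  simp only [killedGreen, green, centeredPotential, ← Finset.sum_sub_distrib,
    sum_mul_centerAt_mul (hC.pos M).ne', ← sub_mul, sub_sub_sub_cancel_right]
  refine Finset.sum_congr rfl fun i _ => ?_
  rw [← mul_div_assoc, ← mul_div_assoc, Finset.mul_sum, Finset.mul_sum]
  congr 1
  refine Finset.sum_congr rfl fun x _ => ?_
  rw [mul_left_comm, beyond_mul_beyond, mul_left_comm]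

lemma gen_killedGreen (hC : IrreducibleChain K μ) (y : Fin (n + 1) → ℝ) {x : Fin (n + 1)}
    (hx : x ≠ M) : gen K (killedGreen K μ M y) x = y x := by
  have hmean : ∑ x, μ x * centerAt μ M y x = 0 := by
    simpa using sum_mul_centerAt_mul (hC.pos M).ne' y 1
  have hgen : gen K (killedGreen K μ M y) x = gen K (green K μ (centerAt μ M y)) x := by
    simp only [gen_apply_eq_sum hC.row_sum, hC.killedGreen_eq_green_sub, sub_sub_sub_cancel_right]
  rw [hgen, hC.gen_green hmean, centerAt, Pi.sub_apply, Pi.single_eq_of_ne hx, sub_zero]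

lemma sum_mul_beyond (hC : IrreducibleChain K μ) (M : Fin (n + 1)) (i : Fin n) :
    ∑ x, μ x * beyond M i x = far μ M i := by
  unfold beyond far
  split_ifs
  · rfl
  · exact (one_sub_cum hC.sum_eq_one i).symm

lemma sum_mul_beyond_mul_beyond (hC : IrreducibleChain K μ) (M : Fin (n + 1)) (i k : Fin n) :
    ∑ x, μ x * beyond M i x * beyond M k x =
      if SameSide M i k then min (far μ M i) (far μ M k) else 0 := by
  have hprod (i k : Fin n) : ∑ x, μ x * below i x * below k x = min (cum μ i) (cum μ k) :=
    sum_mul_below_mul_below hC.nonneg i k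
  have hle {i k : Fin n} (hi : i.castSucc < M) (hk : ¬ k.castSucc < M) : cum μ i ≤ cum μ k :=
    monotone_cum hC.nonneg (Fin.castSucc_le_castSucc_iff.1 (hi.trans_le (not_lt.1 hk)).le)
  have hcum (i : Fin n) : ∑ x, μ x * below i x = cum μ i := rfl
  unfold beyond far SameSide
  by_cases hi : i.castSucc < M <;> by_cases hk : k.castSucc < M <;>
    simp only [hi, hk, if_true, if_false, mul_sub, sub_mul, mul_one, Finset.sum_sub_distrib,
      hprod, hcum, hC.sum_eq_one, iff_true, iff_false, not_true_eq_false]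
  · rw [min_eq_left (hle hi hk), sub_self]
  · rw [min_eq_right (hle hk hi), sub_self]
  · rw [min_sub_sub_left]
    linarith [min_add_max (cum μ i) (cum μ k)]

/-- `killedGreen K μ M 1` is the mean of the hitting time of `M`, as a function of the starting
point. -/
lemma killedGreen_one (hC : IrreducibleChain K μ) (M j : Fin (n + 1)) :
    killedGreen K μ M 1 j = ∑ i, beyond M i j * (far μ M i / flow K μ i) := by
  simp only [killedGreen, Pi.one_apply, mul_one, hC.sum_mul_beyond]

lemma killedGreen_one_zero_add_last (hC : IrreducibleChain K μ) (M : Fin (n + 1)) :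
    killedGreen K μ M 1 0 + killedGreen K μ M 1 (Fin.last n) = hitMean K μ M := by
  simp only [hC.killedGreen_one, ← Finset.sum_add_distrib, ← add_mul,
    beyond_zero_add_beyond_last, one_mul, hitMean]

lemma killedGreen_one_zero_sq_add_last_sq (hC : IrreducibleChain K μ) (M : Fin (n + 1)) :
    killedGreen K μ M 1 0 ^ 2 + killedGreen K μ M 1 (Fin.last n) ^ 2 =
      ∑ i, ∑ k, (if SameSide M i k then far μ M i * far μ M k else 0) /
        (flow K μ i * flow K μ k) := by
  simp only [hC.killedGreen_one, sq, Finset.sum_mul_sum, ← Finset.sum_add_distrib]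
  refine Finset.sum_congr rfl fun i _ => Finset.sum_congr rfl fun k _ => ?_
  rw [mul_mul_mul_comm (beyond M i 0), mul_mul_mul_comm (beyond M i (Fin.last n)), ← add_mul,
    beyond_zero_mul_add_beyond_last_mul, ite_mul, one_mul, zero_mul, div_mul_div_comm]
  split_ifs
  exacts [rfl, (zero_div _).symm]

lemma killedGreen_killedGreen_one_zero_add_last (hC : IrreducibleChain K μ) (M : Fin (n + 1)) :
    killedGreen K μ M (killedGreen K μ M 1) 0 +
        killedGreen K μ M (killedGreen K μ M 1) (Fin.last n) =
      ∑ i, ∑ k, (if SameSide M i k then far μ M k * min (far μ M i) (far μ M k) else 0) /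
        (flow K μ i * flow K μ k) := by
  have hsum (i : Fin n) : ∑ x, μ x * killedGreen K μ M 1 x * beyond M i x =
      ∑ k, (if SameSide M i k then far μ M k * min (far μ M i) (far μ M k) else 0) / flow K μ k :=
    calc ∑ x, μ x * killedGreen K μ M 1 x * beyond M i x
        = ∑ k, far μ M k / flow K μ k * ∑ x, μ x * beyond M i x * beyond M k x := by
          simp only [hC.killedGreen_one, Finset.mul_sum, Finset.sum_mul]
          rw [Finset.sum_comm]
          exact Finset.sum_congr rfl fun k _ => Finset.sum_congr rfl fun x _ => by ring
      _ = _ := Finset.sum_congr rfl fun k _ => by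
          rw [hC.sum_mul_beyond_mul_beyond, div_mul_eq_mul_div, mul_ite, mul_zero]
  rw [killedGreen, killedGreen, ← Finset.sum_add_distrib]
  refine Finset.sum_congr rfl fun i _ => ?_
  rw [← add_mul, beyond_zero_add_beyond_last, one_mul, hsum, Finset.sum_div]
  exact Finset.sum_congr rfl fun k _ => by rw [div_div, mul_comm (flow K μ k)]

lemma two_mul_killedGreen_sub_sq (hC : IrreducibleChain K μ) (M : Fin (n + 1)) :
    2 * (killedGreen K μ M (killedGreen K μ M 1) 0 +
        killedGreen K μ M (killedGreen K μ M 1) (Fin.last n)) -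
      (killedGreen K μ M 1 0 ^ 2 + killedGreen K μ M 1 (Fin.last n) ^ 2) = hitVar K μ M := by
  have hswap := hC.killedGreen_killedGreen_one_zero_add_last M
  rw [Finset.sum_comm] at hswap
  rw [two_mul, hC.killedGreen_one_zero_sq_add_last_sq]
  nth_rewrite 1 [hC.killedGreen_killedGreen_one_zero_add_last M]
  rw [hswap, hitVar]
  simp only [← Finset.sum_add_distrib, ← Finset.sum_sub_distrib]
  refine Finset.sum_congr rfl fun i _ => Finset.sum_congr rfl fun k _ => ?_
  have hsymm : SameSide M k i ↔ SameSide M i k := Iff.comm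
  simp only [hsymm, mul_comm (flow K μ k), ← add_div, ← sub_div]
  split_ifs
  · rw [min_comm (far μ M k)]
    rcases le_total (far μ M i) (far μ M k) with h | h
    · rw [min_eq_left h]
      ring
    · rw [min_eq_right h]
      ring
  · simp

end IrreducibleChain

end KilledGreen

/-! ### The chain killed at a vertex -/

section Killed

variable {n : ℕ} {K : Matrix (Fin (n + 1)) (Fin (n + 1)) ℝ} {μ : Fin (n + 1) → ℝ}
  {M j : Fin (n + 1)} {Ω : Type*} {X : ℕ → Ω → Fin (n + 1)}

/-- The event that the process `X` does not visit `M` up to time `m`. -/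
def avoid (X : ℕ → Ω → Fin (n + 1)) (M : Fin (n + 1)) (m : ℕ) : Set Ω :=
  {ω | ∀ k ≤ m, X k ω ≠ M}

lemma avoid_succ_inter_eq {z : Fin (n + 1)} (hz : z ≠ M) (m : ℕ) :
    avoid X M (m + 1) ∩ {ω | X (m + 1) ω = z} = avoid X M m ∩ {ω | X (m + 1) ω = z} := by
  ext ω
  refine and_congr_left fun hω => ?_
  simp only [avoid, Set.mem_ofPred_eq, ← Nat.lt_succ_iff, Nat.forall_lt_succ_right]
  exact and_iff_left (hω.trans_ne hz)

variable [MeasurableSpace Ω] {P : Measure Ω}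

lemma measurableSet_avoid (hX : ∀ m, Measurable (X m)) (M : Fin (n + 1)) (m : ℕ) :
    MeasurableSet (avoid X M m) := by
  have hinter : avoid X M m = ⋂ k ≤ m, X k ⁻¹' {M}ᶜ := by
    ext ω
    simp [avoid]
  rw [hinter]
  exact MeasurableSet.iInter fun k => MeasurableSet.iInter fun _ =>
    hX k (measurableSet_singleton M).compl

lemma measure_preimage_inter_eq_sum {α : Type*} [MeasurableSpace α] [MeasurableSingletonClass α]
    {Y : Ω → α} (hY : Measurable Y) (S : Finset α) (B : Set Ω) :
    P (Y ⁻¹' S ∩ B) = ∑ p ∈ S, P (Y ⁻¹' {p} ∩ B) := by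
  have hfib (p : α) : MeasurableSet (Y ⁻¹' {p}) := hY (measurableSet_singleton p)
  have h := sum_measure_preimage_singleton (μ := P.restrict B) S fun p _ => hfib p
  rw [Measure.restrict_apply (hY S.measurableSet)] at h
  simp only [← h, Measure.restrict_apply (hfib _)]

namespace IsMarkovChain

lemma measure_path_inter (hX : IsMarkovChain K j X P) {m : ℕ}
    (p : Fin (m + 1) → Fin (n + 1)) (z : Fin (n + 1)) :
    P ({ω | ∀ k : Fin (m + 1), X k ω = p k} ∩ {ω | X (m + 1) ω = z}) =
      P {ω | ∀ k : Fin (m + 1), X k ω = p k} * ENNReal.ofReal (K (p (Fin.last m)) z) := by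
  let x (k : ℕ) : Fin (n + 1) := if h : k < m + 1 then p ⟨k, h⟩ else z
  have hx (k : ℕ) (h : k < m + 1) : x k = p ⟨k, h⟩ := dif_pos h
  have hxz : x (m + 1) = z := dif_neg (lt_irrefl _)
  have hpath : {ω | ∀ k ≤ m, X k ω = x k} = {ω | ∀ k : Fin (m + 1), X k ω = p k} := by
    ext ω
    simp only [Set.mem_ofPred_eq, Fin.forall_iff, ← Nat.lt_succ_iff]
    exact forall₂_congr fun k hk => by rw [hx k hk]
  have hstep : {ω | ∀ k ≤ m + 1, X k ω = x k} =
      {ω | ∀ k ≤ m, X k ω = x k} ∩ {ω | X (m + 1) ω = z} := by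
    ext ω
    simp only [Set.mem_ofPred_eq, Set.mem_inter_iff, ← Nat.lt_succ_iff, ← hxz]
    exact Nat.forall_lt_succ_right
  rw [← hpath, ← hstep, hX.step, hxz, hx m m.lt_succ_self]
  rfl

lemma measure_avoid_inter (hX : IsMarkovChain K j X P) (m : ℕ) (y z : Fin (n + 1)) :
    P (avoid X M m ∩ {ω | X m ω = y} ∩ {ω | X (m + 1) ω = z}) =
      P (avoid X M m ∩ {ω | X m ω = y}) * ENNReal.ofReal (K y z) := by
  let Y (ω : Ω) (k : Fin (m + 1)) : Fin (n + 1) := X k ω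
  have hY : Measurable Y := measurable_pi_lambda _ fun k => hX.measurable k
  let S : Finset (Fin (m + 1) → Fin (n + 1)) := {p | (∀ k, p k ≠ M) ∧ p (Fin.last m) = y}
  have hS : avoid X M m ∩ {ω | X m ω = y} = Y ⁻¹' S := by
    ext ω
    simp [avoid, S, Y, Fin.forall_iff]
  have hfib (p : Fin (m + 1) → Fin (n + 1)) : Y ⁻¹' {p} = {ω | ∀ k : Fin (m + 1), X k ω = p k} := by
    ext ω
    exact funext_iff
  have hsum := measure_preimage_inter_eq_sum (P := P) hY S Set.univ
  simp only [Set.inter_univ] at hsum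
  rw [hS, measure_preimage_inter_eq_sum hY, hsum, Finset.sum_mul]
  refine Finset.sum_congr rfl fun p hp => ?_
  rw [hfib, hX.measure_path_inter, (Finset.mem_filter.1 hp).2.2]

end IsMarkovChain

/-- The sub-probability of being at `x` at time `m` without having visited `M`. -/
noncomputable def killed (X : ℕ → Ω → Fin (n + 1)) (M : Fin (n + 1)) (P : Measure Ω) (m : ℕ)
    (x : Fin (n + 1)) : ℝ :=
  P.real (avoid X M m ∩ {ω | X m ω = x})

/-- The expectation of `f (X m)` on the event that `M` has not been visited up to time `m`. -/
noncomputable def killedMean (X : ℕ → Ω → Fin (n + 1)) (M : Fin (n + 1)) (P : Measure Ω)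
    (f : Fin (n + 1) → ℝ) (m : ℕ) : ℝ :=
  ∑ x, killed X M P m x * f x

lemma killed_nonneg (X : ℕ → Ω → Fin (n + 1)) (M : Fin (n + 1)) (P : Measure Ω) (m : ℕ)
    (x : Fin (n + 1)) : 0 ≤ killed X M P m x :=
  measureReal_nonneg

lemma killed_self (X : ℕ → Ω → Fin (n + 1)) (M : Fin (n + 1)) (P : Measure Ω) (m : ℕ) :
    killed X M P m M = 0 := by
  have hempty : avoid X M m ∩ {ω | X m ω = M} = ∅ :=
    Set.eq_empty_of_forall_notMem fun ω hω => hω.1 m le_rfl hω.2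
  rw [killed, hempty, measureReal_empty]

lemma killedMean_nonneg {f : Fin (n + 1) → ℝ} (hf : ∀ x, 0 ≤ f x) (m : ℕ) :
    0 ≤ killedMean X M P f m :=
  Finset.sum_nonneg fun x _ => mul_nonneg (killed_nonneg X M P m x) (hf x)

lemma killedMean_congr {f f' : Fin (n + 1) → ℝ} (h : ∀ x, x ≠ M → f x = f' x) (m : ℕ) :
    killedMean X M P f m = killedMean X M P f' m := by
  refine Finset.sum_congr rfl fun x _ => ?_
  rcases eq_or_ne x M with rfl | hx
  · rw [killed_self, zero_mul, zero_mul]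
  · rw [h x hx]

variable [IsProbabilityMeasure P]

lemma measureReal_eq_sum_inter {α : Type*} [Fintype α] [MeasurableSpace α]
    [MeasurableSingletonClass α] {Y : Ω → α} (hY : Measurable Y) (B : Set Ω) :
    P.real B = ∑ x, P.real (B ∩ {ω | Y ω = x}) := by
  have h := measure_preimage_inter_eq_sum (P := P) hY Finset.univ B
  rw [Finset.coe_univ, Set.preimage_univ, Set.univ_inter] at h
  rw [measureReal_def, h, ENNReal.toReal_sum fun _ _ => measure_ne_top _ _]
  exact Finset.sum_congr rfl fun x _ => by rw [Set.inter_comm]; rfl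

lemma killedMean_one (hX : ∀ m, Measurable (X m)) (m : ℕ) :
    killedMean X M P 1 m = P.real (avoid X M m) := by
  simp only [killedMean, Pi.one_apply, mul_one, killed]
  exact (measureReal_eq_sum_inter (hX m) _).symm

lemma exists_killedMean_le (hX : ∀ m, Measurable (X m)) (f : Fin (n + 1) → ℝ) :
    ∃ B, ∀ m, killedMean X M P f m ≤ B * P.real (avoid X M m) := by
  refine ⟨∑ x, |f x|, fun m => ?_⟩
  rw [← killedMean_one hX, killedMean, killedMean, Finset.mul_sum]
  refine Finset.sum_le_sum fun x _ => ?_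
  rw [Pi.one_apply, mul_one, mul_comm]
  refine mul_le_mul_of_nonneg_right ((le_abs_self _).trans ?_) (killed_nonneg X M P m x)
  exact Finset.single_le_sum (f := fun x => |f x|) (fun _ _ => abs_nonneg _) (Finset.mem_univ x)

namespace IsMarkovChain

lemma killed_zero (hX : IsMarkovChain K j X P) {x : Fin (n + 1)} (hx : x ≠ M) :
    killed X M P 0 x = if x = j then 1 else 0 := by
  have havoid : avoid X M 0 ∩ {ω | X 0 ω = x} = {ω | X 0 ω = x} :=
    Set.inter_eq_right.2 fun ω hω k hk => by
      rw [nonpos_iff_eq_zero.1 hk]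
      exact hω.trans_ne hx
  rw [killed, havoid]
  split_ifs with h
  · rw [h, measureReal_congr (eventuallyEq_univ.2 hX.init), probReal_univ]
  · rw [measureReal_def, measure_eq_zero_iff_ae_notMem.2, ENNReal.toReal_zero]
    filter_upwards [hX.init] with ω hω hωx
    exact h (hωx.symm.trans hω)

lemma killed_succ (hX : IsMarkovChain K j X P) (hK : ∀ x y, 0 ≤ K x y) (m : ℕ)
    {z : Fin (n + 1)} (hz : z ≠ M) :
    killed X M P (m + 1) z = ∑ y, killed X M P m y * K y z := by
  rw [killed, avoid_succ_inter_eq hz, measureReal_eq_sum_inter (hX.measurable m)]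
  refine Finset.sum_congr rfl fun y _ => ?_
  rw [Set.inter_right_comm, measureReal_def, hX.measure_avoid_inter, ENNReal.toReal_mul,
    ENNReal.toReal_ofReal (hK y z)]
  rfl

lemma killedMean_zero (hX : IsMarkovChain K j X P) {f : Fin (n + 1) → ℝ} (hf : f M = 0) :
    killedMean X M P f 0 = f j := by
  have hterm (x : Fin (n + 1)) : killed X M P 0 x * f x = if x = j then f x else 0 := by
    rcases eq_or_ne x M with rfl | hx
    · rw [hf, mul_zero, ite_self]
    · rw [hX.killed_zero hx, ite_mul, one_mul, zero_mul]
  simp [killedMean, hterm]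

lemma killedMean_succ (hX : IsMarkovChain K j X P) (hK : ∀ x y, 0 ≤ K x y)
    {f : Fin (n + 1) → ℝ} (hf : f M = 0) (m : ℕ) :
    killedMean X M P f (m + 1) = killedMean X M P f m - killedMean X M P (gen K f) m := by
  have hterm (z : Fin (n + 1)) :
      killed X M P (m + 1) z * f z = ∑ y, killed X M P m y * (K y z * f z) := by
    rcases eq_or_ne z M with rfl | hz
    · simp only [hf, mul_zero, Finset.sum_const_zero]
    · simp only [hX.killed_succ hK m hz, Finset.sum_mul, mul_assoc]
  simp only [killedMean, hterm]
  rw [Finset.sum_comm, ← Finset.sum_sub_distrib]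
  refine Finset.sum_congr rfl fun y _ => ?_
  rw [gen_apply, ← Finset.mul_sum, mul_sub, sub_sub_cancel]
  rfl

lemma killedMean_killedGreen_succ (hX : IsMarkovChain K j X P) (hC : IrreducibleChain K μ)
    (y : Fin (n + 1) → ℝ) (m : ℕ) :
    killedMean X M P (killedGreen K μ M y) (m + 1) =
      killedMean X M P (killedGreen K μ M y) m - killedMean X M P y m := by
  rw [hX.killedMean_succ hC.apply_nonneg (killedGreen_self K μ y M),
    killedMean_congr fun x hx => hC.gen_killedGreen y hx]

lemma sum_range_killedMean (hX : IsMarkovChain K j X P) (hC : IrreducibleChain K μ)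
    (y : Fin (n + 1) → ℝ) (N : ℕ) :
    ∑ m ∈ Finset.range N, killedMean X M P y m =
      killedGreen K μ M y j - killedMean X M P (killedGreen K μ M y) N := by
  have htel (m : ℕ) : killedMean X M P y m = killedMean X M P (killedGreen K μ M y) m -
      killedMean X M P (killedGreen K μ M y) (m + 1) := by
    rw [hX.killedMean_killedGreen_succ hC, sub_sub_cancel]
  simp only [htel]
  rw [Finset.sum_range_sub', hX.killedMean_zero (killedGreen_self K μ y M)]

lemma sum_range_succ_mul_killedMean (hX : IsMarkovChain K j X P) (hC : IrreducibleChain K μ)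
    (y : Fin (n + 1) → ℝ) (N : ℕ) :
    ∑ m ∈ Finset.range N, ((m : ℝ) + 1) * killedMean X M P y m =
      killedGreen K μ M (killedGreen K μ M y) j -
        (killedMean X M P (killedGreen K μ M (killedGreen K μ M y)) N +
          N * killedMean X M P (killedGreen K μ M y) N) := by
  induction N with
  | zero => simp [hX.killedMean_zero (killedGreen_self K μ _ M)]
  | succ N ih =>
    rw [Finset.sum_range_succ, ih, hX.killedMean_killedGreen_succ hC,
      hX.killedMean_killedGreen_succ hC]
    push_cast
    ring

lemma summable_succ_mul_measureReal_avoid (hX : IsMarkovChain K j X P)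
    (hC : IrreducibleChain K μ) :
    Summable fun m : ℕ => ((m : ℝ) + 1) * P.real (avoid X M m) := by
  refine summable_of_sum_range_le (c := killedGreen K μ M (killedGreen K μ M 1) j)
    (fun m => mul_nonneg (by positivity) measureReal_nonneg) fun N => ?_
  have hg := hC.killedGreen_nonneg (M := M) fun _ => zero_le_one
  simp only [← killedMean_one hX.measurable]
  rw [hX.sum_range_succ_mul_killedMean hC, sub_le_self_iff]
  exact add_nonneg (killedMean_nonneg (hC.killedGreen_nonneg hg) N)
    (mul_nonneg N.cast_nonneg (killedMean_nonneg hg N))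

lemma tendsto_succ_mul_killedMean (hX : IsMarkovChain K j X P) (hC : IrreducibleChain K μ)
    {f : Fin (n + 1) → ℝ} (hf : ∀ x, 0 ≤ f x) :
    Tendsto (fun m : ℕ => ((m : ℝ) + 1) * killedMean X M P f m) atTop (𝓝 0) := by
  obtain ⟨B, hB⟩ := exists_killedMean_le (M := M) (P := P) hX.measurable f
  have hlim := (hX.summable_succ_mul_measureReal_avoid (M := M) hC).tendsto_atTop_zero.const_mul B
  rw [mul_zero] at hlim
  refine squeeze_zero (fun m => mul_nonneg (by positivity) (killedMean_nonneg hf m))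
    (fun m => ?_) hlim
  rw [mul_left_comm]
  exact mul_le_mul_of_nonneg_left (hB m) (by positivity)

lemma tendsto_killedMean (hX : IsMarkovChain K j X P) (hC : IrreducibleChain K μ)
    {f : Fin (n + 1) → ℝ} (hf : ∀ x, 0 ≤ f x) :
    Tendsto (killedMean X M P f) atTop (𝓝 0) :=
  squeeze_zero (killedMean_nonneg hf)
    (fun m => le_mul_of_one_le_left (killedMean_nonneg hf m) (by simp))
    (hX.tendsto_succ_mul_killedMean hC hf)

lemma hasSum_measureReal_avoid (hX : IsMarkovChain K j X P) (hC : IrreducibleChain K μ) :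
    HasSum (fun m => P.real (avoid X M m)) (killedGreen K μ M 1 j) := by
  have hg : ∀ x, 0 ≤ killedGreen K μ M 1 x := hC.killedGreen_nonneg fun _ => zero_le_one
  have hlim := hX.tendsto_killedMean (M := M) hC hg
  rw [hasSum_iff_tendsto_nat_of_nonneg fun _ => measureReal_nonneg]
  simp only [← killedMean_one hX.measurable, hX.sum_range_killedMean hC]
  simpa only [sub_zero] using hlim.const_sub (killedGreen K μ M 1 j)

lemma hasSum_succ_mul_measureReal_avoid (hX : IsMarkovChain K j X P)
    (hC : IrreducibleChain K μ) :
    HasSum (fun m : ℕ => ((m : ℝ) + 1) * P.real (avoid X M m))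
      (killedGreen K μ M (killedGreen K μ M 1) j) := by
  have hg : ∀ x, 0 ≤ killedGreen K μ M 1 x := hC.killedGreen_nonneg fun _ => zero_le_one
  have hlim₂ := hX.tendsto_killedMean (M := M) hC (hC.killedGreen_nonneg (M := M) hg)
  have hlim : Tendsto (fun m : ℕ => m * killedMean X M P (killedGreen K μ M 1) m) atTop (𝓝 0) :=
    squeeze_zero (fun m => mul_nonneg m.cast_nonneg (killedMean_nonneg hg m))
      (fun m => mul_le_mul_of_nonneg_right (by simp) (killedMean_nonneg hg m))
      (hX.tendsto_succ_mul_killedMean hC hg)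
  rw [hasSum_iff_tendsto_nat_of_nonneg fun m => mul_nonneg (by positivity) measureReal_nonneg]
  simp only [← killedMean_one hX.measurable, hX.sum_range_succ_mul_killedMean hC]
  simpa only [add_zero, sub_zero] using
    (hlim₂.add hlim).const_sub (killedGreen K μ M (killedGreen K μ M 1) j)

end IsMarkovChain

end Killed

/-! ### Moments of the hitting times -/

section RandomTime

variable {Ω : Type*} [MeasurableSpace Ω] {P : Measure Ω}

lemma tsum_ite_natCast_lt_natCast (N : ℕ) (c : ℕ → ℝ≥0∞) :
    ∑' m : ℕ, (if (m : ℝ≥0∞) < N then c m else 0) = ∑ m ∈ Finset.range N, c m := by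
  simp only [Nat.cast_lt, ← Finset.mem_range]
  rw [tsum_eq_sum (s := Finset.range N) fun m hm => if_neg hm]
  exact Finset.sum_congr rfl fun m hm => if_pos hm

lemma eq_tsum_ite_natCast_lt {τ : ℝ≥0∞} (h : τ = ∞ ∨ ∃ N : ℕ, τ = N) :
    τ = ∑' m : ℕ, if (m : ℝ≥0∞) < τ then 1 else 0 := by
  rcases h with rfl | ⟨N, rfl⟩
  · simp
  · rw [tsum_ite_natCast_lt_natCast N fun _ => 1]
    simp

lemma sq_eq_tsum_ite_natCast_lt {τ : ℝ≥0∞} (h : τ = ∞ ∨ ∃ N : ℕ, τ = N) :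
    τ ^ 2 = ∑' m : ℕ, if (m : ℝ≥0∞) < τ then (2 * m + 1 : ℝ≥0∞) else 0 := by
  rcases h with rfl | ⟨N, rfl⟩
  · simp only [ENNReal.natCast_lt_top, if_true]
    rw [ENNReal.top_pow two_ne_zero, eq_comm, eq_top_iff,
      ← ENNReal.tsum_const_eq_top_of_ne_zero (α := ℕ) (c := 1) one_ne_zero]
    exact ENNReal.tsum_le_tsum fun m => le_add_self
  · rw [tsum_ite_natCast_lt_natCast N fun m => 2 * m + 1]
    induction N with
    | zero => simp
    | succ N ih =>
      rw [Finset.sum_range_succ, ← ih]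
      push_cast
      ring

lemma tsum_ofReal_of_hasSum {f : ℕ → ℝ} {a : ℝ} (hf : ∀ m, 0 ≤ f m) (h : HasSum f a) :
    ∑' m, ENNReal.ofReal (f m) = ENNReal.ofReal a := by
  rw [← ENNReal.ofReal_tsum_of_nonneg hf h.summable, h.tsum_eq]

lemma hasMeanVar_of_lintegral_eq [IsProbabilityMeasure P] {τ : Ω → ℝ≥0∞}
    (hτ : AEMeasurable τ P) {a b : ℝ} (ha : 0 ≤ a) (hb : 0 ≤ b)
    (hmean : ∫⁻ ω, τ ω ∂P = ENNReal.ofReal a) (hsq : ∫⁻ ω, τ ω ^ 2 ∂P = ENNReal.ofReal b) :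
    HasMeanVar τ P ∧ mean τ P = a ∧ var τ P = b - a ^ 2 := by
  have hτ2 : AEMeasurable (fun ω => τ ω ^ 2) P := hτ.pow_const 2
  have htop : ∫⁻ ω, τ ω ∂P ≠ ∞ := hmean.trans_ne ENNReal.ofReal_ne_top
  have htop2 : ∫⁻ ω, τ ω ^ 2 ∂P ≠ ∞ := hsq.trans_ne ENNReal.ofReal_ne_top
  have hL2 : MemLp (fun ω => (τ ω).toReal) 2 P := by
    rw [memLp_two_iff_integrable_sq hτ.ennreal_toReal.aestronglyMeasurable]
    simpa only [← ENNReal.toReal_pow] using integrable_toReal_of_lintegral_ne_top hτ2 htop2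
  have hE : ∫ ω, (τ ω).toReal ∂P = a := by
    rw [integral_toReal hτ (ae_lt_top' hτ htop), hmean, ENNReal.toReal_ofReal ha]
  have hE2 : ∫ ω, (τ ω).toReal ^ 2 ∂P = b := by
    simp only [← ENNReal.toReal_pow]
    rw [integral_toReal hτ2 (ae_lt_top' hτ2 htop2), hsq, ENNReal.toReal_ofReal hb]
  refine ⟨⟨(ae_lt_top' hτ htop).mono fun ω h => h.ne, hL2⟩, hE, ?_⟩
  rw [var, variance_eq_sub hL2, hE, ← hE2]
  rfl

end RandomTime

section Hit

variable {n : ℕ} {M : Fin (n + 1)} {Ω : Type*} {X : ℕ → Ω → Fin (n + 1)}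

lemma natCast_lt_hit_iff {ω : Ω} {m : ℕ} : (m : ℝ≥0∞) < hit X M ω ↔ ω ∈ avoid X M m := by
  refine ⟨fun h k hk hX => h.not_ge ((iInf₂_le k hX).trans (Nat.cast_le.2 hk)), fun h => ?_⟩
  refine (Nat.cast_lt.2 m.lt_succ_self).trans_le (le_iInf₂ fun k hX => Nat.cast_le.2 ?_)
  exact Nat.succ_le_of_lt (not_le.1 fun hk => h k hk hX)

lemma hit_eq_top_or_natCast (ω : Ω) : hit X M ω = ∞ ∨ ∃ N : ℕ, hit X M ω = N := by
  classical
  by_cases h : ∃ k, X k ω = M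
  · have hle : hit X M ω ≤ (Nat.find h : ℕ) := iInf₂_le (Nat.find h) (Nat.find_spec h)
    refine .inr ⟨Nat.find h, le_antisymm hle ?_⟩
    exact le_iInf₂ fun k hX => Nat.cast_le.2 (Nat.find_min' h hX)
  · refine .inl ?_
    simp only [hit, not_exists.1 h, iInf_false, iInf_top]

variable [MeasurableSpace Ω] {P : Measure Ω}

lemma measurable_hit (hX : ∀ m, Measurable (X m)) : Measurable (hit X M) := by
  refine Measurable.iInf fun m => ?_
  simp only [iInf_eq_if]
  exact Measurable.ite (hX m (measurableSet_singleton M)) measurable_const measurable_const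

lemma lintegral_tsum_ite_natCast_lt_hit (hX : ∀ m, Measurable (X m)) (c : ℕ → ℝ≥0∞) :
    ∫⁻ ω, ∑' m : ℕ, (if (m : ℝ≥0∞) < hit X M ω then c m else 0) ∂P =
      ∑' m, c m * P (avoid X M m) := by
  have hind (m : ℕ) (ω : Ω) : (if (m : ℝ≥0∞) < hit X M ω then c m else 0) =
      (avoid X M m).indicator (fun _ => c m) ω := by
    classical
    rw [Set.indicator]
    exact if_congr natCast_lt_hit_iff rfl rfl
  simp only [hind]
  rw [lintegral_tsum fun m =>
    (measurable_const.indicator (measurableSet_avoid hX M m)).aemeasurable]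
  simp only [lintegral_indicator_const (measurableSet_avoid hX M _)]

lemma hit_moments [IsProbabilityMeasure P] (hX : ∀ m, Measurable (X m)) {a b : ℝ}
    (ha : HasSum (fun m => P.real (avoid X M m)) a)
    (hb : HasSum (fun m : ℕ => ((m : ℝ) + 1) * P.real (avoid X M m)) b) :
    HasMeanVar (hit X M) P ∧ mean (hit X M) P = a ∧ var (hit X M) P = 2 * b - a - a ^ 2 := by
  have hq (m : ℕ) : 0 ≤ P.real (avoid X M m) := measureReal_nonneg
  have hq₂ (m : ℕ) : 0 ≤ (2 * (m : ℝ) + 1) * P.real (avoid X M m) :=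
    mul_nonneg (by positivity) (hq m)
  have hsq : HasSum (fun m : ℕ => (2 * (m : ℝ) + 1) * P.real (avoid X M m)) (2 * b - a) :=
    ((hb.mul_left 2).sub ha).congr_fun fun m => by ring
  refine hasMeanVar_of_lintegral_eq (measurable_hit hX).aemeasurable (ha.nonneg hq)
    (hsq.nonneg hq₂) ?_ ?_
  · rw [lintegral_congr fun ω => eq_tsum_ite_natCast_lt (hit_eq_top_or_natCast ω),
      lintegral_tsum_ite_natCast_lt_hit hX, ← tsum_ofReal_of_hasSum hq ha]
    exact tsum_congr fun m => by rw [one_mul, ofReal_measureReal]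
  · rw [lintegral_congr fun ω => sq_eq_tsum_ite_natCast_lt (hit_eq_top_or_natCast ω),
      lintegral_tsum_ite_natCast_lt_hit hX, ← tsum_ofReal_of_hasSum hq₂ hsq]
    refine tsum_congr fun m => ?_
    rw [ENNReal.ofReal_mul (by positivity), ofReal_measureReal,
      ENNReal.ofReal_add (by positivity) zero_le_one, ENNReal.ofReal_mul zero_le_two,
      ENNReal.ofReal_natCast, ENNReal.ofReal_ofNat, ENNReal.ofReal_one]

end Hit

section CountingPath

variable {f : ℝ≥0 → ℕ}

/-- `f` counts the terms, up to time `t`, of a strictly increasing sequence of positive arrival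
times tending to infinity. The property holds for almost every path of a Poisson process. -/
def IsCountingPath (f : ℝ≥0 → ℕ) : Prop :=
  ∃ S : ℕ → ℝ≥0, 0 < S 0 ∧ StrictMono S ∧ Tendsto S atTop atTop ∧
    ∀ t, f t = {k : ℕ | S k ≤ t}.ncard

namespace IsCountingPath

lemma exists_arrivals (hf : IsCountingPath f) :
    ∃ S : ℕ → ℝ≥0, 0 < S 0 ∧ StrictMono S ∧ ∀ t k, k < f t ↔ S k ≤ t := by
  classical
  obtain ⟨S, hS0, hmono, hlim, hcount⟩ := hf
  refine ⟨S, hS0, hmono, fun t k => ?_⟩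
  have hex : ∃ m, t < S m := (hlim.eventually_gt_atTop t).exists
  have hiff (k : ℕ) : S k ≤ t ↔ k < Nat.find hex := by
    simp only [Nat.lt_find_iff, not_lt]
    exact ⟨fun h m hm => (hmono.monotone hm).trans h, fun h => h k le_rfl⟩
  have hset : {k : ℕ | S k ≤ t} = Finset.range (Nat.find hex) := by
    ext k
    rw [Finset.coe_range, Set.mem_Iio, ← hiff, Set.mem_ofPred_eq]
  rw [hcount, hset, Set.ncard_coe_finset, Finset.card_range, hiff]

lemma apply_zero (hf : IsCountingPath f) : f 0 = 0 := by
  obtain ⟨S, hS0, -, hlt⟩ := hf.exists_arrivals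
  by_contra h
  exact hS0.not_ge ((hlt 0 0).1 (Nat.pos_of_ne_zero h))

lemma exists_le_apply_eq (hf : IsCountingPath f) {t : ℝ≥0} {k : ℕ} (hk : k ≤ f t) :
    ∃ u ≤ t, f u = k := by
  obtain ⟨S, -, hmono, hlt⟩ := hf.exists_arrivals
  rcases k with _ | k
  · exact ⟨0, zero_le, hf.apply_zero⟩
  · refine ⟨S k, (hlt t k).1 hk, le_antisymm (not_lt.1 fun h => ?_) ((hlt _ _).2 le_rfl)⟩
    exact (hmono k.lt_succ_self).not_ge ((hlt (S k) (k + 1)).1 h)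

lemma exists_gt_forall_apply_le (hf : IsCountingPath f) (t : ℝ≥0) :
    ∃ s, t < s ∧ ∀ u < s, f u ≤ f t := by
  obtain ⟨S, -, -, hlt⟩ := hf.exists_arrivals
  exact ⟨S (f t), not_le.1 fun h => lt_irrefl _ ((hlt _ _).2 h), fun u hu =>
    not_lt.1 fun h => hu.not_ge ((hlt _ _).1 h)⟩

lemma exists_le_apply (hf : IsCountingPath f) (k : ℕ) : ∃ t, k ≤ f t := by
  obtain ⟨S, -, -, hlt⟩ := hf.exists_arrivals
  exact ⟨S k, ((hlt _ _).2 le_rfl).le⟩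

end IsCountingPath

end CountingPath

section Poisson

lemma IsPoissonProcess.measure_eq {Ω : Type*} [MeasurableSpace Ω] {P : Measure Ω}
    {N : ℝ≥0 → Ω → ℕ} (hN : IsPoissonProcess N P) (t : ℝ≥0) (k : ℕ) :
    P {ω | N t ω = k} = ENNReal.ofReal (Real.exp (-t) * t ^ k / k.factorial) := by
  have hdiff : (fun ω => N t ω - N 0 ω) =ᵐ[P] N t := by
    filter_upwards [hN.counting] with ω hω
    have h0 : N 0 ω = 0 := IsCountingPath.apply_zero hω
    rw [h0, Nat.sub_zero]
  have hlaw : P.map (N t) = poissonMeasure t := by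
    rw [← Measure.map_congr hdiff, hN.law 0 t zero_le, tsub_zero]
  rw [← poissonMeasure_singleton, ← hlaw,
    Measure.map_apply (hN.measurable t) (measurableSet_singleton k)]
  rfl

/-- The Poisson weight `e⁻ᵗ tᵏ / k!`, which is also the density of the `k`-th arrival time. -/
noncomputable def poissonWeight (k : ℕ) (t : ℝ) : ℝ≥0∞ :=
  ENNReal.ofReal (Real.exp (-t) * t ^ k / k.factorial)

lemma measurable_poissonWeight (k : ℕ) : Measurable (poissonWeight k) := by
  unfold poissonWeight
  fun_prop

lemma lintegral_poissonWeight (k : ℕ) : ∫⁻ t in Set.Ioi (0 : ℝ), poissonWeight k t = 1 := by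
  have hint := Real.GammaIntegral_convergent (s := (k : ℝ) + 1) (by positivity)
  have hGamma := Real.Gamma_eq_integral (s := (k : ℝ) + 1) (by positivity)
  rw [Real.Gamma_nat_eq_factorial] at hGamma
  simp only [add_sub_cancel_right, Real.rpow_natCast] at hint hGamma
  simp only [poissonWeight]
  rw [← ofReal_integral_eq_lintegral_ofReal (hint.div_const _)]
  · rw [integral_div, ← hGamma, div_self (by positivity), ENNReal.ofReal_one]
  · filter_upwards [ae_restrict_mem measurableSet_Ioi] with t ht
    have ht0 : (0 : ℝ) < t := ht
    exact div_nonneg (by positivity) (by positivity)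

lemma poissonWeight_mul_ofReal (k : ℕ) {t : ℝ} (ht : 0 ≤ t) :
    poissonWeight k t * ENNReal.ofReal t =
      ENNReal.ofReal ((k : ℝ) + 1) * poissonWeight (k + 1) t := by
  unfold poissonWeight
  rw [← ENNReal.ofReal_mul (by positivity), ← ENNReal.ofReal_mul (by positivity),
    Nat.factorial_succ]
  congr 1
  push_cast
  field_simp
  ring

end Poisson

section HitC

variable {n : ℕ} {M : Fin (n + 1)} {Ω : Type*} {X : ℕ → Ω → Fin (n + 1)} {N : ℝ≥0 → Ω → ℕ}

/-- The event that `t ↦ X (N t)` does not visit `M` up to time `t`. -/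
def avoidC (X : ℕ → Ω → Fin (n + 1)) (N : ℝ≥0 → Ω → ℕ) (M : Fin (n + 1)) (t : ℝ≥0) : Set Ω :=
  {ω | ω ∈ avoid X M (N t ω)}

lemma avoidC_eq_iUnion (X : ℕ → Ω → Fin (n + 1)) (N : ℝ≥0 → Ω → ℕ) (M : Fin (n + 1))
    (t : ℝ≥0) : avoidC X N M t = ⋃ k, avoid X M k ∩ {ω | N t ω = k} := by
  ext ω
  simp [avoidC]

lemma hitC_le_iff {ω : Ω} (hω : IsCountingPath (N · ω)) {t : ℝ≥0} :
    hitC X N M ω ≤ t ↔ ω ∉ avoidC X N M t := by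
  constructor
  · intro hle hav
    obtain ⟨s, hts, hs⟩ := hω.exists_gt_forall_apply_le t
    have hsle : (s : ℝ≥0∞) ≤ hitC X N M ω := le_iInf₂ fun u hu =>
      ENNReal.coe_le_coe.2 (not_lt.1 fun hus => hav _ (hs u hus) hu)
    exact hts.not_ge (ENNReal.coe_le_coe.1 (hsle.trans hle))
  · intro hav
    obtain ⟨k, hk, hX⟩ : ∃ k ≤ N t ω, X k ω = M := by simpa [avoidC, avoid] using hav
    obtain ⟨u, hut, rfl⟩ := hω.exists_le_apply_eq hk
    have hle : hitC X N M ω ≤ u := iInf₂_le u hX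
    exact hle.trans (ENNReal.coe_le_coe.2 hut)

lemma hitC_ne_top {ω : Ω} (hω : IsCountingPath (N · ω)) (hhit : hit X M ω ≠ ∞) :
    hitC X N M ω ≠ ∞ := by
  obtain ⟨k, hk⟩ : ∃ k, X k ω = M := by
    by_contra! hX
    exact hhit (by simp [hit, hX])
  obtain ⟨t, ht⟩ := hω.exists_le_apply k
  exact ne_top_of_le_ne_top ENNReal.coe_ne_top ((hitC_le_iff hω).2 fun hav => hav k ht hk)

variable [MeasurableSpace Ω] {P : Measure Ω}

lemma measurableSet_avoidC (hX : ∀ m, Measurable (X m)) (hN : IsPoissonProcess N P)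
    (t : ℝ≥0) : MeasurableSet (avoidC X N M t) := by
  rw [avoidC_eq_iUnion]
  exact MeasurableSet.iUnion fun k =>
    (measurableSet_avoid hX M k).inter (hN.measurable t (measurableSet_singleton k))

lemma aemeasurable_hitC (hX : ∀ m, Measurable (X m)) (hN : IsPoissonProcess N P) :
    AEMeasurable (hitC X N M) P := by
  have hnull (x : ℝ≥0∞) : NullMeasurableSet {ω | hitC X N M ω ≤ x} P := by
    rcases eq_or_ne x ∞ with rfl | hx
    · simp
    lift x to ℝ≥0 using hx
    refine (measurableSet_avoidC (M := M) hX hN x).compl.nullMeasurableSet.congr ?_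
    refine Filter.eventuallyEq_set.2 ?_
    filter_upwards [hN.counting] with ω hω using (hitC_le_iff hω).symm
  have hmeas : Measurable (fun ω : NullMeasurableSpace Ω P => hitC X N M (ω : Ω)) :=
    measurable_of_Iic hnull
  exact NullMeasurable.aemeasurable hmeas

lemma measure_avoidC (hX : ∀ m, Measurable (X m)) (hN : IsPoissonProcess N P)
    (hXN : IndepFun (fun ω (m : ℕ) => X m ω) (fun ω (t : ℝ≥0) => N t ω) P) (t : ℝ≥0) :
    P (avoidC X N M t) = ∑' k, P (avoid X M k) * poissonWeight k t := by
  have hdisj : Pairwise (Function.onFun Disjoint fun k => avoid X M k ∩ {ω | N t ω = k}) :=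
    fun i k hik => Set.disjoint_left.2 fun ω hi hk => hik (hi.2.symm.trans hk.2)
  rw [avoidC_eq_iUnion, measure_iUnion hdisj fun k =>
    (measurableSet_avoid hX M k).inter (hN.measurable t (measurableSet_singleton k))]
  refine tsum_congr fun k => ?_
  have hpath : MeasurableSet (avoid (fun i (x : ℕ → Fin (n + 1)) => x i) M k) :=
    measurableSet_avoid (fun i => measurable_pi_apply i) M k
  have hcount : MeasurableSet {x : ℝ≥0 → ℕ | x t = k} :=
    (measurable_pi_apply t : Measurable fun x : ℝ≥0 → ℕ => x t) (measurableSet_singleton k)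
  rw [poissonWeight, ← hN.measure_eq]
  exact hXN.measure_inter_preimage_eq_mul _ _ hpath hcount

lemma measure_lt_toReal_hitC (hX : ∀ m, Measurable (X m)) (hN : IsPoissonProcess N P)
    (hXN : IndepFun (fun ω (m : ℕ) => X m ω) (fun ω (t : ℝ≥0) => N t ω) P)
    (hfin : ∀ᵐ ω ∂P, hitC X N M ω ≠ ∞) {t : ℝ} (ht : 0 ≤ t) :
    P {ω | t < (hitC X N M ω).toReal} = ∑' k, P (avoid X M k) * poissonWeight k t := by
  lift t to ℝ≥0 using ht
  rw [← measure_avoidC hX hN hXN]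
  refine measure_congr (Filter.eventuallyEq_set.2 ?_)
  filter_upwards [hfin, hN.counting] with ω hω hcount
  have hiff : hitC X N M ω ≤ t ↔ ω ∉ avoidC X N M t := hitC_le_iff hcount
  rw [← not_iff_not, ← hiff, not_lt, ← ENNReal.ofReal_coe_nnreal,
    ENNReal.le_ofReal_iff_toReal_le hω t.coe_nonneg]

lemma lintegral_hitC (hX : ∀ m, Measurable (X m)) (hN : IsPoissonProcess N P)
    (hXN : IndepFun (fun ω (m : ℕ) => X m ω) (fun ω (t : ℝ≥0) => N t ω) P)
    (hfin : ∀ᵐ ω ∂P, hitC X N M ω ≠ ∞) :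
    ∫⁻ ω, hitC X N M ω ∂P = ∑' k, P (avoid X M k) := by
  have hmeas (k : ℕ) := measurable_poissonWeight k
  calc ∫⁻ ω, hitC X N M ω ∂P
      = ∫⁻ ω, ENNReal.ofReal (hitC X N M ω).toReal ∂P :=
        lintegral_congr_ae (hfin.mono fun ω hω => (ENNReal.ofReal_toReal hω).symm)
    _ = ∫⁻ t in Set.Ioi 0, P {ω | t < (hitC X N M ω).toReal} :=
        lintegral_eq_lintegral_meas_lt P (.of_forall fun ω => ENNReal.toReal_nonneg)
          (aemeasurable_hitC hX hN).ennreal_toReal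
    _ = ∫⁻ t in Set.Ioi 0, ∑' k, P (avoid X M k) * poissonWeight k t :=
        setLIntegral_congr_fun measurableSet_Ioi fun t ht =>
          measure_lt_toReal_hitC hX hN hXN hfin (le_of_lt ht)
    _ = ∑' k, P (avoid X M k) := by
        rw [lintegral_tsum fun k => ((hmeas k).const_mul _).aemeasurable]
        refine tsum_congr fun k => ?_
        rw [lintegral_const_mul _ (hmeas k), lintegral_poissonWeight, mul_one]

lemma lintegral_hitC_sq (hX : ∀ m, Measurable (X m)) (hN : IsPoissonProcess N P)
    (hXN : IndepFun (fun ω (m : ℕ) => X m ω) (fun ω (t : ℝ≥0) => N t ω) P)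
    (hfin : ∀ᵐ ω ∂P, hitC X N M ω ≠ ∞) :
    ∫⁻ ω, hitC X N M ω ^ 2 ∂P =
      2 * ∑' k : ℕ, ENNReal.ofReal ((k : ℝ) + 1) * P (avoid X M k) := by
  have hmeas (k : ℕ) := measurable_poissonWeight k
  have hdens {t : ℝ} (ht : 0 < t) :
      P {ω | t < (hitC X N M ω).toReal} * ENNReal.ofReal (t ^ ((2 : ℝ) - 1)) =
        ∑' k : ℕ, ENNReal.ofReal ((k : ℝ) + 1) * P (avoid X M k) * poissonWeight (k + 1) t := by
    rw [measure_lt_toReal_hitC hX hN hXN hfin ht.le, show (2 : ℝ) - 1 = 1 by norm_num,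
      Real.rpow_one, ← ENNReal.tsum_mul_right]
    refine tsum_congr fun k => ?_
    rw [mul_assoc, poissonWeight_mul_ofReal k ht.le, mul_assoc, mul_left_comm]
  calc ∫⁻ ω, hitC X N M ω ^ 2 ∂P
      = ∫⁻ ω, ENNReal.ofReal ((hitC X N M ω).toReal ^ (2 : ℝ)) ∂P := by
        refine lintegral_congr_ae (hfin.mono fun ω hω => ?_)
        simp only [Real.rpow_two, ENNReal.ofReal_pow ENNReal.toReal_nonneg,
          ENNReal.ofReal_toReal hω]
    _ = 2 * ∫⁻ t in Set.Ioi 0, P {ω | t < (hitC X N M ω).toReal} *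
          ENNReal.ofReal (t ^ ((2 : ℝ) - 1)) := by
        rw [lintegral_rpow_eq_lintegral_meas_lt_mul P (.of_forall fun ω => ENNReal.toReal_nonneg)
          (aemeasurable_hitC hX hN).ennreal_toReal zero_lt_two, ENNReal.ofReal_ofNat]
    _ = 2 * ∫⁻ t in Set.Ioi 0,
          ∑' k : ℕ, ENNReal.ofReal ((k : ℝ) + 1) * P (avoid X M k) * poissonWeight (k + 1) t := by
        rw [setLIntegral_congr_fun measurableSet_Ioi fun t ht => hdens ht]
    _ = 2 * ∑' k : ℕ, ENNReal.ofReal ((k : ℝ) + 1) * P (avoid X M k) := by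
        rw [lintegral_tsum fun k => ((hmeas (k + 1)).const_mul _).aemeasurable]
        congr 1
        refine tsum_congr fun k => ?_
        rw [lintegral_const_mul _ (hmeas (k + 1)), lintegral_poissonWeight, mul_one]

lemma hitC_moments [IsProbabilityMeasure P] (hX : ∀ m, Measurable (X m))
    (hN : IsPoissonProcess N P)
    (hXN : IndepFun (fun ω (m : ℕ) => X m ω) (fun ω (t : ℝ≥0) => N t ω) P) {a b : ℝ}
    (ha : HasSum (fun m => P.real (avoid X M m)) a)
    (hb : HasSum (fun m : ℕ => ((m : ℝ) + 1) * P.real (avoid X M m)) b) :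
    HasMeanVar (hitC X N M) P ∧ mean (hitC X N M) P = a ∧ var (hitC X N M) P = 2 * b - a ^ 2 := by
  have hq (m : ℕ) : 0 ≤ P.real (avoid X M m) := measureReal_nonneg
  have hq₁ (m : ℕ) : 0 ≤ ((m : ℝ) + 1) * P.real (avoid X M m) :=
    mul_nonneg (by positivity) (hq m)
  have hfin : ∀ᵐ ω ∂P, hitC X N M ω ≠ ∞ := by
    filter_upwards [hN.counting, (hit_moments hX ha hb).1.1] with ω hω hhit
      using hitC_ne_top hω hhit
  refine hasMeanVar_of_lintegral_eq (aemeasurable_hitC hX hN) (ha.nonneg hq)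
    (mul_nonneg zero_le_two (hb.nonneg hq₁)) ?_ ?_
  · rw [lintegral_hitC hX hN hXN hfin, ← tsum_ofReal_of_hasSum hq ha]
    exact tsum_congr fun m => (ofReal_measureReal (by finiteness)).symm
  · rw [lintegral_hitC_sq hX hN hXN hfin, ENNReal.ofReal_mul zero_le_two, ENNReal.ofReal_ofNat,
      ← tsum_ofReal_of_hasSum hq₁ hb]
    congr 1
    refine tsum_congr fun m => ?_
    rw [ENNReal.ofReal_mul (by positivity), ofReal_measureReal]

end HitC

lemma end_moments {n : ℕ} {K : Matrix (Fin (n + 1)) (Fin (n + 1)) ℝ} {μ : Fin (n + 1) → ℝ}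
    (hC : IrreducibleChain K μ) {Ω : Type*} [MeasurableSpace Ω] {P : Fin (n + 1) → Measure Ω}
    [∀ j, IsProbabilityMeasure (P j)] {X : ℕ → Ω → Fin (n + 1)} {N : ℝ≥0 → Ω → ℕ}
    (hX : ∀ j, IsMarkovChain K j X (P j)) (hN : ∀ j, IsPoissonProcess N (P j))
    (hXN : ∀ j, IndepFun (fun ω (m : ℕ) => X m ω) (fun ω (t : ℝ≥0) => N t ω) (P j))
    (M : Fin (n + 1)) :
    (∀ j, HasMeanVar (hitC X N M) (P j) ∧ HasMeanVar (hit X M) (P j)) ∧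
      endMean P (hitC X N M) = hitMean K μ M ∧ endMean P (hit X M) = hitMean K μ M ∧
      endDev P (hitC X N M) = √(hitVar K μ M) ∧
      endDev P (hit X M) = √(hitVar K μ M - hitMean K μ M) := by
  have hd (j : Fin (n + 1)) := hit_moments (M := M) (hX j).measurable
    ((hX j).hasSum_measureReal_avoid hC) ((hX j).hasSum_succ_mul_measureReal_avoid hC)
  have hc (j : Fin (n + 1)) := hitC_moments (M := M) (hX j).measurable (hN j) (hXN j)
    ((hX j).hasSum_measureReal_avoid hC) ((hX j).hasSum_succ_mul_measureReal_avoid hC)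
  have hmean := hC.killedGreen_one_zero_add_last M
  have hvar := hC.two_mul_killedGreen_sub_sq M
  refine ⟨fun j => ⟨(hc j).1, (hd j).1⟩, ?_, ?_, ?_, ?_⟩
  · rw [endMean, (hc _).2.1, (hc _).2.1, hmean]
  · rw [endMean, (hd _).2.1, (hd _).2.1, hmean]
  · rw [endDev, (hc _).2.2, (hc _).2.2, ← hvar]
    congr 1
    ring
  · rw [endDev, (hd _).2.2, (hd _).2.2, ← hvar, ← hmean]
    congr 1
    ring

end BDCutoff

theorem theorem1p3
    -- irreducible birth and death chains on `{0, …, n}`, `n ≥ 1`, and their stationary laws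
    (K : (n : ℕ) → Matrix (Fin (n + 1)) (Fin (n + 1)) ℝ)
    (μ : (n : ℕ) → Fin (n + 1) → ℝ)
    (hK : ∀ n, 1 ≤ n → BDCutoff.IsBirthDeath (K n))
    (hirr : ∀ n, 1 ≤ n → (K n).IsIrreducible)
    (hμ : ∀ n, 1 ≤ n → BDCutoff.IsStationary (K n) (μ n))
    -- the discrete time chains `X n`, run from each starting state `j` under the law `P n j`,
    -- and rate one Poisson processes `N n` independent of them
    (Ω : ℕ → Type*) [∀ n, MeasurableSpace (Ω n)]
    (P : (n : ℕ) → Fin (n + 1) → Measure (Ω n))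
    [∀ n j, IsProbabilityMeasure (P n j)]
    (X : (n : ℕ) → ℕ → Ω n → Fin (n + 1))
    (N : (n : ℕ) → ℝ≥0 → Ω n → ℕ)
    (hX : ∀ n, 1 ≤ n → ∀ j, BDCutoff.IsMarkovChain (K n) j (X n) (P n j))
    (hN : ∀ n, 1 ≤ n → ∀ j, BDCutoff.IsPoissonProcess (N n) (P n j))
    (hXN : ∀ n, 1 ≤ n → ∀ j,
      IndepFun (fun ω (m : ℕ) => X n m ω) (fun ω (t : ℝ≥0) => N n t ω) (P n j))
    -- the states `M n`, with mass bounded below on both sides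
    (M : (n : ℕ) → Fin (n + 1))
    (hMleft : ∃ δ : ℝ, 0 < δ ∧ ∀ n, 1 ≤ n → δ ≤ ∑ i ∈ Finset.Iic (M n), μ n i)
    (hMright : ∃ δ : ℝ, 0 < δ ∧ ∀ n, 1 ≤ n → δ ≤ ∑ i ∈ Finset.Ici (M n), μ n i)
    -- the constants
    (lam s b c : ℕ → ℝ)
    (hlam : ∀ n, lam n = BDCutoff.spectralGap (K n))
    (hs : ∀ n, s n = BDCutoff.endMean (P n) (BDCutoff.hitC (X n) (N n) (M n)))
    (hb : ∀ n, b n = BDCutoff.endDev (P n) (BDCutoff.hitC (X n) (N n) (M n)))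
    (hc : ∀ n, c n = BDCutoff.endDev (P n) (BDCutoff.hit (X n) (M n))) :
    -- the means and variances are meaningful, and `s n` is the same in discrete time
    (∀ n, 1 ≤ n → ∀ j, j = 0 ∨ j = Fin.last n →
      BDCutoff.HasMeanVar (BDCutoff.hitC (X n) (N n) (M n)) (P n j) ∧
      BDCutoff.HasMeanVar (BDCutoff.hit (X n) (M n)) (P n j)) ∧
    (∀ n, 1 ≤ n → s n = BDCutoff.endMean (P n) (BDCutoff.hit (X n) (M n))) ∧
    -- continuous time
    ((BDCutoff.HasCutoff (fun n ε => BDCutoff.sepTimeC (K n) (μ n) 0 ε) ↔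
        Tendsto (fun n => s n * lam n) atTop atTop) ∧
      (Tendsto (fun n => s n * lam n) atTop atTop ↔
        Tendsto (fun n => s n / b n) atTop atTop) ∧
      (Tendsto (fun n => s n / b n) atTop atTop →
        BDCutoff.HasCutoffWindow (fun n ε => BDCutoff.sepTimeC (K n) (μ n) 0 ε) s b)) ∧
    -- discrete time, for monotone chains
    ((∀ n, 1 ≤ n → ∀ i : Fin n,
        K n i.castSucc i.succ + K n i.succ i.castSucc ≤ 1) →
      (BDCutoff.HasCutoff (fun n ε => (BDCutoff.sepTime (K n) (μ n) 0 ε : ℝ)) ↔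
        Tendsto (fun n => s n * lam n) atTop atTop) ∧
      (Tendsto (fun n => s n * lam n) atTop atTop ↔
        Tendsto (fun n => s n / c n) atTop atTop) ∧
      (Tendsto (fun n => s n / c n) atTop atTop →
        BDCutoff.HasCutoffWindow (fun n ε => (BDCutoff.sepTime (K n) (μ n) 0 ε : ℝ)) s
          (fun n => max (c n) (1 / lam n)))) := by
  have hC : ∀ n, 1 ≤ n → BDCutoff.IrreducibleChain (K n) (μ n) := fun n hn =>
    ⟨hK n hn, hμ n hn, hirr n hn⟩
  have hmom := fun n hn =>
    BDCutoff.end_moments (hC n hn) (hX n hn) (hN n hn) (hXN n hn) (M n)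
  have hs' : ∀ n, 1 ≤ n → s n = BDCutoff.hitMean (K n) (μ n) (M n) := fun n hn =>
    (hs n).trans (hmom n hn).2.1
  have hb' : ∀ n, 1 ≤ n → b n = √(BDCutoff.hitVar (K n) (μ n) (M n)) := fun n hn =>
    (hb n).trans (hmom n hn).2.2.2.1
  have hc' : ∀ n, 1 ≤ n → c n =
      √(BDCutoff.hitVar (K n) (μ n) (M n) - BDCutoff.hitMean (K n) (μ n) (M n)) := fun n hn =>
    (hc n).trans (hmom n hn).2.2.2.2
  obtain ⟨δ₁, hδ₁, hl⟩ := hMleft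
  obtain ⟨δ₂, hδ₂, hr⟩ := hMright
  have hδ : 0 < min δ₁ δ₂ := lt_min hδ₁ hδ₂
  have hl' := fun n hn => (min_le_left δ₁ δ₂).trans (hl n hn)
  have hr' := fun n hn => (min_le_right δ₁ δ₂).trans (hr n hn)
  exact ⟨fun n hn j _ => (hmom n hn).1 j, fun n hn => (hs' n hn).trans (hmom n hn).2.2.1.symm,
    BDCutoff.continuous_cutoff hC hδ hl' hr' hlam hs' hb',
    fun hmono => BDCutoff.discrete_cutoff hC hδ hl' hr' hlam hs' hc' hmono⟩
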